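/- **Setting.** A colored hexagon is a hexagon with three pairwise non-adjacent sides colored red and the other three colored black. Let $(S,T)$ be an ideally triangulated surface: $S$ is obtained from a finite non-empty disjoint union of colored hexagons by identifying all red sides in pairs by homeomorphisms (two red sides of the same hexagon may be identified). The images of the red sides are the edges; $E$ is the set of edges. The images of the black sides are called A-arcs. By straightening the edges to shortest geodesic arcs orthogonal to the boundary, a hyperbolic metric on $S$ with totally geodesic boundary, up to isotopy, is the same as a realization of every 2-cell as a hyperbolic right-angled hexagon in which identified red sides have equal lengths, up to isometries carrying every labelled 2-cell to itself; the Teichmüller space $T(S)$ is the space of these. For $\lambda\in\mathbf R$ and a metric in $T(S)$, the $\psi_\lambda$ edge invariant is $$\psi_\lambda(e)=\int_0^{\frac{a+b-c}{2}}\cosh^\lambda(t)\,dt+\int_0^{\frac{a'+b'-c'}{2}}\cosh^\lambda(t)\,dt ,$$ where for each of the two red sides forming $e$, $a,b$ (resp. $a',b'$) are the lengths of the two A-arcs adjacent to that side in its hexagon and $c$ (resp. $c'$) is the length of the A-arc facing it. This defines $\Psi_\lambda:T(S)\to\mathbf R^E$. An edge path $(H_0,e_1,H_1,\dots,e_n,H_n)$,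 $n\ge 1$, is a sequence of hexagons and edges in which one passes from $H_{i-1}$ to $H_i$ across $e_i$, such that for $1\le i<n$ the path enters $H_i$ through one red side (lying over $e_i$) and leaves it through a different red side (lying over $e_{i+1}$). It is an edge cycle if $H_n=H_0$ and the red side of $H_0$ through which it finally enters (over $e_n$) differs from the one through which it first leaves (over $e_1$). An edge path or cycle is fundamental if every edge occurs at most twice among $e_1,\dots,e_n$. **Theorem.** Let $(S,T)$ be an ideally triangulated surface. For every $\lambda\in\mathbf R$, the image $\Psi_\lambda(T(S))$ is the set of all $z\in\mathbf R^E$ such that 1. $z(e)<2\int_0^\infty\cosh^\lambda(t)\,dt$ for each edge $e$; 2. $\sum_{i=1}^n z(e_i)>-2\int_0^\infty\cosh^\lambda(t)\,dt$ for each fundamental edge path $(H_0,e_1,H_1,\dots,e_n,H_n)$; 3. $\sum_{i=1}^n z(e_i)>0$ for each fundamental edge cycle $(H_0,e_1,H_1,\dots,e_n,H_n=H_0)$ (the integral is $+\infty$ when $\lambda\ge 0$). Consequently $\Psi_\lambda(T(S))$ is an open convex polytope, that is, an open convex set cut out by finitely many strict affine inequalities. Moreover, for $\lambda_1<\lambda_2<0<\lambda_3$,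 $$\Psi_{\lambda_1}(T(S))\subsetneq\Psi_{\lambda_2}(T(S))\subsetneq\Psi_0(T(S))=\Psi_{\lambda_3}(T(S)),$$ and $\bigcap_{\lambda<0}\Psi_\lambda(T(S))=\emptyset$. -/

import Mathlib

open scoped UpperHalfPlane ENNReal

noncomputable section

namespace LuoCoord

/-! ### Right-angled hexagons in the hyperbolic plane -/

/-- The image of `w` under the isometry `w ↦ (w - z) / (w - z̄)` from the upper half-plane onto the
Poincaré disk that sends `z` to the origin. Geodesics through the origin are diameters, so the
argument of this number is the direction at `z` of the geodesic from `z` to `w`. -/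
def direction (z w : ℍ) : ℂ := ((w : ℂ) - (z : ℂ)) / ((w : ℂ) - (starRingEnd ℂ) (z : ℂ))

/-- The oriented hyperbolic angle at `z`, in `(-π, π]`, counterclockwise from the geodesic ray
towards `u` to the geodesic ray towards `w`. -/
def orientedAngle (z u w : ℍ) : ℝ := (direction z w / direction z u).arg

/-- A colored hyperbolic right-angled hexagon, with vertices
`p 0, q 0, p 1, q 1, p 2, q 2` in counterclockwise order. The red sides are `[p i, q i]`, the black
sides (A-arcs) are `[q i, p (i + 1)]` (indices modulo 3), and all six interior angles are `π / 2`.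
(Adjacent vertices are automatically distinct, since `Complex.arg 0 = 0`.) -/
structure RightAngledHexagon where
  /-- the initial vertex of each red side -/
  p : Fin 3 → ℍ
  /-- the terminal vertex of each red side -/
  q : Fin 3 → ℍ
  angle_p : ∀ i, orientedAngle (p i) (q i) (q (i + 2)) = Real.pi / 2
  angle_q : ∀ i, orientedAngle (q i) (p (i + 1)) (p i) = Real.pi / 2

namespace RightAngledHexagon

/-- The length of the `i`-th red side. -/
def redLength (H : RightAngledHexagon) (i : Fin 3) : ℝ := dist (H.p i) (H.q i)

/-- The length of the A-arc facing the `i`-th red side, that is, of the A-arc which joins the two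
other red sides. -/
def arcLength (H : RightAngledHexagon) (i : Fin 3) : ℝ := dist (H.q (i + 1)) (H.p (i + 2))

/-- Half of `a + b - c`, where `a`, `b` are the lengths of the two A-arcs adjacent to the `i`-th red
side and `c` is the length of the A-arc facing it. -/
def rCoord (H : RightAngledHexagon) (i : Fin 3) : ℝ :=
  (H.arcLength (i + 1) + H.arcLength (i + 2) - H.arcLength i) / 2

/-- Congruence of colored right-angled hexagons with labelled sides: some isometry of the hyperbolic
plane carries each vertex to the corresponding vertex. -/
def Congruent (H K : RightAngledHexagon) : Prop :=
  ∃ g : ℍ ≃ᵢ ℍ, ∀ i, g (H.p i) = K.p i ∧ g (H.q i) = K.q i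

theorem Congruent.refl (H : RightAngledHexagon) : H.Congruent H :=
  ⟨IsometryEquiv.refl ℍ, fun _ => ⟨rfl, rfl⟩⟩

theorem Congruent.symm {H K : RightAngledHexagon} (h : H.Congruent K) : K.Congruent H := by
  obtain ⟨g, hg⟩ := h
  refine ⟨g.symm, fun i => ?_⟩
  rw [← (hg i).1, ← (hg i).2]
  simp

theorem Congruent.trans {H K L : RightAngledHexagon} (h : H.Congruent K) (h' : K.Congruent L) :
    H.Congruent L := by
  obtain ⟨g, hg⟩ := h
  obtain ⟨g', hg'⟩ := h'
  refine ⟨g.trans g', fun i => ?_⟩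
  simp [(hg i).1, (hg i).2, (hg' i).1, (hg' i).2]

theorem Congruent.arcLength_eq {H K : RightAngledHexagon} (h : H.Congruent K) (i : Fin 3) :
    H.arcLength i = K.arcLength i := by
  obtain ⟨g, hg⟩ := h
  simp only [arcLength, ← (hg _).1, ← (hg _).2, g.dist_eq]

theorem Congruent.rCoord_eq {H K : RightAngledHexagon} (h : H.Congruent K) (i : Fin 3) :
    H.rCoord i = K.rCoord i := by
  simp only [rCoord, h.arcLength_eq]

end RightAngledHexagon

/-! ### Ideally triangulated surfaces -/

/-- An ideally triangulated compact surface with boundary: a disjoint union of colored hexagons,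
indexed by `ι`, whose red sides are identified in pairs. The pair `(h, i) : ι × Fin 3` is the `i`-th
red side of the hexagon `h`; the red sides of a hexagon are numbered in cyclic order. Two red sides
of one and the same hexagon may be identified with each other. Up to isotopy an identification is
given by the pairing and by whether it preserves the directions `p → q` of the two sides; both
kinds are allowed, so the surface need not be orientable. -/
structure IdealTriangulation (ι : Type*) where
  /-- the red side with which a red side is identified -/
  glue : ι × Fin 3 → ι × Fin 3
  glue_glue : ∀ s, glue (glue s) = s
  glue_ne : ∀ s, glue s ≠ s
  /-- whether the identification preserves the directions of the two sides -/
  preserves : ι × Fin 3 → Bool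
  preserves_glue : ∀ s, preserves (glue s) = preserves s

namespace IdealTriangulation

variable {ι : Type*} (T : IdealTriangulation ι)

/-- Two red sides have the same image in the surface. -/
def sideSetoid : Setoid (ι × Fin 3) where
  r s t := t = s ∨ t = T.glue s
  iseqv :=
    { refl := fun _ => Or.inl rfl
      symm := by
        rintro s t (rfl | rfl)
        · exact Or.inl rfl
        · exact Or.inr (T.glue_glue s).symm
      trans := by
        rintro s t u (rfl | rfl) (rfl | rfl)
        · exact Or.inl rfl
        · exact Or.inr rfl
        · exact Or.inr rfl
        · exact Or.inl (T.glue_glue s) }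

/-- The edges of the ideal triangulation: the images of the red sides in the surface. -/
def Edge : Type _ := Quotient T.sideSetoid

/-- The edge that is the image of a red side. -/
def edge (s : ι × Fin 3) : T.Edge := Quotient.mk T.sideSetoid s

/-- A hyperbolic metric with totally geodesic boundary on the triangulated surface: every 2-cell is
a colored hyperbolic right-angled hexagon, and red sides that are identified have equal lengths, so
that they can be glued isometrically. -/
structure HyperbolicMetric where
  hexagon : ι → RightAngledHexagon
  redLength_glue : ∀ s : ι × Fin 3,
    (hexagon (T.glue s).1).redLength (T.glue s).2 = (hexagon s.1).redLength s.2

/-- Two hyperbolic metrics are equivalent if there is an isometry between them that carries every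
labelled 2-cell to itself. -/
def metricSetoid : Setoid T.HyperbolicMetric where
  r d d' := ∀ h, (d.hexagon h).Congruent (d'.hexagon h)
  iseqv :=
    { refl := fun _ _ => RightAngledHexagon.Congruent.refl _
      symm := fun H h => (H h).symm
      trans := fun H H' h => (H h).trans (H' h) }

/-- The Teichmüller space of the triangulated surface. -/
def Teichmuller : Type _ := Quotient T.metricSetoid

/-- The contribution `∫₀^{(a+b-c)/2} cosh^lam t dt` of one red side to the edge invariant. -/
def sideInvariant (lam : ℝ) (d : T.HyperbolicMetric) (s : ι × Fin 3) : ℝ :=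
  ∫ t in (0 : ℝ)..(d.hexagon s.1).rCoord s.2, Real.cosh t ^ lam

/-- The `ψ_lam` edge invariant of a hyperbolic metric: the sum of the contributions of the two red
sides that are identified to the edge. -/
def edgeInvariant (lam : ℝ) (d : T.HyperbolicMetric) : T.Edge → ℝ :=
  Quotient.lift (fun s => T.sideInvariant lam d s + T.sideInvariant lam d (T.glue s)) (by
    rintro s t (rfl | rfl)
    · rfl
    · simp only [T.glue_glue]
      exact add_comm _ _)

/-- The map `Ψ_lam` from the Teichmüller space to `ℝ^E`. -/
def Psi (lam : ℝ) : T.Teichmuller → (T.Edge → ℝ) :=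
  Quotient.lift (T.edgeInvariant lam) (by
    intro d d' h
    funext e
    refine Quotient.inductionOn e fun s => ?_
    simp only [edgeInvariant, sideInvariant, Quotient.lift_mk, (h _).rCoord_eq])

/-! ### Edge paths and edge cycles -/

/-- A red side `s` also stands for a crossing of its edge: one leaves the hexagon `s.1` through `s`
and enters the hexagon `(T.glue s).1` through `T.glue s`. The crossing `t` may follow the crossing
`s` if `t` leaves the hexagon entered by `s`, through a red side other than the one through which
`s` entered. -/
def Follows (s t : ι × Fin 3) : Prop := t.1 = (T.glue s).1 ∧ t ≠ T.glue s

/-- An edge path `(H₀, e₁, H₁, …, eₙ, Hₙ)` with `n ≥ 1`, given by its crossings. -/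
def IsEdgePath (c : List (ι × Fin 3)) : Prop := c ≠ [] ∧ c.IsChain T.Follows

/-- An edge cycle `(H₀, e₁, H₁, …, eₙ, Hₙ = H₀)` with `n ≥ 1`: an edge path whose first crossing
may follow its last one. -/
def IsEdgeCycle (c : List (ι × Fin 3)) : Prop :=
  T.IsEdgePath c ∧ ∃ h : c ≠ [], T.Follows (c.getLast h) (c.head h)

open Classical in
/-- Each edge appears at most twice. -/
def IsFundamental (c : List (ι × Fin 3)) : Prop := ∀ e : T.Edge, (c.map T.edge).count e ≤ 2

/-- The sum of `z (eᵢ)` over the edges of an edge path. -/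
def pathSum (z : T.Edge → ℝ) (c : List (ι × Fin 3)) : ℝ := (c.map fun s => z (T.edge s)).sum

end IdealTriangulation

/-! ### The polytope -/

/-- `∫₀^∞ cosh^lam t dt`, which is infinite for `lam ≥ 0`. -/
def coshIntegral (lam : ℝ) : ℝ≥0∞ := ∫⁻ t in Set.Ioi (0 : ℝ), ENNReal.ofReal (Real.cosh t ^ lam)

/-- An open convex polytope in `ℝ^E`, not necessarily bounded: an open convex set that is cut out by
finitely many strict affine inequalities. -/
def IsOpenConvexPolytope {E : Type*} (P : Set (E → ℝ)) : Prop :=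
  IsOpen P ∧ Convex ℝ P ∧
    ∃ A : Set (((E → ℝ) →ₗ[ℝ] ℝ) × ℝ), A.Finite ∧ P = {z | ∀ a ∈ A, a.1 z < a.2}

end LuoCoord

end

noncomputable section

namespace LuoCoord

open scoped MatrixGroups

/-! ### Frames along a right-angled hexagon -/

/-! A right-angled hexagon has arc lengths `r (i + 1) + r (i + 2)`, where `r = rCoord`, so the
pairwise sums of `r` are positive; conversely every such triple occurs (`exists_hexagon`), and the
law of cosines then gives the red lengths. Put `w s = ∫₀^{r s} cosh^lam` on each red side `s`, and
let `I` be the integral over the half-line. This primitive is odd and increasing with range `(-I,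
I)`, so positivity of pairwise sums is the same condition for `w` as for `r`. A metric with
invariant `z` thus yields a point of the set `weights`, which is cut out by linear conditions: `w s
+ w (glue s) = z`, `|w s| < I`, and positive pairwise sums in each hexagon.

Necessity of the inequalities is telescoping: along a path, `∑ z` equals the two end weights plus
the pairwise sums in the hexagons crossed (`le_pathSum`). For sufficiency, the linear conditions
form a system of strict difference constraints on the red sides; longest simple paths solve it as
soon as simple cycles and simple paths are consistent (`exists_difference_solution`,
`exists_feasible`). A list of distinct red sides meets an edge at most twice, so fundamental paths
and cycles suffice, and only finitely many inequalities matter.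

A point of `weights` gives hexagons whose identified red sides may still have different lengths.
These are matched by a variational principle. If `L` is the logarithm of `tanh² (x / 2)` for a red
side of length `x`, there is an increasing function `slope` for which the 1-form `∑ slope (L i) dw
i` of a hexagon is closed (`exists_potential`). Its primitive has nonpositive second variation
(`secondVariation_le`). A maximum of the total potential over `weights` is critical along the moves
that shift weight from `s` to `glue s`, which says exactly that the identified sides have equal
length (`exists_sideLog_glue_eq`).

The maximum exists because the closure of `weights` is compact and from every boundary point some
ray into `weights` increases the potential (`exists_max_of_increasing_at_boundary`). If a pairwise
sum vanishes, the slope along the ray tends to `+∞`: either an arc shrinks linearly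
(`tendsto_sum_hexSlope_of_opposite`) or a red side becomes infinitely long
(`tendsto_sum_hexSlope_of_corner`). Otherwise some weights equal `+I`; those red sides shrink to
zero while their partners do not, and moving weight to the partners increases the potential
(`potentialSlope_inward_pos`).

Since `weights` depends on `lam` only through `I`, the comparison of images reduces to the
monotonicity of `I` in `lam`, its divergence for `lam ≥ 0`, and its becoming arbitrarily small for
negative `lam`. -/

theorem direction_smul (g : SL(2, ℝ)) (z w : ℍ) :
    direction (g • z) (g • w) = direction z w *
      ((g 1 0 * (starRingEnd ℂ) (z : ℂ) + g 1 1) / (g 1 0 * (z : ℂ) + g 1 1)) := by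
  have hden : ∀ v : ℍ, (g 1 0 : ℂ) * (v : ℂ) + g 1 1 ≠ 0 := fun v => by
    have := UpperHalfPlane.denom_ne_zero (g : GL (Fin 2) ℝ) v
    simpa [UpperHalfPlane.denom] using this
  have hdet : (g 0 0 : ℂ) * g 1 1 - g 0 1 * g 1 0 = 1 := by
    have := g.det_coe
    rw [Matrix.det_fin_two] at this
    exact_mod_cast this
  have hcoe : ∀ v : ℍ, ((g • v : ℍ) : ℂ) = (g 0 0 * (v : ℂ) + g 0 1) / (g 1 0 * (v : ℂ) + g 1 1) :=
    fun v => by simpa using UpperHalfPlane.coe_specialLinearGroup_apply g v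
  have hz := hden z
  have hw := hden w
  have hzc : (g 1 0 : ℂ) * (starRingEnd ℂ) (z : ℂ) + g 1 1 ≠ 0 := by
    intro h
    apply hz
    have := congrArg (starRingEnd ℂ) h
    simpa using this
  have hwz : (w : ℂ) - (starRingEnd ℂ) (z : ℂ) ≠ 0 := by
    intro h
    have := congrArg Complex.im h
    have h1 := w.im_pos
    have h2 := z.im_pos
    simp at this
    linarith
  have e1 : ((g • w : ℍ) : ℂ) - ((g • z : ℍ) : ℂ) = ((w : ℂ) - z) /
      ((g 1 0 * (w : ℂ) + g 1 1) * (g 1 0 * (z : ℂ) + g 1 1)) := by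
    rw [hcoe, hcoe, div_sub_div _ _ hw hz]
    congr 1
    linear_combination ((w : ℂ) - z) * hdet
  have e2 : ((g • w : ℍ) : ℂ) - (starRingEnd ℂ) ((g • z : ℍ) : ℂ) =
      ((w : ℂ) - (starRingEnd ℂ) (z : ℂ)) /
      ((g 1 0 * (w : ℂ) + g 1 1) * (g 1 0 * (starRingEnd ℂ) (z : ℂ) + g 1 1)) := by
    rw [hcoe, hcoe]
    simp only [map_div₀, map_add, map_mul, Complex.conj_ofReal]
    rw [div_sub_div _ _ hw hzc]
    congr 1
    linear_combination ((w : ℂ) - (starRingEnd ℂ) (z : ℂ)) * hdet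
  rw [direction, e1, e2, direction, div_div_div_eq, div_mul_div_comm,
    div_eq_div_iff (mul_ne_zero (mul_ne_zero hw hz) hwz) (mul_ne_zero hwz hz)]
  ring

/-- The automorphy factor in `direction_smul` depends on `g` and the base point only, so it cancels
in the quotient of two directions. -/
theorem orientedAngle_smul (g : SL(2, ℝ)) (z u w : ℍ) :
    orientedAngle (g • z) (g • u) (g • w) = orientedAngle z u w := by
  have hz : (g 1 0 : ℂ) * (z : ℂ) + g 1 1 ≠ 0 := by
    have := UpperHalfPlane.denom_ne_zero (g : GL (Fin 2) ℝ) z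
    simpa [UpperHalfPlane.denom] using this
  have hzc : (g 1 0 : ℂ) * (starRingEnd ℂ) (z : ℂ) + g 1 1 ≠ 0 := by
    intro h
    apply hz
    have := congrArg (starRingEnd ℂ) h
    simpa using this
  rw [orientedAngle, direction_smul, direction_smul, mul_div_mul_right _ _ (div_ne_zero hzc hz),
    orientedAngle]

/-- The translation by `a` along the imaginary axis. -/
def axisTranslation (a : ℝ) : SL(2, ℝ) :=
  ⟨!![Real.exp (a / 2), 0; 0, Real.exp (-a / 2)], by
    rw [Matrix.det_fin_two_of, ← Real.exp_add]; simp; ring⟩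

/-- The rotation by `π / 2` around `I`. -/
def quarterTurn : SL(2, ℝ) :=
  ⟨!![√2 / 2, √2 / 2; -(√2 / 2), √2 / 2], by
    rw [Matrix.det_fin_two_of]
    have := Real.mul_self_sqrt (show (0 : ℝ) ≤ 2 by norm_num)
    linear_combination this / 2⟩

theorem coe_axisTranslation_smul (a : ℝ) :
    ((axisTranslation a • UpperHalfPlane.I : ℍ) : ℂ) = Real.exp a * Complex.I := by
  have h := UpperHalfPlane.coe_specialLinearGroup_apply (axisTranslation a) UpperHalfPlane.I
  rw [h]
  have : Real.exp a = Real.exp (a / 2) / Real.exp (-a / 2) := by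
    rw [← Real.exp_sub]; ring_nf
  rw [this]
  simp [axisTranslation]
  ring

theorem dist_axisTranslation (a : ℝ) :
    dist UpperHalfPlane.I (axisTranslation a • UpperHalfPlane.I) = |a| := by
  have h := coe_axisTranslation_smul a
  have hre : (axisTranslation a • UpperHalfPlane.I : ℍ).re = 0 := by
    rw [← UpperHalfPlane.coe_re, h]; simp
  have him : (axisTranslation a • UpperHalfPlane.I : ℍ).im = Real.exp a := by
    rw [← UpperHalfPlane.coe_im, h]; simp [-Complex.ofReal_exp]
  rw [UpperHalfPlane.dist_of_re_eq (by rw [hre]; simp), him]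
  simp [Real.dist_eq]

theorem quarterTurn_smul_I : quarterTurn • UpperHalfPlane.I = UpperHalfPlane.I := by
  apply UpperHalfPlane.ext
  rw [UpperHalfPlane.coe_specialLinearGroup_apply]
  have h2 : (√2 : ℂ) ≠ 0 := by norm_cast; positivity
  have : (1 - Complex.I) ≠ 0 := by
    intro h
    have := congrArg Complex.re h
    simp at this
  simp [quarterTurn]
  have h3 : -((√2 : ℂ) / 2 * Complex.I) + √2 / 2 ≠ 0 := by
    have : -((√2 : ℂ) / 2 * Complex.I) + √2 / 2 = √2 / 2 * (1 - Complex.I) := by ring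
    rw [this]
    exact mul_ne_zero (div_ne_zero h2 two_ne_zero) ‹_›
  rw [div_eq_iff h3]
  linear_combination (√2 / 2 : ℂ) * Complex.I_mul_I

theorem direction_I_quarterTurn_smul (w : ℍ) :
    direction UpperHalfPlane.I (quarterTurn • w) = Complex.I * direction UpperHalfPlane.I w := by
  conv_lhs => rw [← quarterTurn_smul_I]
  rw [direction_smul, mul_comm]
  congr 1
  have h2 : (√2 : ℂ) ≠ 0 := by norm_cast; positivity
  have : (1 - Complex.I) ≠ 0 := by
    intro h
    have := congrArg Complex.re h
    simp at this
  simp [quarterTurn]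
  have h3 : -((√2 : ℂ) / 2 * Complex.I) + √2 / 2 ≠ 0 := by
    have : -((√2 : ℂ) / 2 * Complex.I) + √2 / 2 = √2 / 2 * (1 - Complex.I) := by ring
    rw [this]
    exact mul_ne_zero (div_ne_zero h2 two_ne_zero) ‹_›
  rw [div_eq_iff h3]
  linear_combination (√2 / 2 : ℂ) * Complex.I_mul_I

theorem direction_I_quarterTurn_inv_smul (w : ℍ) :
    direction UpperHalfPlane.I (quarterTurn⁻¹ • w) =
      -Complex.I * direction UpperHalfPlane.I w := by
  have h := direction_I_quarterTurn_smul (quarterTurn⁻¹ • w)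
  rw [smul_inv_smul] at h
  rw [h]
  linear_combination (direction UpperHalfPlane.I (quarterTurn⁻¹ • w)) * Complex.I_mul_I

theorem direction_I_axisTranslation (a : ℝ) :
    direction UpperHalfPlane.I (axisTranslation a • UpperHalfPlane.I) =
      ((Real.exp a - 1) / (Real.exp a + 1) : ℝ) := by
  rw [direction, coe_axisTranslation_smul]
  have : (Real.exp a : ℂ) + 1 ≠ 0 := by
    norm_cast; positivity
  push_cast at this ⊢
  simp
  have h2 : Complex.exp a * Complex.I + Complex.I = (Complex.exp a + 1) * Complex.I := by ring
  have h1 : Complex.exp a * Complex.I - Complex.I = (Complex.exp a - 1) * Complex.I := by ring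
  rw [h1, h2, mul_div_mul_right _ _ Complex.I_ne_zero]

theorem arg_pos_mul_I {a : ℝ} (ha : 0 < a) : ((a : ℂ) * Complex.I).arg = Real.pi / 2 := by
  rw [Complex.arg_real_mul _ ha, Complex.arg_I]

theorem orientedAngle_axisTranslation_quarterTurn_inv {a b : ℝ} (ha : 0 < a) (hb : 0 < b) :
    orientedAngle UpperHalfPlane.I (axisTranslation a • UpperHalfPlane.I)
      (quarterTurn⁻¹ • axisTranslation (-b) • UpperHalfPlane.I) = Real.pi / 2 := by
  rw [orientedAngle, direction_I_quarterTurn_inv_smul, direction_I_axisTranslation,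
    direction_I_axisTranslation]
  have h1 : 0 < (Real.exp a - 1) / (Real.exp a + 1) := by
    have := Real.one_lt_exp_iff.2 ha
    exact div_pos (by linarith) (by positivity)
  have h2 : 0 < -((Real.exp (-b) - 1) / (Real.exp (-b) + 1)) := by
    have := Real.exp_lt_one_iff.2 (neg_lt_zero.2 hb)
    rw [neg_div']
    exact div_pos (by linarith) (by positivity)
  rw [← arg_pos_mul_I (div_pos h2 h1)]
  congr 1
  push_cast
  ring

theorem orientedAngle_quarterTurn_axisTranslation {a b : ℝ} (ha : 0 < a) (hb : 0 < b) :
    orientedAngle UpperHalfPlane.I (quarterTurn • axisTranslation b • UpperHalfPlane.I)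
      (axisTranslation (-a) • UpperHalfPlane.I) = Real.pi / 2 := by
  rw [orientedAngle, direction_I_quarterTurn_smul, direction_I_axisTranslation,
    direction_I_axisTranslation]
  have h1 : 0 < (Real.exp b - 1) / (Real.exp b + 1) := by
    have := Real.one_lt_exp_iff.2 hb
    exact div_pos (by linarith) (by positivity)
  have h2 : 0 < -((Real.exp (-a) - 1) / (Real.exp (-a) + 1)) := by
    have := Real.exp_lt_one_iff.2 (neg_lt_zero.2 ha)
    rw [neg_div']
    exact div_pos (by linarith) (by positivity)
  rw [← arg_pos_mul_I (div_pos h2 h1)]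
  congr 1
  rw [div_mul_eq_div_div_swap, Complex.div_I]
  push_cast
  ring

theorem axisTranslation_neg (a : ℝ) : axisTranslation (-a) = (axisTranslation a)⁻¹ := by
  symm
  rw [inv_eq_iff_mul_eq_one]
  apply Subtype.ext
  rw [Matrix.SpecialLinearGroup.coe_mul, Matrix.SpecialLinearGroup.coe_one, axisTranslation,
    axisTranslation, Matrix.mul_fin_two, Matrix.one_fin_two, ← Real.exp_add, ← Real.exp_add]
  ring_nf
  simp

/-- The hexagon whose frames at the initial vertices of the red sides are `G`. -/
def hexagonOfFrames (x θ : Fin 3 → ℝ) (hx : ∀ i, 0 < x i) (hθ : ∀ i, 0 < θ i)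
    (G : Fin 3 → SL(2, ℝ))
    (hG : ∀ i, ∀ z : ℍ, G (i + 1) • z = (G i * axisTranslation (x i) * quarterTurn *
      axisTranslation (θ (i + 2)) * quarterTurn) • z) : RightAngledHexagon where
  p i := G i • UpperHalfPlane.I
  q i := (G i * axisTranslation (x i)) • UpperHalfPlane.I
  angle_p i := by
    have h := hG (i + 2)
    have e : i + 2 + 1 = i := by fin_cases i <;> rfl
    rw [e] at h
    -- The previous vertex is seen from the frame `G i` by walking the black side backwards: undo
    -- the last quarter turn, then translate by `-θ`.
    have key : (G (i + 2) * axisTranslation (x (i + 2))) • UpperHalfPlane.I = G i •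
        (quarterTurn⁻¹ • axisTranslation (-θ (i + 2 + 2)) • UpperHalfPlane.I) := by
      rw [h, axisTranslation_neg]
      conv_lhs => rw [← quarterTurn_smul_I]
      simp only [← mul_smul]
      congr 1
      group
    rw [key, mul_smul, orientedAngle_smul]
    exact orientedAngle_axisTranslation_quarterTurn_inv (hx _) (hθ _)
  angle_q i := by
    have h1 : G (i + 1) • UpperHalfPlane.I = (G i * axisTranslation (x i)) •
        (quarterTurn • axisTranslation (θ (i + 2)) • UpperHalfPlane.I) := by
      rw [hG]
      simp only [mul_smul, quarterTurn_smul_I]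
    have h2 : G i • UpperHalfPlane.I = (G i * axisTranslation (x i)) •
        axisTranslation (-x i) • UpperHalfPlane.I := by
      rw [axisTranslation_neg, mul_smul, smul_inv_smul]
    rw [h1, h2, orientedAngle_smul]
    exact orientedAngle_quarterTurn_axisTranslation (hx _) (hθ _)

theorem redLength_hexagonOfFrames (x θ : Fin 3 → ℝ) (hx : ∀ i, 0 < x i) (hθ : ∀ i, 0 < θ i)
    (G : Fin 3 → SL(2, ℝ)) (hG) (i : Fin 3) :
    (hexagonOfFrames x θ hx hθ G hG).redLength i = x i := by
  simp only [RightAngledHexagon.redLength, hexagonOfFrames]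
  rw [mul_smul, dist_smul, dist_axisTranslation, abs_of_pos (hx i)]

theorem arcLength_hexagonOfFrames (x θ : Fin 3 → ℝ) (hx : ∀ i, 0 < x i) (hθ : ∀ i, 0 < θ i)
    (G : Fin 3 → SL(2, ℝ)) (hG) (i : Fin 3) :
    (hexagonOfFrames x θ hx hθ G hG).arcLength i = θ i := by
  simp only [RightAngledHexagon.arcLength, hexagonOfFrames]
  have e : i + 2 = i + 1 + 1 := by fin_cases i <;> rfl
  have e' : i + 1 + 2 = i := by fin_cases i <;> rfl
  rw [e, hG, e']
  simp only [mul_smul, quarterTurn_smul_I, dist_smul]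
  have : dist UpperHalfPlane.I (quarterTurn • axisTranslation (θ i) • UpperHalfPlane.I) =
      dist (quarterTurn • UpperHalfPlane.I)
        (quarterTurn • axisTranslation (θ i) • UpperHalfPlane.I) := by
    rw [quarterTurn_smul_I]
  rw [this, dist_smul, dist_axisTranslation, abs_of_pos (hθ i)]

/-! ### Existence of right-angled hexagons -/

theorem axisTranslation_quarterTurn (x θ : ℝ) :
    ((axisTranslation x * quarterTurn * axisTranslation θ * quarterTurn : SL(2, ℝ)) :
      Matrix (Fin 2) (Fin 2) ℝ) =
      !![Real.exp (x / 2) * Real.sinh (θ / 2), Real.exp (x / 2) * Real.cosh (θ / 2);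
        -(Real.exp (-x / 2) * Real.cosh (θ / 2)), -(Real.exp (-x / 2) * Real.sinh (θ / 2))] := by
  have h := Real.mul_self_sqrt (show (0 : ℝ) ≤ 2 by norm_num)
  rw [Matrix.SpecialLinearGroup.coe_mul, Matrix.SpecialLinearGroup.coe_mul,
    Matrix.SpecialLinearGroup.coe_mul]
  simp only [axisTranslation, quarterTurn, Matrix.mul_fin_two, Real.sinh_eq, Real.cosh_eq, neg_div]
  ext i j
  fin_cases i <;> fin_cases j <;> simp
  · linear_combination (Real.exp (x / 2) * (Real.exp (θ / 2) - Real.exp (-(θ / 2))) / 4) * h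
  · linear_combination (Real.exp (x / 2) * (Real.exp (θ / 2) + Real.exp (-(θ / 2))) / 4) * h
  · linear_combination (-Real.exp (-(x / 2)) * (Real.exp (θ / 2) + Real.exp (-(θ / 2))) / 4) * h
  · linear_combination (-Real.exp (-(x / 2)) * (Real.exp (θ / 2) - Real.exp (-(θ / 2))) / 4) * h

/-- The holonomy around the hexagon, in half-lengths `a`, `b`, `c` of the arcs. The hypotheses on
`x0`, `x1`, `x2` encode the law of cosines: for instance `cosh (x0 / 2) = k * k0 / (s1 * s2)` and
`sinh (x0 / 2) = k1 * k2 / (s1 * s2)`. The sign `-1` is harmless because it acts trivially on the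
half-plane. -/
theorem hexagon_closing {a b c : ℝ} {k k0 k1 k2 s0 s1 s2 : ℝ}
    (hk : k ^ 2 = Real.cosh (a + b + c)) (hk0 : k0 ^ 2 = Real.cosh (b + c - a))
    (hk1 : k1 ^ 2 = Real.cosh (a + c - b)) (hk2 : k2 ^ 2 = Real.cosh (a + b - c))
    (hs2 : s2 ^ 2 = Real.sinh (2 * c))
    (h0 : s0 ≠ 0) (h1 : s1 ≠ 0) (h2 : s2 ≠ 0)
    {x0 x1 x2 : ℝ}
    (hx0 : Real.exp (x0 / 2) = (k * k0 + k1 * k2) / (s1 * s2))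
    (hx0' : Real.exp (-x0 / 2) = (k * k0 - k1 * k2) / (s1 * s2))
    (hx1 : Real.exp (x1 / 2) = (k * k1 + k0 * k2) / (s0 * s2))
    (hx1' : Real.exp (-x1 / 2) = (k * k1 - k0 * k2) / (s0 * s2))
    (hx2 : Real.exp (x2 / 2) = (k * k2 + k0 * k1) / (s0 * s1))
    (hx2' : Real.exp (-x2 / 2) = (k * k2 - k0 * k1) / (s0 * s1)) :
    (axisTranslation x0 * quarterTurn * axisTranslation (2 * c) * quarterTurn) *
      (axisTranslation x1 * quarterTurn * axisTranslation (2 * a) * quarterTurn) =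
    -(axisTranslation x2 * quarterTurn * axisTranslation (2 * b) * quarterTurn)⁻¹ := by
  apply Subtype.ext
  rw [Matrix.SpecialLinearGroup.coe_mul, axisTranslation_quarterTurn, axisTranslation_quarterTurn,
    Matrix.SpecialLinearGroup.coe_neg, Matrix.SpecialLinearGroup.coe_inv,
    axisTranslation_quarterTurn, Matrix.adjugate_fin_two_of, Matrix.mul_fin_two, hx0, hx0', hx1,
    hx1', hx2, hx2']
  have e : ∀ y : ℝ, 2 * y / 2 = y := fun y => by ring
  rw [e, e, e]
  set A := Real.exp a with hA
  set B := Real.exp b with hB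
  set C := Real.exp c with hC
  have hA0 : A ≠ 0 := (Real.exp_pos _).ne'
  have hB0 : B ≠ 0 := (Real.exp_pos _).ne'
  have hC0 : C ≠ 0 := (Real.exp_pos _).ne'
  have shc : Real.sinh (2 * c) = (C ^ 2 - (C ^ 2)⁻¹) / 2 := by
    rw [Real.sinh_eq, Real.exp_neg, two_mul, Real.exp_add, ← hC, sq]
  have e0 : Real.cosh (a + b + c) = (A * B * C + (A * B * C)⁻¹) / 2 := by
    rw [Real.cosh_eq, Real.exp_neg, Real.exp_add, Real.exp_add]
  have e1 : Real.cosh (b + c - a) = (B * C / A + A / (B * C)) / 2 := by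
    rw [Real.cosh_eq, Real.exp_neg, Real.exp_sub, Real.exp_add, inv_div]
  have e2 : Real.cosh (a + c - b) = (A * C / B + B / (A * C)) / 2 := by
    rw [Real.cosh_eq, Real.exp_neg, Real.exp_sub, Real.exp_add, inv_div]
  have e3 : Real.cosh (a + b - c) = (A * B / C + C / (A * B)) / 2 := by
    rw [Real.cosh_eq, Real.exp_neg, Real.exp_sub, Real.exp_add, inv_div]
  rw [e0] at hk
  rw [e1] at hk0
  rw [e2] at hk1
  rw [e3] at hk2
  rw [shc] at hs2
  have ca : Real.cosh a = (A + A⁻¹) / 2 := by rw [Real.cosh_eq, Real.exp_neg]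
  have cb : Real.cosh b = (B + B⁻¹) / 2 := by rw [Real.cosh_eq, Real.exp_neg]
  have cc : Real.cosh c = (C + C⁻¹) / 2 := by rw [Real.cosh_eq, Real.exp_neg]
  have sa : Real.sinh a = (A - A⁻¹) / 2 := by rw [Real.sinh_eq, Real.exp_neg]
  have sb : Real.sinh b = (B - B⁻¹) / 2 := by rw [Real.sinh_eq, Real.exp_neg]
  have sc : Real.sinh c = (C - C⁻¹) / 2 := by rw [Real.sinh_eq, Real.exp_neg]
  set ua := Real.cosh a
  set ub := Real.cosh b
  set uc := Real.cosh c
  set va := Real.sinh a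
  set vb := Real.sinh b
  set vc := Real.sinh c
  -- Each matrix entry, once expanded, is a combination of `k0 * k1` and `k * k2`; these four
  -- product-to-sum identities evaluate the two coefficients.
  have I1 : k ^ 2 * (vc * va - uc * ua) + k2 ^ 2 * (vc * va + uc * ua) = -vb * s2 ^ 2 := by
    rw [hk, hk2, hs2, ca, cc, sa, sb, sc]; field_simp; ring
  have I2 : k0 ^ 2 * (vc * va + uc * ua) + k1 ^ 2 * (vc * va - uc * ua) = vb * s2 ^ 2 := by
    rw [hk0, hk1, hs2, ca, cc, sa, sb, sc]; field_simp; ring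
  have I3 : k ^ 2 * (vc * ua - uc * va) + k2 ^ 2 * (vc * ua + uc * va) = ub * s2 ^ 2 := by
    rw [hk, hk2, hs2, ca, cb, cc, sa, sc]; field_simp; ring
  have I4 : k0 ^ 2 * (vc * ua + uc * va) + k1 ^ 2 * (vc * ua - uc * va) = ub * s2 ^ 2 := by
    rw [hk0, hk1, hs2, ca, cb, cc, sa, sc]; field_simp; ring
  -- The two factors on the left share `s2` and the right side has denominator `s0 * s1`, so only
  -- the square of `s2` has to be known.
  have f : ∀ {N D : ℝ}, N = D * s2 ^ 2 → N / (s0 * s1 * s2 ^ 2) = D / (s0 * s1) := by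
    intro N D h
    rw [h]; field_simp
  ext i j
  fin_cases i <;> fin_cases j <;> simp
  · rw [show (k * k0 + k1 * k2) / (s1 * s2) * vc * ((k * k1 + k0 * k2) / (s0 * s2) * va) +
      -((k * k0 + k1 * k2) / (s1 * s2) * uc * ((k * k1 - k0 * k2) / (s0 * s2) * ua)) =
      ((k * k0 + k1 * k2) * vc * (k * k1 + k0 * k2) * va -
        (k * k0 + k1 * k2) * uc * (k * k1 - k0 * k2) * ua) / (s0 * s1 * s2 ^ 2) by
      field_simp; ring, div_mul_eq_mul_div]
    apply f
    linear_combination k0 * k1 * I1 + k * k2 * I2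
  · rw [show (k * k0 + k1 * k2) / (s1 * s2) * vc * ((k * k1 + k0 * k2) / (s0 * s2) * ua) +
      -((k * k0 + k1 * k2) / (s1 * s2) * uc * ((k * k1 - k0 * k2) / (s0 * s2) * va)) =
      ((k * k0 + k1 * k2) * vc * (k * k1 + k0 * k2) * ua -
        (k * k0 + k1 * k2) * uc * (k * k1 - k0 * k2) * va) / (s0 * s1 * s2 ^ 2) by
      field_simp; ring, div_mul_eq_mul_div]
    apply f
    linear_combination k0 * k1 * I3 + k * k2 * I4
  · rw [show -((k * k0 - k1 * k2) / (s1 * s2) * uc * ((k * k1 + k0 * k2) / (s0 * s2) * va)) +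
      (k * k0 - k1 * k2) / (s1 * s2) * vc * ((k * k1 - k0 * k2) / (s0 * s2) * ua) =
      ((k * k0 - k1 * k2) * vc * (k * k1 - k0 * k2) * ua -
        (k * k0 - k1 * k2) * uc * (k * k1 + k0 * k2) * va) / (s0 * s1 * s2 ^ 2) by
      field_simp; ring, div_mul_eq_mul_div, ← neg_div]
    apply f
    linear_combination k0 * k1 * I3 - k * k2 * I4
  · rw [show -((k * k0 - k1 * k2) / (s1 * s2) * uc * ((k * k1 + k0 * k2) / (s0 * s2) * ua)) +
      (k * k0 - k1 * k2) / (s1 * s2) * vc * ((k * k1 - k0 * k2) / (s0 * s2) * va) =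
      ((k * k0 - k1 * k2) * vc * (k * k1 - k0 * k2) * va -
        (k * k0 - k1 * k2) * uc * (k * k1 + k0 * k2) * ua) / (s0 * s1 * s2 ^ 2) by
      field_simp; ring, div_mul_eq_mul_div, ← neg_div]
    apply f
    linear_combination k0 * k1 * I1 - k * k2 * I2

/-- This is `cosh² - sinh² = 1` for half a red side in disguise; it is used both to construct
hexagons and to compute `1 - tanh²` of half a red side. -/
theorem cosh_mul_cosh_sub_cosh_mul_cosh (a b c : ℝ) :
    Real.cosh (a + b + c) * Real.cosh a - Real.cosh b * Real.cosh c =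
      Real.sinh (c + a) * Real.sinh (a + b) := by
  simp only [Real.cosh_add, Real.sinh_add]
  linear_combination (Real.cosh b * Real.cosh c) * Real.cosh_sq_sub_sinh_sq a

/-- For any real numbers `r i` with positive pairwise sums there is a right-angled hexagon with
these coordinates; its red sides are given by the law of cosines. -/
theorem exists_hexagon (r : Fin 3 → ℝ) (hr : ∀ i, 0 < r (i + 1) + r (i + 2)) :
    ∃ H : RightAngledHexagon, (∀ i, H.rCoord i = r i) ∧ ∀ i, 0 < H.redLength i ∧
      Real.sinh (H.redLength i / 2) ^ 2 = Real.cosh (r (i + 1)) * Real.cosh (r (i + 2)) /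
        (Real.sinh (r (i + 2) + r i) * Real.sinh (r i + r (i + 1))) := by
  have hS : ∀ i, 0 < Real.sinh (r (i + 1) + r (i + 2)) := fun i => Real.sinh_pos_iff.2 (hr i)
  set k : ℝ := √(Real.cosh (r 0 + r 1 + r 2)) with hk
  set κ : Fin 3 → ℝ := fun i => √(Real.cosh (r i)) with hκ
  set σ : Fin 3 → ℝ := fun i => √(Real.sinh (r (i + 1) + r (i + 2))) with hσ
  set θ : Fin 3 → ℝ := fun i => r (i + 1) + r (i + 2) with hθ
  have kpos : 0 < k := Real.sqrt_pos.2 (Real.cosh_pos _)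
  have κpos : ∀ i, 0 < κ i := fun i => Real.sqrt_pos.2 (Real.cosh_pos _)
  have σpos : ∀ i, 0 < σ i := fun i => Real.sqrt_pos.2 (hS i)
  have ksq : k ^ 2 = Real.cosh (r 0 + r 1 + r 2) := Real.sq_sqrt (Real.cosh_pos _).le
  have κsq : ∀ i, κ i ^ 2 = Real.cosh (r i) := fun i => Real.sq_sqrt (Real.cosh_pos _).le
  have σsq : ∀ i, σ i ^ 2 = Real.sinh (r (i + 1) + r (i + 2)) := fun i => Real.sq_sqrt (hS i).le
  set h : Fin 3 → ℝ := fun i => κ (i + 1) * κ (i + 2) / (σ (i + 1) * σ (i + 2)) with hh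
  have hpos : ∀ i, 0 < h i := fun i =>
    div_pos (mul_pos (κpos _) (κpos _)) (mul_pos (σpos _) (σpos _))
  set x : Fin 3 → ℝ := fun i => 2 * Real.arsinh (h i) with hx
  have xpos : ∀ i, 0 < x i := fun i => by
    have := Real.arsinh_pos_iff.2 (hpos i)
    simp only [hx]; linarith
  have hsum : ∀ i, r 0 + r 1 + r 2 = r i + r (i + 1) + r (i + 2) := by
    intro i; fin_cases i <;> simp <;> ring
  -- With `h i` the hyperbolic sine of half a red side, this identifies the cosine, and sum and
  -- difference give the exponentials required by `hexagon_closing`.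
  have hone : ∀ i, 1 + h i ^ 2 = (k * κ i / (σ (i + 1) * σ (i + 2))) ^ 2 := fun i => by
    have h1 := (σpos (i + 1)).ne'
    have h2 := (σpos (i + 2)).ne'
    have e1 : i + 1 + 1 = i + 2 := by fin_cases i <;> rfl
    have e2 : i + 1 + 2 = i := by fin_cases i <;> rfl
    have e3 : i + 2 + 1 = i := by fin_cases i <;> rfl
    have e4 : i + 2 + 2 = i + 1 := by fin_cases i <;> rfl
    have key : σ (i + 1) ^ 2 * σ (i + 2) ^ 2 + κ (i + 1) ^ 2 * κ (i + 2) ^ 2 = k ^ 2 * κ i ^ 2 := by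
      rw [σsq, σsq, κsq, κsq, κsq, ksq, hsum i, e1, e2, e3, e4]
      linear_combination -cosh_mul_cosh_sub_cosh_mul_cosh (r i) (r (i + 1)) (r (i + 2))
    simp only [hh]
    field_simp
    linear_combination key
  have hexp : ∀ i, Real.exp (x i / 2) =
      (k * κ i + κ (i + 1) * κ (i + 2)) / (σ (i + 1) * σ (i + 2)) := fun i => by
    have : x i / 2 = Real.arsinh (h i) := by simp only [hx]; ring
    rw [this, Real.exp_arsinh, hone, Real.sqrt_sq
      (div_pos (mul_pos kpos (κpos _)) (mul_pos (σpos _) (σpos _))).le]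
    simp only [hh]
    ring
  have hexp' : ∀ i, Real.exp (-x i / 2) =
      (k * κ i - κ (i + 1) * κ (i + 2)) / (σ (i + 1) * σ (i + 2)) := fun i => by
    have : -x i / 2 = Real.arsinh (-h i) := by simp only [hx, Real.arsinh_neg]; ring
    rw [this, Real.exp_arsinh, neg_sq, hone, Real.sqrt_sq
      (div_pos (mul_pos kpos (κpos _)) (mul_pos (σpos _) (σpos _))).le]
    simp only [hh]
    ring
  have closing := hexagon_closing (a := θ 0 / 2) (b := θ 1 / 2) (c := θ 2 / 2)
    (k := k) (k0 := κ 0) (k1 := κ 1) (k2 := κ 2) (s0 := σ 0) (s1 := σ 1) (s2 := σ 2)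
    (x0 := x 0) (x1 := x 1) (x2 := x 2)
    (by rw [ksq]; congr 1; simp [hθ]; ring) (by rw [κsq]; congr 1; simp [hθ]; ring)
    (by rw [κsq]; congr 1; simp [hθ]; ring) (by rw [κsq]; congr 1; simp [hθ]; ring)
    (by rw [σsq]; congr 1; simp [hθ]; ring) (σpos _).ne' (σpos _).ne' (σpos _).ne'
    (hexp 0) (hexp' 0)
    (by rw [hexp 1]; simp; ring) (by rw [hexp' 1]; simp; ring)
    (by rw [hexp 2]; simp) (by rw [hexp' 2]; simp)
  have e : ∀ y : ℝ, 2 * (y / 2) = y := fun y => by ring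
  rw [e, e, e] at closing
  set M : Fin 3 → SL(2, ℝ) := fun i => axisTranslation (x i) * quarterTurn *
    axisTranslation (θ (i + 2)) * quarterTurn with hM
  have hclose : M 0 * M 1 = -(M 2)⁻¹ := closing
  have hG : ∀ i, ∀ z : ℍ, (![1, M 0, M 0 * M 1] : Fin 3 → SL(2, ℝ)) (i + 1) • z =
      ((![1, M 0, M 0 * M 1] : Fin 3 → SL(2, ℝ)) i * axisTranslation (x i) * quarterTurn *
        axisTranslation (θ (i + 2)) * quarterTurn) • z := by
    intro i z
    have : (![1, M 0, M 0 * M 1] : Fin 3 → SL(2, ℝ)) i * axisTranslation (x i) * quarterTurn *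
        axisTranslation (θ (i + 2)) * quarterTurn =
        (![1, M 0, M 0 * M 1] : Fin 3 → SL(2, ℝ)) i * M i := by
      simp only [hM, mul_assoc]
    rw [this]
    fin_cases i
    · simp
    · simp
    -- Only here does closing up matter: the frame after three steps is `-1`, which acts as the
    -- identity.
    · have h2 : M 0 * M 1 * M 2 = -1 := by rw [hclose, neg_mul, inv_mul_cancel]
      have h3 : (-1 : SL(2, ℝ)) • z = z := by
        apply UpperHalfPlane.ext
        rw [UpperHalfPlane.coe_specialLinearGroup_apply]
        simp
      simp [h2, h3]
  refine ⟨hexagonOfFrames x θ xpos hr _ hG, fun i => ?_, fun i => ⟨?_, ?_⟩⟩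
  · simp only [RightAngledHexagon.rCoord, arcLength_hexagonOfFrames, hθ]
    fin_cases i <;> simp <;> ring
  · rw [redLength_hexagonOfFrames]; exact xpos i
  · rw [redLength_hexagonOfFrames]
    have : x i / 2 = Real.arsinh (h i) := by simp only [hx]; ring
    rw [this, Real.sinh_arsinh]
    have e1 : i + 1 + 1 = i + 2 := by fin_cases i <;> rfl
    have e2 : i + 1 + 2 = i := by fin_cases i <;> rfl
    have e3 : i + 2 + 1 = i := by fin_cases i <;> rfl
    have e4 : i + 2 + 2 = i + 1 := by fin_cases i <;> rfl
    simp only [hh]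
    rw [div_pow, mul_pow, mul_pow, κsq, κsq, σsq, σsq, e1, e2, e3, e4]

end LuoCoord

end

noncomputable section

namespace LuoCoord

/-! ### Systems of strict difference constraints -/

theorem finite_nodup_lists (α : Type*) [Finite α] : {c : List α | c.Nodup}.Finite := by
  classical
  have := Fintype.ofFinite α
  have : Finite {c : List α // c.Nodup} := Finite.of_fintype _
  exact Set.finite_coe_iff.1 this

/-- A finite system of strict difference constraints `w s - a s < w t` (for `R s t`) with bounds
`l < w < u` is solvable as soon as it is consistent along simple cycles and simple paths (which are
listed here in reverse order). -/
theorem exists_difference_solution {α : Type*} [Finite α] (R : α → α → Prop) (a l u : α → ℝ)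
    (hcycle : ∀ (c : List α) (s t : α), c.Nodup → c.IsChain (fun x y => R y x) →
      c.head? = some s → c.getLast? = some t → R s t → 0 < (c.map a).sum)
    (hpath : ∀ (t : α) (c : List α), (t :: c).Nodup → (t :: c).IsChain (fun x y => R y x) →
      l ((t :: c).getLast (List.cons_ne_nil _ _)) - (c.map a).sum < u t) :
    ∃ w : α → ℝ, (∀ s, l s < w s ∧ w s < u s) ∧ ∀ s t, R s t → w s - a s < w t := by
  classical
  have hfin : {c : List α | c.Nodup}.Finite := finite_nodup_lists α
  -- There are finitely many simple lists, so a single slack `ε` per vertex fits into all the strict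
  -- inequalities at once.
  obtain ⟨ε, hε, hε1, hε2⟩ : ∃ ε : ℝ, 0 < ε ∧
      (∀ c ∈ {c : List α | c.Nodup}, 0 < (c.map a).sum → ε * c.length < (c.map a).sum) ∧
      (∀ c ∈ {c : List α | c.Nodup}, ∀ h : c ≠ [],
        l (c.getLast h) - (c.tail.map a).sum < u (c.head h) →
        l (c.getLast h) - (c.tail.map a).sum + ε * c.length < u (c.head h)) := by
    have ht : ∀ (x : ℝ), Filter.Tendsto (fun ε : ℝ => ε * x) (nhdsWithin 0 (Set.Ioi 0)) (nhds 0) := by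
      intro x
      have : Filter.Tendsto (fun ε : ℝ => ε * x) (nhds 0) (nhds (0 * x)) :=
        (continuous_id.mul continuous_const).tendsto 0
      rw [zero_mul] at this
      exact this.mono_left nhdsWithin_le_nhds
    have e0 : ∀ᶠ ε : ℝ in nhdsWithin 0 (Set.Ioi 0), 0 < ε := self_mem_nhdsWithin
    have e1 : ∀ᶠ ε : ℝ in nhdsWithin 0 (Set.Ioi 0), ∀ c ∈ {c : List α | c.Nodup},
        0 < (c.map a).sum → ε * c.length < (c.map a).sum := by
      rw [Filter.eventually_all_finite hfin]
      intro c _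
      by_cases h : 0 < (c.map a).sum
      · filter_upwards [(ht c.length).eventually_lt_const h] with ε h' _ using h'
      · exact Filter.Eventually.of_forall fun ε h' => absurd h' h
    have e2 : ∀ᶠ ε : ℝ in nhdsWithin 0 (Set.Ioi 0), ∀ c ∈ {c : List α | c.Nodup}, ∀ h : c ≠ [],
        l (c.getLast h) - (c.tail.map a).sum < u (c.head h) →
        l (c.getLast h) - (c.tail.map a).sum + ε * c.length < u (c.head h) := by
      rw [Filter.eventually_all_finite hfin]
      intro c _
      by_cases h : c ≠ []
      · by_cases h2 : l (c.getLast h) - (c.tail.map a).sum < u (c.head h)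
        · filter_upwards [(ht c.length).eventually_lt_const (sub_pos.2 h2)] with ε h' _ _
          linarith
        · exact Filter.Eventually.of_forall fun ε _ h' => absurd h' h2
      · exact Filter.Eventually.of_forall fun ε h' => absurd h' h
    obtain ⟨ε, h0, h1, h2⟩ := (e0.and (e1.and e2)).exists
    exact ⟨ε, h0, h1, h2⟩
  let P : α → Set (List α) := fun t =>
    {c | (t :: c).Nodup ∧ (t :: c).IsChain (fun x y => R y x)}
  -- The lower bound forced on `w t` by a simple path ending at `t`, starting from the bound `l` at
  -- its first vertex (the last entry of the list) and gaining `ε` at each vertex. The solution is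
  -- the maximum over all such paths.
  let f : α → List α → ℝ := fun t c =>
    l ((t :: c).getLast (List.cons_ne_nil _ _)) - (c.map a).sum + ε * (t :: c).length
  have hPfin : ∀ t, (P t).Finite := fun t => hfin.subset fun c hc => (List.nodup_cons.1 hc.1).2
  have hPne : ∀ t, (P t).Nonempty := fun t => ⟨[], by simp [P]⟩
  choose m hm hmax using fun t => Set.exists_max_image (P t) (f t) (hPfin t) (hPne t)
  have ffac : ∀ (s : α) (c : List α) (c1 c2 : List α) (t : α), s :: c = c1 ++ t :: c2 →
      f s c - a s = f t c2 - ((c1 ++ [t]).map a).sum + ε * c1.length := by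
    intro s c c1 c2 t h
    have h1 : (s :: c).getLast (List.cons_ne_nil _ _) =
        (t :: c2).getLast (List.cons_ne_nil _ _) := by
      simp only [h]
      rw [List.getLast_append_of_ne_nil]
    have h2 : a s + (c.map a).sum = (c1.map a).sum + (a t + (c2.map a).sum) := by
      have := congrArg (fun d => (d.map a).sum) h
      simpa using this
    have h3 : ((s :: c).length : ℝ) = c1.length + (t :: c2).length := by
      rw [h]; simp
    simp only [f]
    rw [h1, h3]
    simp only [List.map_append, List.sum_append, List.map_cons, List.map_nil, List.sum_cons,
      List.sum_nil]
    linear_combination -h2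
  refine ⟨fun t => f t (m t), fun t => ⟨?_, ?_⟩, fun s t hst => ?_⟩
  · have : f t [] ≤ f t (m t) := hmax t [] (by simp [P])
    refine lt_of_lt_of_le ?_ this
    simp [f, hε]
  · exact hε2 (t :: m t) (hm t).1 (List.cons_ne_nil _ _) (hpath t _ (hm t).1 (hm t).2)
  -- If `t` lies on the optimal path of `s`, then closing up by `s → t` creates a simple cycle; its
  -- sum exceeds `ε` times its length, so the initial part of the path up to `t` already gives the
  -- required bound. Otherwise the path is prolonged by `t`, which gains `ε`.
  · by_cases ht : t ∈ s :: m s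
    · obtain ⟨c1, c2, hc⟩ := List.append_of_mem ht
      have hnd := (hm s).1
      have hch := (hm s).2
      rw [hc] at hnd hch
      have e : c1 ++ t :: c2 = (c1 ++ [t]) ++ c2 := by simp
      have hcyc : 0 < ((c1 ++ [t]).map a).sum := by
        refine hcycle (c1 ++ [t]) s t ?_ ?_ ?_ (by simp) hst
        · rw [e] at hnd
          exact (List.nodup_append.1 hnd).1
        · rw [e] at hch
          exact hch.left_of_append
        · cases c1 with
          | nil => simp at hc ⊢; exact hc.1.symm
          | cons x c1 => simp at hc ⊢; exact hc.1.symm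
      have h1 := hε1 (c1 ++ [t]) (by rw [e] at hnd; exact (List.nodup_append.1 hnd).1) hcyc
      have h2 : f t c2 ≤ f t (m t) := hmax t c2
        ⟨(List.nodup_append.1 hnd).2.1, hch.right_of_append⟩
      have h3 := ffac s (m s) c1 c2 t hc
      simp only [List.length_append, List.length_singleton, Nat.cast_add, Nat.cast_one] at h1
      show f s (m s) - a s < f t (m t)
      rw [h3]
      nlinarith
    · have h1 : f t (s :: m s) ≤ f t (m t) := hmax t _ ⟨List.nodup_cons.2 ⟨ht, (hm s).1⟩,
        List.isChain_cons_cons.2 ⟨hst, (hm s).2⟩⟩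
      have h2 := ffac t (s :: m s) [t] (m s) s rfl
      show f s (m s) - a s < f t (m t)
      simp at h2
      linarith

/-! ### Feasibility of the linear constraints on the red sides -/

namespace IdealTriangulation

variable {ι : Type*} (T : IdealTriangulation ι)

theorem edge_glue (s : ι × Fin 3) : T.edge (T.glue s) = T.edge s :=
  Quotient.sound (s := T.sideSetoid) (Or.inr (T.glue_glue s).symm)

/-- After eliminating `w (glue s) = z - w s`, positivity of a pairwise sum reads `w s - z < w t`
whenever the crossing `t` may follow `s`. This is a difference constraint along `Follows`, whose
simple paths and cycles are edge paths and edge cycles. -/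
theorem exists_feasible [Finite ι] (z : T.Edge → ℝ) {B : ℝ} (hB : 0 < B)
    (h1 : ∀ e, z e < 2 * B)
    (h2 : ∀ c, c.Nodup → T.IsEdgePath c → -(2 * B) < T.pathSum z c)
    (h3 : ∀ c, c.Nodup → T.IsEdgeCycle c → 0 < T.pathSum z c) :
    ∃ w : ι × Fin 3 → ℝ, (∀ s, w s + w (T.glue s) = z (T.edge s)) ∧ (∀ s, |w s| < B) ∧
      ∀ s t, s.1 = t.1 → s ≠ t → 0 < w s + w t := by
  set a : ι × Fin 3 → ℝ := fun s => z (T.edge s) with ha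
  have hag : ∀ s, a (T.glue s) = a s := fun s => by simp only [ha, T.edge_glue]
  have hP : ∀ c : List (ι × Fin 3), c.Nodup → c.IsChain (fun x y => T.Follows y x) →
      -(2 * B) < (c.map a).sum := by
    intro c hc hch
    by_cases hn : c = []
    · simp [hn, hB]
    · have := h2 c.reverse (List.nodup_reverse.2 hc)
        ⟨by simpa using hn, List.isChain_reverse.2 hch⟩
      rw [pathSum, List.map_reverse, List.sum_reverse] at this
      exact this
  -- The bounds combine `|w s| < B` with the same condition `|a s - w s| < B` for the partner of
  -- `s`.
  obtain ⟨w, hw, hwR⟩ := exists_difference_solution T.Follows a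
    (fun s => max (-B) (a s - B)) (fun s => min B (a s + B)) (by
      intro c s t hc hch hs ht hst
      have hn : c ≠ [] := by rintro rfl; simp at hs
      have := h3 c.reverse (List.nodup_reverse.2 hc)
        ⟨⟨by simpa using hn, List.isChain_reverse.2 hch⟩, by simpa using hn, by
          rw [List.getLast_reverse, List.head_reverse]
          rw [List.head?_eq_some_head hn] at hs
          rw [List.getLast?_eq_some_getLast hn] at ht
          cases hs; cases ht
          exact hst⟩
      rw [pathSum, List.map_reverse, List.sum_reverse] at this
      exact this) (by
      intro t c hc hch
      have p1 := hP (t :: c) hc hch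
      have hcn := (List.nodup_cons.1 hc).2
      have p2 := hP c hcn hch.tail
      have ht := h1 (T.edge t)
      rw [List.map_cons, List.sum_cons] at p1
      -- Each bound is a maximum or minimum of two terms, so four inequalities arise. For a path
      -- with at least two crossings they are the path conditions with either, both or neither of
      -- the end crossings deleted; for a single crossing the edge bound `h1` is needed as well.
      rcases List.eq_nil_or_concat' c with rfl | ⟨d, x, rfl⟩
      · simp only [List.getLast_singleton, List.map_nil, List.sum_nil, sub_zero] at p1 ⊢
        simp only [max_lt_iff, lt_min_iff]
        refine ⟨⟨?_, ?_⟩, ?_, ?_⟩ <;> simp only [ha] at * <;> linarith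
      · have q1 := hP (t :: d) (by
          have : t :: (d ++ [x]) = (t :: d) ++ [x] := rfl
          rw [this] at hc
          exact (List.nodup_append.1 hc).1) (by
          have : t :: (d ++ [x]) = (t :: d) ++ [x] := rfl
          rw [this] at hch
          exact hch.left_of_append)
        have q2 := hP d (List.nodup_append.1 hcn).1 hch.tail.left_of_append
        have hl : (t :: (d ++ [x])).getLast (List.cons_ne_nil _ _) = x := by simp
        rw [List.map_cons, List.sum_cons] at q1
        rw [hl]
        simp only [List.map_append, List.sum_append, List.map_cons, List.map_nil, List.sum_cons,
          List.sum_nil, add_zero] at p1 p2 ⊢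
        rw [sub_lt_iff_lt_add, max_lt_iff, ← sub_lt_iff_lt_add, ← sub_lt_iff_lt_add, lt_min_iff,
          lt_min_iff]
        refine ⟨⟨?_, ?_⟩, ?_, ?_⟩ <;> linarith)
  -- The difference solution need not satisfy `w s + w (glue s) = a s`. The constraints are
  -- invariant under `w s ↦ a s - w (glue s)`, and averaging with this involution enforces the
  -- equation.
  refine ⟨fun s => (w s + a s - w (T.glue s)) / 2, fun s => ?_, fun s => ?_, fun s t hst hne => ?_⟩
  · simp only [T.glue_glue, hag]
    ring
  · have b1 := hw s
    have b2 := hw (T.glue s)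
    simp only [max_lt_iff, lt_min_iff, hag] at b1 b2
    rw [abs_lt]
    constructor <;> linarith [b1.1.1, b1.1.2, b1.2.1, b1.2.2, b2.1.1, b2.1.2, b2.2.1, b2.2.2]
  · have r1 := hwR (T.glue s) t ⟨by rw [T.glue_glue]; exact hst.symm, by
      rw [T.glue_glue]; exact hne.symm⟩
    have r2 := hwR (T.glue t) s ⟨by rw [T.glue_glue]; exact hst, by
      rw [T.glue_glue]; exact hne⟩
    rw [hag] at r1 r2
    simp only
    linarith

end IdealTriangulation

end LuoCoord

end

noncomputable section

namespace LuoCoord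

open MeasureTheory Filter Topology

/-! ### The primitive of `cosh ^ lam` -/

/-- The function `r ↦ ∫₀^r cosh^lam t dt`. -/
def coshPrimitive (lam r : ℝ) : ℝ := ∫ t in (0 : ℝ)..r, Real.cosh t ^ lam

theorem continuous_cosh_rpow (lam : ℝ) : Continuous fun t : ℝ => Real.cosh t ^ lam :=
  Real.continuous_cosh.rpow_const fun t => Or.inl (Real.cosh_pos t).ne'

theorem cosh_rpow_pos (lam t : ℝ) : 0 < Real.cosh t ^ lam := Real.rpow_pos_of_pos (Real.cosh_pos t) _

theorem hasStrictDerivAt_coshPrimitive (lam r : ℝ) :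
    HasStrictDerivAt (coshPrimitive lam) (Real.cosh r ^ lam) r :=
  intervalIntegral.integral_hasStrictDerivAt_right
    ((continuous_cosh_rpow lam).intervalIntegrable _ _)
    ((continuous_cosh_rpow lam).stronglyMeasurableAtFilter _ _)
    (continuous_cosh_rpow lam).continuousAt

theorem hasDerivAt_coshPrimitive (lam r : ℝ) :
    HasDerivAt (coshPrimitive lam) (Real.cosh r ^ lam) r :=
  (hasStrictDerivAt_coshPrimitive lam r).hasDerivAt

theorem strictMono_coshPrimitive (lam : ℝ) : StrictMono (coshPrimitive lam) :=
  strictMono_of_hasDerivAt_pos (hasDerivAt_coshPrimitive lam) fun r => cosh_rpow_pos lam r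

theorem continuous_coshPrimitive (lam : ℝ) : Continuous (coshPrimitive lam) :=
  continuous_iff_continuousAt.2 fun r => (hasDerivAt_coshPrimitive lam r).continuousAt

@[simp] theorem coshPrimitive_zero (lam : ℝ) : coshPrimitive lam 0 = 0 := by simp [coshPrimitive]

theorem coshPrimitive_neg (lam r : ℝ) : coshPrimitive lam (-r) = -coshPrimitive lam r := by
  have h := intervalIntegral.integral_comp_neg (a := 0) (b := r) fun t : ℝ => Real.cosh t ^ lam
  simp only [Real.cosh_neg, neg_zero] at h
  rw [coshPrimitive, coshPrimitive, h, intervalIntegral.integral_symm]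

theorem ofReal_coshPrimitive (lam : ℝ) {r : ℝ} (hr : 0 ≤ r) :
    ENNReal.ofReal (coshPrimitive lam r) =
      ∫⁻ t in Set.Ioc 0 r, ENNReal.ofReal (Real.cosh t ^ lam) := by
  rw [coshPrimitive, intervalIntegral.integral_of_le hr, ofReal_integral_eq_lintegral_ofReal]
  · exact ((continuous_cosh_rpow lam).intervalIntegrable 0 r).1
  · exact Eventually.of_forall fun t => (cosh_rpow_pos lam t).le

theorem coshIntegral_eq_iSup (lam : ℝ) :
    coshIntegral lam = ⨆ n : ℕ, ENNReal.ofReal (coshPrimitive lam n) := by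
  have h : Set.Ioi (0 : ℝ) = ⋃ n : ℕ, Set.Ioc (0 : ℝ) n := by
    ext t
    simp only [Set.mem_Ioi, Set.mem_iUnion, Set.mem_Ioc]
    exact ⟨fun ht => (exists_nat_ge t).imp fun n hn => ⟨ht, hn⟩, fun ⟨_, hn⟩ => hn.1⟩
  rw [coshIntegral, h, setLIntegral_iUnion_of_directed]
  · exact iSup_congr fun n => (ofReal_coshPrimitive lam n.cast_nonneg).symm
  · refine directed_of_isDirected_le fun m n hmn => Set.Ioc_subset_Ioc_right ?_
    exact_mod_cast hmn

theorem ofReal_coshPrimitive_lt (lam : ℝ) (r : ℝ) :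
    ENNReal.ofReal (coshPrimitive lam r) < coshIntegral lam := by
  obtain ⟨n, hn⟩ := exists_nat_gt (max r 0)
  rw [max_lt_iff] at hn
  rw [coshIntegral_eq_iSup]
  refine lt_of_lt_of_le ?_ (le_iSup _ n)
  refine (ENNReal.ofReal_lt_ofReal_iff ?_).2 (strictMono_coshPrimitive lam hn.1)
  rw [← coshPrimitive_zero lam]
  exact strictMono_coshPrimitive lam hn.2

/-- The range of `coshPrimitive` is the open interval of radius `coshIntegral`. -/
theorem mem_range_coshPrimitive {lam y : ℝ} :
    y ∈ Set.range (coshPrimitive lam) ↔ ENNReal.ofReal |y| < coshIntegral lam := by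
  have key : ∀ y : ℝ, 0 ≤ y → ENNReal.ofReal y < coshIntegral lam →
      y ∈ Set.range (coshPrimitive lam) := by
    intro y hy h
    rw [coshIntegral_eq_iSup, lt_iSup_iff] at h
    obtain ⟨n, hn⟩ := h
    have hn' := (ENNReal.ofReal_lt_ofReal_iff'.1 hn).1
    have := intermediate_value_Icc (n.cast_nonneg (α := ℝ))
      (continuous_coshPrimitive lam).continuousOn
    rw [coshPrimitive_zero] at this
    obtain ⟨x, -, hx⟩ := this ⟨hy, hn'.le⟩
    exact ⟨x, hx⟩
  constructor
  · rintro ⟨r, rfl⟩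
    rcases abs_choice (coshPrimitive lam r) with h | h
    · rw [h]; exact ofReal_coshPrimitive_lt lam r
    · rw [h, ← coshPrimitive_neg]; exact ofReal_coshPrimitive_lt lam (-r)
  · intro h
    rcases le_total 0 y with hy | hy
    · rw [abs_of_nonneg hy] at h
      exact key y hy h
    · rw [abs_of_nonpos hy] at h
      obtain ⟨r, hr⟩ := key (-y) (neg_nonneg.2 hy) h
      exact ⟨-r, by rw [coshPrimitive_neg, hr, neg_neg]⟩

theorem coshIntegral_pos (lam : ℝ) : 0 < coshIntegral lam := by
  simpa using ofReal_coshPrimitive_lt lam 0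

theorem coshIntegral_of_nonneg {lam : ℝ} (h : 0 ≤ lam) : coshIntegral lam = ⊤ := by
  rw [coshIntegral_eq_iSup]
  apply ENNReal.eq_top_of_forall_nnreal_le
  intro x
  obtain ⟨n, hn⟩ := exists_nat_ge (x : ℝ)
  refine le_trans ?_ (le_iSup _ n)
  rw [← ENNReal.ofReal_coe_nnreal]
  apply ENNReal.ofReal_le_ofReal
  refine hn.trans ?_
  have : ∫ t in (0 : ℝ)..n, (1 : ℝ) ≤ coshPrimitive lam n := by
    refine intervalIntegral.integral_mono_on n.cast_nonneg (by simp)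
      ((continuous_cosh_rpow lam).intervalIntegrable _ _) fun t _ => ?_
    exact Real.one_le_rpow (Real.one_le_cosh t) h
  simpa using this

/-- From `cosh r ≥ exp r / 2` the integrand is at most `2 ^ (-lam) * exp (lam * r)`, whose integral
over the half-line is `2 ^ (-lam) / (-lam)`. -/
theorem coshIntegral_lt_top {lam : ℝ} (h : lam < 0) : coshIntegral lam < ⊤ := by
  have hanti : Antitone fun r => -lam * coshPrimitive lam r + 2 ^ (-lam) * Real.exp (lam * r) := by
    refine antitone_of_hasDerivAt_nonpos (f' := fun r => -lam * Real.cosh r ^ lam +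
      2 ^ (-lam) * (Real.exp (lam * r) * (lam * 1))) (fun r => ?_) fun r => ?_
    · exact ((hasDerivAt_coshPrimitive lam r).const_mul _).add
        (((hasDerivAt_id r).const_mul lam).exp.const_mul _)
    · have h1 : Real.cosh r ^ lam ≤ (Real.exp r / 2) ^ lam := by
        refine Real.rpow_le_rpow_of_nonpos (by positivity) ?_ h.le
        rw [Real.cosh_eq]
        have := Real.exp_pos (-r)
        linarith
      have h2 : (Real.exp r / 2) ^ lam = 2 ^ (-lam) * Real.exp (lam * r) := by
        rw [Real.div_rpow (Real.exp_pos r).le zero_le_two, Real.rpow_neg zero_le_two,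
          ← Real.exp_mul, mul_comm r lam]
        field_simp
      rw [h2] at h1
      have := mul_le_mul_of_nonneg_left h1 (neg_pos.2 h).le
      show _ ≤ (0 : ℝ)
      linarith
  refine lt_of_le_of_lt (b := ENNReal.ofReal (2 ^ (-lam) / (-lam))) ?_ ENNReal.ofReal_lt_top
  rw [coshIntegral_eq_iSup]
  refine iSup_le fun n => ENNReal.ofReal_le_ofReal ?_
  have := hanti (n.cast_nonneg (α := ℝ))
  simp only [coshPrimitive_zero, mul_zero, Real.exp_zero, mul_one, zero_add] at this
  have h3 : 0 < (2 : ℝ) ^ (-lam) * Real.exp (lam * n) := by positivity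
  rw [le_div_iff₀ (neg_pos.2 h)]
  linarith

theorem coshIntegral_strictMonoOn {lam₁ lam₂ : ℝ} (h : lam₁ < lam₂) (h₂ : lam₂ < 0) :
    coshIntegral lam₁ < coshIntegral lam₂ := by
  refine lintegral_strict_mono ?_ ?_ (coshIntegral_lt_top (h.trans h₂)).ne ?_
  · simp
  · exact (continuous_cosh_rpow lam₂).measurable.ennreal_ofReal.aemeasurable
  · refine (ae_restrict_mem measurableSet_Ioi).mono fun t ht => ?_
    rw [ENNReal.ofReal_lt_ofReal_iff (cosh_rpow_pos _ _)]
    exact Real.rpow_lt_rpow_of_exponent_lt (Real.one_lt_cosh.2 (ne_of_gt ht)) h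

/-- Dominated convergence along `lam = -(n + 1)`, with `cosh⁻¹` as dominating function: the
integrand tends to `0` at every `t > 0`. -/
theorem exists_coshIntegral_lt {ε : ℝ≥0∞} (hε : 0 < ε) : ∃ lam < 0, coshIntegral lam < ε := by
  have h : Tendsto (fun n : ℕ => coshIntegral (-(n + 1 : ℝ))) atTop
      (𝓝 (∫⁻ t in Set.Ioi (0 : ℝ), 0)) := by
    refine tendsto_lintegral_of_dominated_convergence
      (fun t => ENNReal.ofReal (Real.cosh t ^ (-1 : ℝ))) (fun n => ?_) (fun n => ?_) ?_ ?_
    · exact (continuous_cosh_rpow _).measurable.ennreal_ofReal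
    · refine Eventually.of_forall fun t => ENNReal.ofReal_le_ofReal ?_
      refine Real.rpow_le_rpow_of_exponent_le (Real.one_le_cosh t) ?_
      have := n.cast_nonneg (α := ℝ)
      linarith
    · exact (coshIntegral_lt_top (by norm_num)).ne
    · refine (ae_restrict_mem measurableSet_Ioi).mono fun t ht => ?_
      rw [← ENNReal.ofReal_zero]
      refine ENNReal.tendsto_ofReal ?_
      have h1 : (Real.cosh t)⁻¹ < 1 := inv_lt_one_of_one_lt₀ (Real.one_lt_cosh.2 (ne_of_gt ht))
      have h2 := (tendsto_pow_atTop_nhds_zero_of_lt_one (inv_pos.2 (Real.cosh_pos t)).le h1).comp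
        (tendsto_add_atTop_nat 1)
      refine h2.congr fun n => ?_
      simp only [Function.comp]
      rw [Real.rpow_neg (Real.cosh_pos t).le, inv_pow]
      norm_cast
  rw [lintegral_zero] at h
  obtain ⟨n, hn⟩ := (h.eventually_lt_const hε).exists
  exact ⟨_, by have := n.cast_nonneg (α := ℝ); linarith, hn⟩

theorem isOpenEmbedding_coshPrimitive (lam : ℝ) : IsOpenEmbedding (coshPrimitive lam) :=
  .of_continuous_injective_isOpenMap (continuous_coshPrimitive lam)
    (strictMono_coshPrimitive lam).injective
    (isOpenMap_of_hasStrictDerivAt (hasStrictDerivAt_coshPrimitive lam)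
      fun r => (cosh_rpow_pos lam r).ne')

/-- The inverse of `coshPrimitive lam` on its range. -/
def coshInv (lam : ℝ) : ℝ → ℝ :=
  ((isOpenEmbedding_coshPrimitive lam).toOpenPartialHomeomorph (coshPrimitive lam)).symm

@[simp] theorem coshInv_coshPrimitive (lam r : ℝ) : coshInv lam (coshPrimitive lam r) = r :=
  (isOpenEmbedding_coshPrimitive lam).toOpenPartialHomeomorph_left_inv

theorem coshPrimitive_coshInv {lam y : ℝ} (hy : y ∈ Set.range (coshPrimitive lam)) :
    coshPrimitive lam (coshInv lam y) = y :=
  (isOpenEmbedding_coshPrimitive lam).toOpenPartialHomeomorph_right_inv _ hy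

theorem hasDerivAt_coshInv {lam y : ℝ} (hy : y ∈ Set.range (coshPrimitive lam)) :
    HasDerivAt (coshInv lam) (Real.cosh (coshInv lam y) ^ (-lam)) y := by
  have := ((isOpenEmbedding_coshPrimitive lam).toOpenPartialHomeomorph
    (coshPrimitive lam)).hasDerivAt_symm (a := y) (f' := Real.cosh (coshInv lam y) ^ lam)
    (by simpa using hy) (cosh_rpow_pos lam _).ne' (hasDerivAt_coshPrimitive lam _)
  rw [Real.rpow_neg (Real.cosh_pos _).le]
  exact this

/-! ### The potential of a right-angled hexagon -/

/-- For a hexagon with coordinates `a`, `b`, `c` this is `log tanh²(x / 2)`, where `x` is the length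
of the red side with coordinate `a`. -/
def logRatio (a b c : ℝ) : ℝ :=
  Real.log (Real.cosh b) + Real.log (Real.cosh c) - Real.log (Real.cosh (a + b + c)) -
    Real.log (Real.cosh a)

theorem exp_logRatio (a b c : ℝ) : Real.exp (logRatio a b c) =
    Real.cosh b * Real.cosh c / (Real.cosh (a + b + c) * Real.cosh a) := by
  rw [logRatio, Real.exp_sub, Real.exp_sub, Real.exp_add, Real.exp_log (Real.cosh_pos _),
    Real.exp_log (Real.cosh_pos _), Real.exp_log (Real.cosh_pos _), Real.exp_log (Real.cosh_pos _),
    div_div]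

theorem one_sub_exp_logRatio (a b c : ℝ) : 1 - Real.exp (logRatio a b c) =
    Real.sinh (c + a) * Real.sinh (a + b) / (Real.cosh (a + b + c) * Real.cosh a) := by
  rw [exp_logRatio, ← cosh_mul_cosh_sub_cosh_mul_cosh]
  have h1 := (Real.cosh_pos a).ne'
  have h2 := (Real.cosh_pos (a + b + c)).ne'
  field_simp

theorem logRatio_neg {a b c : ℝ} (h1 : 0 < c + a) (h2 : 0 < a + b) : logRatio a b c < 0 := by
  rw [← Real.exp_lt_one_iff, ← sub_pos, one_sub_exp_logRatio]
  exact div_pos (mul_pos (Real.sinh_pos_iff.2 h1) (Real.sinh_pos_iff.2 h2))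
    (mul_pos (Real.cosh_pos _) (Real.cosh_pos _))

/-- The integrand is dictated by closedness: by `exp_mul_logRatio` and `one_sub_exp_logRatio`, this
exponential weight turns the mixed partial derivatives of the 1-form into symmetric expressions in
the two sides. The pole at `0` makes the slope infinite for infinitely long red sides. -/
theorem exists_slope (lam : ℝ) : ∃ U : ℝ → ℝ, ∀ x < 0,
    HasDerivAt U (Real.exp ((1 + lam / 2) * x) / (1 - Real.exp x)) x := by
  obtain ⟨U, hU⟩ := (convex_Iio (0 : ℝ)).exists_forall_hasDerivWithinAt (𝕜 := ℝ)
    (f := fun x => Real.exp ((1 + lam / 2) * x) / (1 - Real.exp x)) (by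
      intro x hx
      have : 1 - Real.exp x ≠ 0 := (sub_pos.2 (Real.exp_lt_one_iff.2 hx)).ne'
      exact DifferentiableAt.differentiableWithinAt (by fun_prop (disch := assumption)))
  exact ⟨U, fun x hx => (hU x hx).hasDerivAt (Iio_mem_nhds hx)⟩

/-- A primitive of `exp ((1 + lam / 2) x) / (1 - exp x)` on the negative reals. -/
def slope (lam : ℝ) : ℝ → ℝ := (exists_slope lam).choose

theorem hasDerivAt_slope (lam : ℝ) {x : ℝ} (hx : x < 0) :
    HasDerivAt (slope lam) (Real.exp ((1 + lam / 2) * x) / (1 - Real.exp x)) x :=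
  (exists_slope lam).choose_spec x hx

theorem slope_strictMonoOn (lam : ℝ) : StrictMonoOn (slope lam) (Set.Iio 0) := by
  refine strictMonoOn_of_deriv_pos (convex_Iio 0)
    (fun x hx => (hasDerivAt_slope lam hx).continuousAt.continuousWithinAt) fun x hx => ?_
  rw [interior_Iio] at hx
  rw [(hasDerivAt_slope lam hx).deriv]
  exact div_pos (Real.exp_pos _) (sub_pos.2 (Real.exp_lt_one_iff.2 hx))

/-- Near `0` the derivative is at least `c / (-x)`, so `slope` grows at least like `-c * log (-x)`.
The constant bounds the exponential factor from below on `(-1, 0)`. -/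
theorem tendsto_slope_zero (lam : ℝ) : Tendsto (slope lam) (𝓝[<] 0) atTop := by
  set c := Real.exp (-|1 + lam / 2|) with hc
  have hcpos : 0 < c := Real.exp_pos _
  have hmono : MonotoneOn (fun x => slope lam x + c * Real.log (-x)) (Set.Ioo (-1) 0) := by
    have hd : ∀ x ∈ Set.Ioo (-1 : ℝ) 0, HasDerivAt (fun x => slope lam x + c * Real.log (-x))
        (Real.exp ((1 + lam / 2) * x) / (1 - Real.exp x) + c * (-1 / (-x))) x := fun x hx =>
      (hasDerivAt_slope lam hx.2).add
        (((hasDerivAt_id x).neg.log (neg_ne_zero.2 hx.2.ne)).const_mul c)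
    refine monotoneOn_of_deriv_nonneg (convex_Ioo _ _)
      (fun x hx => (hd x hx).continuousAt.continuousWithinAt)
      (fun x hx => ?_) fun x hx => ?_
    · rw [interior_Ioo] at hx
      exact (hd x hx).differentiableAt.differentiableWithinAt
    · rw [interior_Ioo] at hx
      rw [(hd x hx).deriv]
      have h1 : c ≤ Real.exp ((1 + lam / 2) * x) := by
        rw [hc, Real.exp_le_exp]
        have : |(1 + lam / 2) * x| ≤ |1 + lam / 2| := by
          rw [abs_mul]
          refine mul_le_of_le_one_right (abs_nonneg _) ?_
          rw [abs_le]; constructor <;> linarith [hx.1, hx.2]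
        linarith [neg_abs_le ((1 + lam / 2) * x)]
      have h2 : 1 - Real.exp x ≤ -x := by linarith [Real.add_one_le_exp x]
      have h3 : 0 < 1 - Real.exp x := sub_pos.2 (Real.exp_lt_one_iff.2 hx.2)
      have h4 : c / (-x) ≤ Real.exp ((1 + lam / 2) * x) / (1 - Real.exp x) :=
        div_le_div₀ (Real.exp_pos _).le h1 h3 h2
      have h5 : c * (-1 / (-x)) = -(c / (-x)) := by ring
      rw [h5]; linarith
  have hlog : Tendsto (fun x : ℝ => -(c * Real.log (-x))) (𝓝[<] 0) atTop := by
    have h1 : Tendsto (fun x : ℝ => -x) (𝓝[<] 0) (𝓝[>] 0) := by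
      have := tendsto_neg_nhdsLT (a := (0 : ℝ))
      rwa [neg_zero] at this
    have h2 := (Real.tendsto_log_nhdsGT_zero.comp h1).const_mul_atBot hcpos
    exact tendsto_neg_atBot_atTop.comp h2
  have hm : (-1 / 2 : ℝ) ∈ Set.Ioo (-1 : ℝ) 0 := by constructor <;> norm_num
  refine tendsto_atTop_mono' _ ?_ (tendsto_atTop_add_const_left _
    (slope lam (-1 / 2) + c * Real.log (-(-1 / 2))) hlog)
  filter_upwards [Ioo_mem_nhdsLT (show (-1 / 2 : ℝ) < 0 by norm_num)] with x hx
  have := hmono hm ⟨by linarith [hx.1], hx.2⟩ hx.1.le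
  simp only at this
  linarith

/-- The triples of coordinates of right-angled hexagons. -/
def coordCone : Set (Fin 3 → ℝ) := {r | ∀ i, 0 < r (i + 1) + r (i + 2)}

/-- The hyperbolic sine of the length of the A-arc facing the `i`-th red side. -/
def arcSinh (r : Fin 3 → ℝ) (i : Fin 3) : ℝ := Real.sinh (r (i + 1) + r (i + 2))

theorem arcSinh_pos {r : Fin 3 → ℝ} (hr : r ∈ coordCone) (i : Fin 3) : 0 < arcSinh r i :=
  Real.sinh_pos_iff.2 (hr i)

/-- The weight common to all second derivatives of the potential. -/
def hexWeight (lam : ℝ) (r : Fin 3 → ℝ) : ℝ :=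
  (Real.cosh (r 0) * Real.cosh (r 1) * Real.cosh (r 2) / Real.cosh (r 0 + r 1 + r 2)) ^
    (1 + lam / 2)

theorem hexWeight_pos (lam : ℝ) (r : Fin 3 → ℝ) : 0 < hexWeight lam r := by
  have h := fun x => Real.cosh_pos x
  exact Real.rpow_pos_of_pos (div_pos (mul_pos (mul_pos (h _) (h _)) (h _)) (h _)) _

/-- The logarithm of `tanh²(x / 2)`, `x` the length of the `i`-th red side. -/
def sideLog (r : Fin 3 → ℝ) (i : Fin 3) : ℝ := logRatio (r i) (r (i + 1)) (r (i + 2))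

theorem sideLog_neg {r : Fin 3 → ℝ} (hr : r ∈ coordCone) (i : Fin 3) : sideLog r i < 0 := by
  have e1 : i + 1 + 1 = i + 2 := by fin_cases i <;> rfl
  have e2 : i + 1 + 2 = i := by fin_cases i <;> rfl
  have e3 : i + 2 + 1 = i := by fin_cases i <;> rfl
  have e4 : i + 2 + 2 = i + 1 := by fin_cases i <;> rfl
  have h1 := hr (i + 1)
  have h2 := hr (i + 2)
  rw [e1, e2] at h1
  rw [e3, e4] at h2
  exact logRatio_neg h1 h2

theorem hasDerivAt_log_cosh {f : ℝ → ℝ} {f' τ : ℝ} (hf : HasDerivAt f f' τ) :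
    HasDerivAt (fun t => Real.log (Real.cosh (f t)))
      (Real.sinh (f τ) * f' / Real.cosh (f τ)) τ :=
  hf.cosh.log (Real.cosh_pos _).ne'

/-- Differences and sums of hyperbolic tangents are rewritten by the addition formulas, so that the
numerators are hyperbolic sines of arc lengths. -/
theorem hasDerivAt_logRatio {a b c : ℝ → ℝ} {a' b' c' τ : ℝ} (ha : HasDerivAt a a' τ)
    (hb : HasDerivAt b b' τ) (hc : HasDerivAt c c' τ) :
    HasDerivAt (fun t => logRatio (a t) (b t) (c t))
      (-(Real.sinh (c τ + a τ) * (b' / Real.cosh (b τ)) +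
        Real.sinh (a τ + b τ) * (c' / Real.cosh (c τ)) +
        Real.sinh (c τ + a τ + (a τ + b τ)) * (a' / Real.cosh (a τ))) /
          Real.cosh (a τ + b τ + c τ)) τ := by
  have h := (((hasDerivAt_log_cosh hb).add (hasDerivAt_log_cosh hc)).sub
    (hasDerivAt_log_cosh ((ha.add hb).add hc))).sub (hasDerivAt_log_cosh ha)
  refine h.congr_deriv ?_
  simp only [Pi.add_apply]
  have e1 : Real.sinh (c τ + a τ) = Real.sinh (a τ + b τ + c τ) * Real.cosh (b τ) -
      Real.cosh (a τ + b τ + c τ) * Real.sinh (b τ) := by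
    rw [← Real.sinh_sub]; ring_nf
  have e2 : Real.sinh (a τ + b τ) = Real.sinh (a τ + b τ + c τ) * Real.cosh (c τ) -
      Real.cosh (a τ + b τ + c τ) * Real.sinh (c τ) := by
    rw [← Real.sinh_sub]; ring_nf
  have e3 : Real.sinh (c τ + a τ + (a τ + b τ)) = Real.sinh (a τ + b τ + c τ) * Real.cosh (a τ) +
      Real.cosh (a τ + b τ + c τ) * Real.sinh (a τ) := by
    rw [← Real.sinh_add]; ring_nf
  rw [e1, e2, e3]
  have h1 := (Real.cosh_pos (a τ)).ne'
  have h2 := (Real.cosh_pos (b τ)).ne'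
  have h3 := (Real.cosh_pos (c τ)).ne'
  have h4 := (Real.cosh_pos (a τ + b τ + c τ)).ne'
  field_simp
  ring

/-- The first factor is symmetric in `a`, `b`, `c`; the rest depends on `a` alone. This separation
is what makes the Hessian symmetric. -/
theorem exp_mul_logRatio (lam a b c : ℝ) : Real.exp ((1 + lam / 2) * logRatio a b c) =
    (Real.cosh a * Real.cosh b * Real.cosh c / Real.cosh (a + b + c)) ^ (1 + lam / 2) *
      Real.cosh a ^ (-1 - lam) / Real.cosh a := by
  have h1 := Real.cosh_pos a
  have h2 := Real.cosh_pos b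
  have h3 := Real.cosh_pos c
  have h4 := Real.cosh_pos (a + b + c)
  rw [mul_comm, Real.exp_mul, exp_logRatio]
  have e : Real.cosh b * Real.cosh c / (Real.cosh (a + b + c) * Real.cosh a) =
      Real.cosh a * Real.cosh b * Real.cosh c / Real.cosh (a + b + c) * Real.cosh a ^ (-2 : ℝ) := by
    rw [Real.rpow_neg h1.le, Real.rpow_two]
    field_simp
  rw [e, Real.mul_rpow (by positivity) (by positivity), ← Real.rpow_mul h1.le,
    eq_div_iff h1.ne', mul_assoc]
  congr 1
  nth_rewrite 2 [← Real.rpow_one (Real.cosh a)]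
  rw [← Real.rpow_add h1]
  ring_nf

theorem hasDerivAt_slope_logRatio (lam : ℝ) {a b c : ℝ → ℝ} {a' b' c' τ : ℝ}
    (ha : HasDerivAt a a' τ) (hb : HasDerivAt b b' τ) (hc : HasDerivAt c c' τ)
    (h1 : 0 < c τ + a τ) (h2 : 0 < a τ + b τ) :
    HasDerivAt (fun t => slope lam (logRatio (a t) (b t) (c t)))
      (-((Real.cosh (a τ) * Real.cosh (b τ) * Real.cosh (c τ) / Real.cosh (a τ + b τ + c τ)) ^
          (1 + lam / 2) * Real.cosh (a τ) ^ (-1 - lam) /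
        (Real.sinh (c τ + a τ) * Real.sinh (a τ + b τ))) *
        (Real.sinh (c τ + a τ) * (b' / Real.cosh (b τ)) +
          Real.sinh (a τ + b τ) * (c' / Real.cosh (c τ)) +
          Real.sinh (c τ + a τ + (a τ + b τ)) * (a' / Real.cosh (a τ)))) τ := by
  have hd := (hasDerivAt_slope lam (logRatio_neg h1 h2)).comp τ (hasDerivAt_logRatio ha hb hc)
  refine hd.congr_deriv ?_
  rw [exp_mul_logRatio, one_sub_exp_logRatio]
  generalize (Real.cosh (a τ) * Real.cosh (b τ) * Real.cosh (c τ) /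
    Real.cosh (a τ + b τ + c τ)) ^ (1 + lam / 2) * Real.cosh (a τ) ^ (-1 - lam) = X
  generalize Real.sinh (c τ + a τ) * (b' / Real.cosh (b τ)) +
          Real.sinh (a τ + b τ) * (c' / Real.cosh (c τ)) +
          Real.sinh (c τ + a τ + (a τ + b τ)) * (a' / Real.cosh (a τ)) = Y
  have h3 := (Real.cosh_pos (a τ)).ne'
  have h4 := (Real.cosh_pos (a τ + b τ + c τ)).ne'
  have h5 := (Real.sinh_pos_iff.2 h1).ne'
  have h6 := (Real.sinh_pos_iff.2 h2).ne'
  field_simp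

theorem hexWeight_eq (lam : ℝ) (r : Fin 3 → ℝ) (i : Fin 3) : hexWeight lam r =
    (Real.cosh (r i) * Real.cosh (r (i + 1)) * Real.cosh (r (i + 2)) /
      Real.cosh (r i + r (i + 1) + r (i + 2))) ^ (1 + lam / 2) := by
  rw [hexWeight]
  congr 1
  fin_cases i
  · rfl
  · simp; ring_nf
  · simp; ring_nf

/-- The derivative of the slope of a red side along a curve of coordinates. -/
theorem hasDerivAt_slope_sideLog (lam : ℝ) {r : ℝ → Fin 3 → ℝ} {r' : Fin 3 → ℝ} {τ : ℝ}
    (h : ∀ i, HasDerivAt (fun t => r t i) (r' i) τ) (hr : r τ ∈ coordCone) (i : Fin 3) :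
    HasDerivAt (fun t => slope lam (sideLog (r t) i))
      (-(hexWeight lam (r τ) * Real.cosh (r τ i) ^ (-1 - lam) /
        (arcSinh (r τ) (i + 1) * arcSinh (r τ) (i + 2))) *
        (arcSinh (r τ) (i + 1) * (r' (i + 1) / Real.cosh (r τ (i + 1))) +
          arcSinh (r τ) (i + 2) * (r' (i + 2) / Real.cosh (r τ (i + 2))) +
          Real.sinh (r τ (i + 2) + r τ i + (r τ i + r τ (i + 1))) *
            (r' i / Real.cosh (r τ i)))) τ := by
  have e1 : i + 1 + 1 = i + 2 := by fin_cases i <;> rfl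
  have e2 : i + 1 + 2 = i := by fin_cases i <;> rfl
  have e3 : i + 2 + 1 = i := by fin_cases i <;> rfl
  have e4 : i + 2 + 2 = i + 1 := by fin_cases i <;> rfl
  have h1 := hr (i + 1)
  have h2 := hr (i + 2)
  rw [e1, e2] at h1
  rw [e3, e4] at h2
  have hd := hasDerivAt_slope_logRatio lam (h i) (h (i + 1)) (h (i + 2)) h1 h2
  rw [← hexWeight_eq lam (r τ) i] at hd
  have hS1 : arcSinh (r τ) (i + 1) = Real.sinh (r τ (i + 2) + r τ i) := by rw [arcSinh, e1, e2]
  have hS2 : arcSinh (r τ) (i + 2) = Real.sinh (r τ i + r τ (i + 1)) := by rw [arcSinh, e3, e4]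
  rw [hS1, hS2]
  exact hd

theorem isOpen_coordCone : IsOpen coordCone := by
  simp only [coordCone, Set.ofPred_forall]
  exact isOpen_iInter_of_finite fun i => isOpen_lt continuous_const (by fun_prop)

theorem convex_coordCone : Convex ℝ coordCone := by
  intro x hx y hy a b ha hb hab i
  have h1 := hx i
  have h2 := hy i
  simp only [Pi.add_apply, Pi.smul_apply, smul_eq_mul]
  have e : a * x (i + 1) + b * y (i + 1) + (a * x (i + 2) + b * y (i + 2)) =
      a * (x (i + 1) + x (i + 2)) + b * (y (i + 1) + y (i + 2)) := by ring
  rw [e]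
  rcases ha.eq_or_lt with rfl | ha
  · have : b = 1 := by linarith
    rw [this]; linarith
  · have := mul_pos ha h1
    have := mul_nonneg hb h2.le
    linarith

/-- Poincaré's lemma on a convex open cone. The factor `cosh^lam` converts `dr i` into `dw i`.
Closedness holds because, in the weights, the mixed partial for `i ≠ j` is minus `hexWeight * cosh
(r i) ^ (-1 - lam) * cosh (r j) ^ (-1 - lam) / arcSinh r k`, with `k` the third index. -/
theorem exists_potential (lam : ℝ) : ∃ V : (Fin 3 → ℝ) → ℝ, ∀ r ∈ coordCone,
    HasFDerivAt V (∑ i, (slope lam (sideLog r i) * Real.cosh (r i) ^ lam) •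
      (ContinuousLinearMap.proj i : (Fin 3 → ℝ) →L[ℝ] ℝ)) r := by
  have hdiffOn : ∀ r ∈ coordCone, DifferentiableAt ℝ (fun r : Fin 3 → ℝ => ∑ i,
      (slope lam (sideLog r i) * Real.cosh (r i) ^ lam) •
        (ContinuousLinearMap.proj i : (Fin 3 → ℝ) →L[ℝ] ℝ)) r := by
    intro r hr
    refine DifferentiableAt.fun_sum fun i _ => DifferentiableAt.smul_const ?_ _
    have hc : ∀ x, Real.cosh x ≠ 0 := fun x => (Real.cosh_pos x).ne'
    refine DifferentiableAt.mul ?_ (DifferentiableAt.rpow_const (by fun_prop) (Or.inl (hc _)))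
    refine (hasDerivAt_slope lam (sideLog_neg hr i)).differentiableAt.comp r ?_
    simp only [sideLog, logRatio]
    fun_prop (disch := intros; apply hc)
  refine convex_coordCone.exists_forall_hasFDerivAt_of_fderiv_symmetric isOpen_coordCone
    (ω := fun r => ∑ i, (slope lam (sideLog r i) * Real.cosh (r i) ^ lam) •
      (ContinuousLinearMap.proj i : (Fin 3 → ℝ) →L[ℝ] ℝ))
    (fun r hr => (hdiffOn r hr).differentiableWithinAt) ?_
  · intro r hr
    have hdiff := hdiffOn r hr
    set ω := fun r : Fin 3 → ℝ => ∑ i,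
        (slope lam (sideLog r i) * Real.cosh (r i) ^ lam) •
          (ContinuousLinearMap.proj i : (Fin 3 → ℝ) →L[ℝ] ℝ) with hω
    set G : (Fin 3 → ℝ) → (Fin 3 → ℝ) → ℝ := fun x y => ∑ i,
      ((-(hexWeight lam r * Real.cosh (r i) ^ (-1 - lam) /
        (arcSinh r (i + 1) * arcSinh r (i + 2))) *
        (arcSinh r (i + 1) * (x (i + 1) / Real.cosh (r (i + 1))) +
          arcSinh r (i + 2) * (x (i + 2) / Real.cosh (r (i + 2))) +
          Real.sinh (r (i + 2) + r i + (r i + r (i + 1))) *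
            (x i / Real.cosh (r i)))) * Real.cosh (r i) ^ lam +
        slope lam (sideLog r i) * (Real.sinh (r i) * x i * lam * Real.cosh (r i) ^ (lam - 1))) *
        y i with hG
    have hfd : ∀ x y, fderiv ℝ ω r x y = G x y := by
      intro x y
      have hcurve : ∀ i, HasDerivAt (fun t : ℝ => (r + t • x) i) (x i) 0 := fun i => by
        simpa using ((hasDerivAt_id (0 : ℝ)).mul_const (x i)).const_add (r i)
      have hcurve' : HasDerivAt (fun t : ℝ => r + t • x) x 0 := hasDerivAt_pi.2 hcurve
      have hr0 : r + (0 : ℝ) • x = r := by simp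
      have h1 : HasDerivAt (fun t : ℝ => ω (r + t • x)) (fderiv ℝ ω r x) 0 := by
        have hf : HasFDerivAt ω (fderiv ℝ ω r) (r + (0 : ℝ) • x) := by
          rw [hr0]
          exact hdiff.hasFDerivAt
        exact hf.comp_hasDerivAt (0 : ℝ) hcurve'
      have h2 : HasDerivAt (fun t : ℝ => ω (r + t • x) y) (fderiv ℝ ω r x y) 0 := by
        simpa using h1.clm_apply (hasDerivAt_const (0 : ℝ) y)
      have h3 : HasDerivAt (fun t : ℝ => ω (r + t • x) y) (G x y) 0 := by
        have : (fun t : ℝ => ω (r + t • x) y) = fun t => ∑ i,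
            (slope lam (sideLog (r + t • x) i) * Real.cosh ((r + t • x) i) ^ lam) * y i := by
          funext t
          simp [hω]
        rw [this]
        refine HasDerivAt.fun_sum fun i _ => HasDerivAt.mul_const ?_ _
        have hs := hasDerivAt_slope_sideLog lam hcurve (by rw [hr0]; exact hr) i
        have hc := (hcurve i).cosh.rpow_const (p := lam) (Or.inl (Real.cosh_pos _).ne')
        have := hs.mul hc
        simp only [hr0] at this
        exact this
      exact h2.unique h3
    intro x y
    rw [hfd, hfd]
    have hC : ∀ i, Real.cosh (r i) ^ (-1 - lam) * Real.cosh (r i) ^ lam =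
        (Real.cosh (r i))⁻¹ := fun i => by
      rw [← Real.rpow_add (Real.cosh_pos _), ← Real.rpow_neg_one]
      ring_nf
    have hS0 := (arcSinh_pos hr 0).ne'
    have hS1 := (arcSinh_pos hr 1).ne'
    have hS2 := (arcSinh_pos hr 2).ne'
    have e3 : (1 : Fin 3) + 2 = 0 := rfl
    have e4 : (2 : Fin 3) + 1 = 0 := rfl
    have e5 : (2 : Fin 3) + 2 = 1 := rfl
    have e6 : (1 : Fin 3) + 1 = 2 := rfl
    -- Over the common denominator the first sum is visibly a symmetric bilinear form; the second
    -- sum, from differentiating `cosh^lam`, is diagonal.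
    have hGx : ∀ x y, G x y = -(hexWeight lam r / (arcSinh r 0 * arcSinh r 1 * arcSinh r 2)) *
        (∑ i, arcSinh r i * (y i / Real.cosh (r i)) *
          (arcSinh r (i + 1) * (x (i + 1) / Real.cosh (r (i + 1))) +
          arcSinh r (i + 2) * (x (i + 2) / Real.cosh (r (i + 2))) +
          Real.sinh (r (i + 2) + r i + (r i + r (i + 1))) * (x i / Real.cosh (r i)))) +
        ∑ i, slope lam (sideLog r i) *
          (Real.sinh (r i) * x i * lam * Real.cosh (r i) ^ (lam - 1)) * y i := by
      intro x y
      simp only [hG]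
      rw [Finset.mul_sum, ← Finset.sum_add_distrib]
      refine Finset.sum_congr rfl fun i _ => ?_
      have hSi := (arcSinh_pos hr i).ne'
      have hSi1 := (arcSinh_pos hr (i + 1)).ne'
      have hSi2 := (arcSinh_pos hr (i + 2)).ne'
      have hprod : arcSinh r 0 * arcSinh r 1 * arcSinh r 2 =
          arcSinh r i * arcSinh r (i + 1) * arcSinh r (i + 2) := by
        fin_cases i
        · rfl
        · simp only [Fin.mk_one, e6, e3]; ring
        · simp only [Fin.reduceFinMk, e4, e5]; ring
      rw [hprod]
      generalize (arcSinh r (i + 1) * (x (i + 1) / Real.cosh (r (i + 1))) +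
          arcSinh r (i + 2) * (x (i + 2) / Real.cosh (r (i + 2))) +
          Real.sinh (r (i + 2) + r i + (r i + r (i + 1))) * (x i / Real.cosh (r i))) = Y
      have h1 : -(hexWeight lam r * Real.cosh (r i) ^ (-1 - lam) /
          (arcSinh r (i + 1) * arcSinh r (i + 2))) * Y * Real.cosh (r i) ^ lam * y i =
          -(hexWeight lam r * (Real.cosh (r i) ^ (-1 - lam) * Real.cosh (r i) ^ lam) /
          (arcSinh r (i + 1) * arcSinh r (i + 2))) * Y * y i := by ring
      rw [add_mul, h1, hC]
      congr 1
      field_simp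
    rw [hGx, hGx]
    congr 1
    · congr 1
      simp only [Fin.sum_univ_three, e3, e4, e5, e6, zero_add]
      ring
    · refine Finset.sum_congr rfl fun i _ => ?_
      ring

/-! ### The potential in the coordinates `∫₀^r cosh^lam` -/

/-- The triples `∫₀^{r i} cosh^lam` for the coordinates `r` of right-angled hexagons. -/
def weightCone (lam : ℝ) : Set (Fin 3 → ℝ) :=
  {w | (∀ i, w i ∈ Set.range (coshPrimitive lam)) ∧ ∀ i, 0 < w (i + 1) + w (i + 2)}

/-- The coordinates of the hexagon with given `∫₀^{r i} cosh^lam`. -/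
def coords (lam : ℝ) (w : Fin 3 → ℝ) (i : Fin 3) : ℝ := coshInv lam (w i)

theorem coshInv_add_pos {lam x y : ℝ} (hx : x ∈ Set.range (coshPrimitive lam))
    (hy : y ∈ Set.range (coshPrimitive lam)) (h : 0 < x + y) :
    0 < coshInv lam x + coshInv lam y := by
  rw [← coshPrimitive_coshInv hx, ← coshPrimitive_coshInv hy, ← neg_lt_iff_pos_add,
    ← coshPrimitive_neg, (strictMono_coshPrimitive lam).lt_iff_lt] at h
  linarith

theorem coords_mem {lam : ℝ} {w : Fin 3 → ℝ} (hw : w ∈ weightCone lam) :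
    coords lam w ∈ coordCone := fun i => coshInv_add_pos (hw.1 _) (hw.1 _) (hw.2 i)

/-- A primitive of the closed 1-form `∑ i, slope (sideLog r i) cosh^lam (r i) dr i`. -/
def coordPotential (lam : ℝ) : (Fin 3 → ℝ) → ℝ := (exists_potential lam).choose

/-- The potential of a hexagon. -/
def hexPotential (lam : ℝ) (w : Fin 3 → ℝ) : ℝ := coordPotential lam (coords lam w)

/-- The partial derivatives of the potential of a hexagon; they are increasing functions of the
lengths of the red sides. -/
def hexSlope (lam : ℝ) (w : Fin 3 → ℝ) (i : Fin 3) : ℝ := slope lam (sideLog (coords lam w) i)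

theorem hasDerivAt_coords {lam : ℝ} {w d : Fin 3 → ℝ} {τ : ℝ} (h : w + τ • d ∈ weightCone lam)
    (i : Fin 3) : HasDerivAt (fun t : ℝ => coords lam (w + t • d) i)
      (Real.cosh (coords lam (w + τ • d) i) ^ (-lam) * d i) τ := by
  have h1 : HasDerivAt (fun t : ℝ => (w + t • d) i) (d i) τ := by
    simpa using ((hasDerivAt_id τ).mul_const (d i)).const_add (w i)
  exact (hasDerivAt_coshInv (h.1 i)).comp τ h1

theorem hasDerivAt_hexPotential {lam : ℝ} {w d : Fin 3 → ℝ} {τ : ℝ}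
    (h : w + τ • d ∈ weightCone lam) :
    HasDerivAt (fun t : ℝ => hexPotential lam (w + t • d))
      (∑ i, hexSlope lam (w + τ • d) i * d i) τ := by
  have h1 : HasDerivAt (fun t : ℝ => coords lam (w + t • d))
      (fun i => Real.cosh (coords lam (w + τ • d) i) ^ (-lam) * d i) τ :=
    hasDerivAt_pi.2 (hasDerivAt_coords h)
  have h2 := ((exists_potential lam).choose_spec _ (coords_mem h)).comp_hasDerivAt τ h1
  refine h2.congr_deriv ?_
  simp only [_root_.sum_apply, _root_.smul_apply,
    ContinuousLinearMap.proj_apply, smul_eq_mul]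
  refine Finset.sum_congr rfl fun i _ => ?_
  -- The factor of the 1-form cancels the derivative of `coshInv`, so the partial derivatives in the
  -- weights are the slopes themselves.
  have : Real.cosh (coords lam (w + τ • d) i) ^ lam *
      Real.cosh (coords lam (w + τ • d) i) ^ (-lam) = 1 := by
    rw [← Real.rpow_add (Real.cosh_pos _)]; simp
  rw [hexSlope]
  linear_combination (slope lam (sideLog (coords lam (w + τ • d)) i) * d i) * this

theorem continuousOn_hexPotential (lam : ℝ) : ContinuousOn (hexPotential lam) (weightCone lam) := by
  intro w hw
  refine ContinuousAt.continuousWithinAt ?_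
  refine ContinuousAt.comp (g := coordPotential lam)
    ((exists_potential lam).choose_spec _ (coords_mem hw)).continuousAt ?_
  refine continuousAt_pi.2 fun i => ?_
  exact ContinuousAt.comp (g := coshInv lam) (hasDerivAt_coshInv (hw.1 i)).continuousAt
    (continuous_apply i).continuousAt

/-- The second derivative of the potential of a hexagon along a line. -/
def secondVariation (lam : ℝ) (r η : Fin 3 → ℝ) : ℝ :=
  -(hexWeight lam r / (arcSinh r 0 * arcSinh r 1 * arcSinh r 2)) *
    ∑ k, arcSinh r (k + 1) * arcSinh r (k + 2) *
      (Real.cosh (r (k + 1) + r (k + 2)) * (η (k + 1) ^ 2 + η (k + 2) ^ 2) +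
        2 * η (k + 1) * η (k + 2))

theorem hasDerivAt_sum_hexSlope {lam : ℝ} {w d : Fin 3 → ℝ} {τ : ℝ}
    (h : w + τ • d ∈ weightCone lam) :
    HasDerivAt (fun t : ℝ => ∑ i, hexSlope lam (w + t • d) i * d i)
      (secondVariation lam (coords lam (w + τ • d))
        fun i => Real.cosh (coords lam (w + τ • d) i) ^ (-1 - lam) * d i) τ := by
  have h1 := fun i => (hasDerivAt_slope_sideLog lam (hasDerivAt_coords h) (coords_mem h) i).mul_const
    (d i)
  have h2 := HasDerivAt.fun_sum (u := Finset.univ) fun i _ => h1 i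
  refine h2.congr_deriv ?_
  have hr := coords_mem h
  set r := coords lam (w + τ • d) with hr_def
  have hη : ∀ i, Real.cosh (r i) ^ (-lam) * d i / Real.cosh (r i) =
      Real.cosh (r i) ^ (-1 - lam) * d i := fun i => by
    have : Real.cosh (r i) ^ (-1 - lam) = Real.cosh (r i) ^ (-lam) / Real.cosh (r i) := by
      rw [eq_div_iff (Real.cosh_pos _).ne']
      nth_rewrite 2 [← Real.rpow_one (Real.cosh (r i))]
      rw [← Real.rpow_add (Real.cosh_pos _)]
      ring_nf
    rw [this]; ring
  simp only [hη]
  set η : Fin 3 → ℝ := fun i => Real.cosh (r i) ^ (-1 - lam) * d i with hη_def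
  have e3 : (1 : Fin 3) + 2 = 0 := rfl
  have e4 : (2 : Fin 3) + 1 = 0 := rfl
  have e5 : (2 : Fin 3) + 2 = 1 := rfl
  have e6 : (1 : Fin 3) + 1 = 2 := rfl
  have hS0 := (arcSinh_pos hr 0).ne'
  have hS1 := (arcSinh_pos hr 1).ne'
  have hS2 := (arcSinh_pos hr 2).ne'
  have t0 : Real.sinh (r 2 + r 0 + (r 0 + r 1)) = arcSinh r 1 * Real.cosh (r 0 + r 1) +
      Real.cosh (r 2 + r 0) * arcSinh r 2 := Real.sinh_add _ _
  have t1 : Real.sinh (r 0 + r 1 + (r 1 + r 2)) = arcSinh r 2 * Real.cosh (r 1 + r 2) +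
      Real.cosh (r 0 + r 1) * arcSinh r 0 := Real.sinh_add _ _
  have t2 : Real.sinh (r 1 + r 2 + (r 2 + r 0)) = arcSinh r 0 * Real.cosh (r 2 + r 0) +
      Real.cosh (r 1 + r 2) * arcSinh r 1 := Real.sinh_add _ _
  have d0 : Real.cosh (r 0) ^ (-1 - lam) * d 0 = η 0 := rfl
  have d1 : Real.cosh (r 1) ^ (-1 - lam) * d 1 = η 1 := rfl
  have d2 : Real.cosh (r 2) ^ (-1 - lam) * d 2 = η 2 := rfl
  have key : ∀ X S S' Y p δ e : ℝ, p * δ = e → -(X * p / (S * S')) * Y * δ = -(X * e / (S * S')) * Y :=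
    fun X S S' Y p δ e h => by rw [← h]; ring
  simp only [secondVariation, Fin.sum_univ_three, e3, e4, e5, e6, zero_add, t0, t1, t2, d0, d1, d2]
  rw [key _ _ _ _ _ _ _ d0, key _ _ _ _ _ _ _ d1, key _ _ _ _ _ _ _ d2]
  field_simp
  ring

/-- Since `cosh ≥ 1`, the quadratic form at each arc dominates a square, and all but the `k`-th arc
may be dropped. The factor `1 / arcSinh r k` is kept because it blows up when that arc degenerates.
-/
theorem secondVariation_le {r : Fin 3 → ℝ} (lam : ℝ) (hr : r ∈ coordCone) (η : Fin 3 → ℝ)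
    (k : Fin 3) : secondVariation lam r η ≤
      -(hexWeight lam r / arcSinh r k * (η (k + 1) + η (k + 2)) ^ 2) := by
  have hS := arcSinh_pos hr
  have hterm : ∀ k, arcSinh r (k + 1) * arcSinh r (k + 2) * (η (k + 1) + η (k + 2)) ^ 2 ≤
      arcSinh r (k + 1) * arcSinh r (k + 2) *
      (Real.cosh (r (k + 1) + r (k + 2)) * (η (k + 1) ^ 2 + η (k + 2) ^ 2) +
        2 * η (k + 1) * η (k + 2)) := by
    intro k
    refine mul_le_mul_of_nonneg_left ?_ (mul_pos (hS _) (hS _)).le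
    have := mul_le_mul_of_nonneg_right (Real.one_le_cosh (r (k + 1) + r (k + 2)))
      (add_nonneg (sq_nonneg (η (k + 1))) (sq_nonneg (η (k + 2))))
    linarith
  have hsum := Finset.single_le_sum (f := fun k => arcSinh r (k + 1) * arcSinh r (k + 2) *
      (Real.cosh (r (k + 1) + r (k + 2)) * (η (k + 1) ^ 2 + η (k + 2) ^ 2) +
        2 * η (k + 1) * η (k + 2))) (fun k _ => le_trans
          (mul_nonneg (mul_pos (hS _) (hS _)).le (sq_nonneg _)) (hterm k)) (Finset.mem_univ k)
  have hprod : arcSinh r 0 * arcSinh r 1 * arcSinh r 2 =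
      arcSinh r k * (arcSinh r (k + 1) * arcSinh r (k + 2)) := by
    have e3 : (1 : Fin 3) + 2 = 0 := rfl
    have e4 : (2 : Fin 3) + 1 = 0 := rfl
    have e5 : (2 : Fin 3) + 2 = 1 := rfl
    have e6 : (1 : Fin 3) + 1 = 2 := rfl
    fin_cases k
    · simp [mul_assoc]
    · simp only [Fin.mk_one, e6, e3]; ring
    · simp only [Fin.reduceFinMk, e4, e5]; ring
  rw [secondVariation, hprod, neg_mul, neg_le_neg_iff]
  refine le_trans (le_of_eq ?_) (mul_le_mul_of_nonneg_left ((hterm k).trans hsum)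
    (div_pos (hexWeight_pos lam r) (mul_pos (hS _) (mul_pos (hS _) (hS _)))).le)
  have h0 := (hS k).ne'
  have h1 := (hS (k + 1)).ne'
  have h2 := (hS (k + 2)).ne'
  field_simp

theorem secondVariation_nonpos {r : Fin 3 → ℝ} (lam : ℝ) (hr : r ∈ coordCone) (η : Fin 3 → ℝ) :
    secondVariation lam r η ≤ 0 :=
  (secondVariation_le lam hr η 0).trans (neg_nonpos.2
    (mul_nonneg (div_pos (hexWeight_pos lam r) (arcSinh_pos hr 0)).le (sq_nonneg _)))

/-- The potential of a hexagon is concave along lines. -/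
theorem antitoneOn_sum_hexSlope {lam : ℝ} {w d : Fin 3 → ℝ} {s : Set ℝ} (hs : Convex ℝ s)
    (h : ∀ τ ∈ s, w + τ • d ∈ weightCone lam) :
    AntitoneOn (fun t : ℝ => ∑ i, hexSlope lam (w + t • d) i * d i) s := by
  refine antitoneOn_of_hasDerivWithinAt_nonpos hs
    (fun τ hτ => (hasDerivAt_sum_hexSlope (h τ hτ)).continuousAt.continuousWithinAt)
    (fun τ hτ => (hasDerivAt_sum_hexSlope (h τ (interior_subset hτ))).hasDerivWithinAt)
    fun τ hτ => secondVariation_nonpos lam (coords_mem (h τ (interior_subset hτ))) _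

/-! ### Behavior of the potential at the boundary -/

theorem abs_lt_abs_of_notMem_range {lam x y : ℝ} (hx : x ∈ Set.range (coshPrimitive lam))
    (hy : y ∉ Set.range (coshPrimitive lam)) : |x| < |y| := by
  rw [mem_range_coshPrimitive] at hx hy
  exact (ENNReal.ofReal_lt_ofReal_iff'.1 (hx.trans_le (not_lt.1 hy))).1

theorem lam_neg_of_notMem_range {lam y : ℝ} (hy : y ∉ Set.range (coshPrimitive lam)) : lam < 0 := by
  by_contra h
  rw [mem_range_coshPrimitive, coshIntegral_of_nonneg (not_lt.1 h)] at hy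
  exact hy ENNReal.ofReal_lt_top

theorem neg_mem_range {lam x : ℝ} (hx : x ∈ Set.range (coshPrimitive lam)) :
    -x ∈ Set.range (coshPrimitive lam) := by
  rw [mem_range_coshPrimitive] at hx ⊢
  rwa [abs_neg]

theorem coshInv_neg {lam x : ℝ} (hx : x ∈ Set.range (coshPrimitive lam)) :
    coshInv lam (-x) = -coshInv lam x := by
  obtain ⟨r, rfl⟩ := hx
  rw [← coshPrimitive_neg, coshInv_coshPrimitive, coshInv_coshPrimitive]

theorem lt_coshInv_iff {lam x r : ℝ} (hx : x ∈ Set.range (coshPrimitive lam)) :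
    r < coshInv lam x ↔ coshPrimitive lam r < x := by
  obtain ⟨s, rfl⟩ := hx
  rw [coshInv_coshPrimitive, (strictMono_coshPrimitive lam).lt_iff_lt]

theorem tendsto_coshInv_atTop {lam y : ℝ} {l : Filter ℝ} {f : ℝ → ℝ}
    (hy : y ∉ Set.range (coshPrimitive lam)) (hpos : 0 < y) (hf : Tendsto f l (𝓝 y))
    (hmem : ∀ᶠ τ in l, f τ ∈ Set.range (coshPrimitive lam)) :
    Tendsto (fun τ => coshInv lam (f τ)) l atTop := by
  refine tendsto_atTop.2 fun M => ?_
  have h1 : coshPrimitive lam M < y := by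
    have := abs_lt_abs_of_notMem_range ⟨M, rfl⟩ hy
    rw [abs_of_pos hpos] at this
    exact (le_abs_self _).trans_lt this
  filter_upwards [hf.eventually_const_lt h1, hmem] with τ h2 h3
  exact ((lt_coshInv_iff h3).2 h2).le

theorem tendsto_ray (w d : Fin 3 → ℝ) (i : Fin 3) :
    Tendsto (fun τ : ℝ => (w + τ • d) i) (𝓝[>] 0) (𝓝 (w i)) := by
  have h : Continuous fun τ : ℝ => (w + τ • d) i := by
    simp only [Pi.add_apply, Pi.smul_apply, smul_eq_mul]; fun_prop
  have := h.tendsto 0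
  simp only [zero_smul, add_zero] at this
  exact this.mono_left nhdsWithin_le_nhds

theorem eventually_ray {P : ℝ → Prop} (h : ∀ τ ∈ Set.Ioc (0 : ℝ) 1, P τ) : ∀ᶠ τ in 𝓝[>] (0 : ℝ), P τ :=
  mem_of_superset (Ioc_mem_nhdsGT zero_lt_one) h

theorem cosh_add_le (x y : ℝ) : Real.cosh (x + y) ≤ Real.exp |y| * Real.cosh x := by
  rw [Real.cosh_eq, Real.cosh_eq, neg_add, Real.exp_add, Real.exp_add]
  have h1 := Real.exp_le_exp.2 (le_abs_self y)
  have h2 := Real.exp_le_exp.2 (neg_le_abs y)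
  have h3 := mul_le_mul_of_nonneg_left h1 (Real.exp_pos x).le
  have h4 := mul_le_mul_of_nonneg_left h2 (Real.exp_pos (-x)).le
  linarith

theorem cosh_le_exp_abs (x : ℝ) : Real.cosh x ≤ Real.exp |x| := by
  simpa using cosh_add_le 0 x

/-- Shifting the argument by at most `2 * M` changes `cosh (r k)` by a bounded factor, so the
estimate is uniform in the third coordinate, which may be unbounded in the applications. -/
theorem le_hexWeight (lam : ℝ) {r : Fin 3 → ℝ} {k : Fin 3} {M : ℝ} (h1 : |r (k + 1)| ≤ M)
    (h2 : |r (k + 2)| ≤ M) : Real.exp (-(4 * M * |1 + lam / 2|)) ≤ hexWeight lam r := by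
  rw [hexWeight_eq lam r k]
  set X := Real.cosh (r k) * Real.cosh (r (k + 1)) * Real.cosh (r (k + 2)) /
    Real.cosh (r k + r (k + 1) + r (k + 2)) with hX
  have c0 := Real.cosh_pos (r k)
  have c1 := Real.one_le_cosh (r (k + 1))
  have c2 := Real.one_le_cosh (r (k + 2))
  have c3 := Real.cosh_pos (r k + r (k + 1) + r (k + 2))
  have hM : 0 ≤ M := (abs_nonneg _).trans h1
  have habs : |r (k + 1) + r (k + 2)| ≤ 2 * M := (abs_add_le _ _).trans (by linarith)
  have hXpos : 0 < X := by positivity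
  have hup : X ≤ Real.exp (4 * M) := by
    rw [hX, div_le_iff₀ c3]
    have a1 := (cosh_le_exp_abs (r (k + 1))).trans (Real.exp_le_exp.2 h1)
    have a2 := (cosh_le_exp_abs (r (k + 2))).trans (Real.exp_le_exp.2 h2)
    have a3 : Real.cosh (r k) ≤ Real.exp (2 * M) * Real.cosh (r k + r (k + 1) + r (k + 2)) := by
      have := cosh_add_le (r k + r (k + 1) + r (k + 2)) (-(r (k + 1) + r (k + 2)))
      rw [abs_neg] at this
      have e : r k + r (k + 1) + r (k + 2) + -(r (k + 1) + r (k + 2)) = r k := by ring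
      rw [e] at this
      exact this.trans (mul_le_mul_of_nonneg_right (Real.exp_le_exp.2 habs) c3.le)
    calc _ ≤ Real.exp (2 * M) * Real.cosh (r k + r (k + 1) + r (k + 2)) * Real.exp M *
          Real.exp M := by gcongr
      _ = _ := by
        rw [show 4 * M = 2 * M + M + M by ring, Real.exp_add, Real.exp_add]; ring
  have hlow : Real.exp (-(4 * M)) ≤ X := by
    rw [hX, le_div_iff₀ c3]
    have a3 : Real.cosh (r k + r (k + 1) + r (k + 2)) ≤ Real.exp (4 * M) * Real.cosh (r k) := by
      have := cosh_add_le (r k) (r (k + 1) + r (k + 2))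
      rw [← add_assoc] at this
      exact this.trans (mul_le_mul_of_nonneg_right (Real.exp_le_exp.2 (habs.trans (by linarith)))
        c0.le)
    calc _ ≤ Real.exp (-(4 * M)) * (Real.exp (4 * M) * Real.cosh (r k)) := by gcongr
      _ = Real.cosh (r k) := by rw [← mul_assoc, ← Real.exp_add]; simp
      _ = Real.cosh (r k) * 1 * 1 := by ring
      _ ≤ _ := by gcongr
  rw [Real.rpow_def_of_pos hXpos, Real.exp_le_exp]
  have hlog : |Real.log X| ≤ 4 * M := by
    rw [abs_le]
    exact ⟨(Real.le_log_iff_exp_le hXpos).2 hlow, (Real.log_le_iff_le_exp hXpos).2 hup⟩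
  have : |Real.log X * (1 + lam / 2)| ≤ 4 * M * |1 + lam / 2| := by
    rw [abs_mul]; gcongr
  linarith [neg_abs_le (Real.log X * (1 + lam / 2))]

/-- The hypothesis makes `f + c * log` decreasing, so `f` is at least `-c * log τ` up to a constant.
-/
theorem tendsto_atTop_of_deriv_le_div {f f' : ℝ → ℝ} {c δ : ℝ} (hc : 0 < c) (hδ : 0 < δ)
    (hf : ∀ τ ∈ Set.Ioo 0 δ, HasDerivAt f (f' τ) τ) (hf' : ∀ τ ∈ Set.Ioo 0 δ, f' τ ≤ -(c / τ)) :
    Tendsto f (𝓝[>] 0) atTop := by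
  have hanti : AntitoneOn (fun τ => f τ + c * Real.log τ) (Set.Ioo 0 δ) := by
    have hd : ∀ τ ∈ Set.Ioo 0 δ, HasDerivAt (fun τ => f τ + c * Real.log τ)
        (f' τ + c * τ⁻¹) τ := fun τ hτ =>
      (hf τ hτ).add ((Real.hasDerivAt_log hτ.1.ne').const_mul c)
    refine antitoneOn_of_hasDerivWithinAt_nonpos (convex_Ioo 0 δ) (f' := fun τ => f' τ + c * τ⁻¹)
      (fun τ hτ => (hd τ hτ).continuousAt.continuousWithinAt)
      (fun τ hτ => (hd τ (interior_subset hτ)).hasDerivWithinAt) fun τ hτ => ?_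
    have := hf' τ (interior_subset hτ)
    rw [div_eq_mul_inv] at this
    linarith
  have hm : δ / 2 ∈ Set.Ioo 0 δ := ⟨by linarith, by linarith⟩
  have hlog := (tendsto_neg_atBot_atTop.comp
    (Real.tendsto_log_nhdsGT_zero.const_mul_atBot hc))
  refine tendsto_atTop_mono' _ ?_ (tendsto_atTop_add_const_left _
    (f (δ / 2) + c * Real.log (δ / 2)) hlog)
  filter_upwards [Ioo_mem_nhdsGT hm.1] with τ hτ
  have := hanti ⟨hτ.1, hτ.2.trans hm.2⟩ hm hτ.2.le
  simp only [Function.comp] at this ⊢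
  linarith

/-- At a point where a pair of coordinates becomes opposite, the slope of the potential along a ray
into the cone is infinite. -/
theorem tendsto_sum_hexSlope_of_opposite {lam : ℝ} {w d : Fin 3 → ℝ} {k : Fin 3}
    (h : ∀ τ ∈ Set.Ioc (0 : ℝ) 1, w + τ • d ∈ weightCone lam) (hk : w (k + 1) + w (k + 2) = 0)
    (h1 : w (k + 1) ∈ Set.range (coshPrimitive lam)) :
    Tendsto (fun τ : ℝ => ∑ i, hexSlope lam (w + τ • d) i * d i) (𝓝[>] 0) atTop := by
  have hw2 : w (k + 2) = -w (k + 1) := by linarith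
  have h2 : w (k + 2) ∈ Set.range (coshPrimitive lam) := hw2 ▸ neg_mem_range h1
  have hd : 0 < d (k + 1) + d (k + 2) := by
    have := (h 1 ⟨zero_lt_one, le_rfl⟩).2 k
    simp only [one_smul, Pi.add_apply] at this
    linarith
  have hder : ∀ i, w i ∈ Set.range (coshPrimitive lam) → HasDerivAt
      (fun τ : ℝ => coords lam (w + τ • d) i) (Real.cosh (coshInv lam (w i)) ^ (-lam) * d i) 0 := by
    intro i hi
    have e : HasDerivAt (fun t : ℝ => (w + t • d) i) (d i) 0 := by
      simpa using ((hasDerivAt_id (0 : ℝ)).mul_const (d i)).const_add (w i)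
    have e0 : (w + (0 : ℝ) • d) i = w i := by simp
    have := (hasDerivAt_coshInv (lam := lam) (y := (w + (0 : ℝ) • d) i)
      (by rw [e0]; exact hi)).comp (0 : ℝ) e
    rw [e0] at this
    exact this
  have hr1 := hder _ h1
  have hr2 := hder _ h2
  have z1 : coords lam (w + (0 : ℝ) • d) (k + 1) = coshInv lam (w (k + 1)) := by simp [coords]
  have z2 : coords lam (w + (0 : ℝ) • d) (k + 2) = -coshInv lam (w (k + 1)) := by
    rw [← coshInv_neg h1, ← hw2]; simp [coords]
  set ρ := coshInv lam (w (k + 1)) with hρ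
  -- the arc degenerates linearly
  obtain ⟨C, hC, hCS⟩ : ∃ C > 0, ∀ᶠ τ in 𝓝[>] (0 : ℝ), arcSinh (coords lam (w + τ • d)) k ≤ C * τ := by
    have hS := (hr1.add hr2).sinh
    obtain ⟨C, hC, hb⟩ := hS.isBigO_sub.exists_pos
    refine ⟨C, hC, ?_⟩
    rw [Asymptotics.isBigOWith_iff] at hb
    filter_upwards [hb.filter_mono nhdsWithin_le_nhds, self_mem_nhdsWithin] with τ hτ hτ0
    simp only [Pi.add_apply, z1, z2, add_neg_cancel, Real.sinh_zero, sub_zero, Real.norm_eq_abs] at hτ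
    rw [abs_of_pos (show (0 : ℝ) < τ from hτ0)] at hτ
    exact (le_abs_self _).trans hτ
  -- At `τ = 0` the two coordinates are opposite, so their `cosh` factors agree and the sum is a
  -- positive multiple of `d (k + 1) + d (k + 2)`; half of that limit serves as `m`.
  obtain ⟨m, hm, hE⟩ : ∃ m > 0, ∀ᶠ τ in 𝓝[>] (0 : ℝ),
      m < Real.cosh (coords lam (w + τ • d) (k + 1)) ^ (-1 - lam) * d (k + 1) +
        Real.cosh (coords lam (w + τ • d) (k + 2)) ^ (-1 - lam) * d (k + 2) := by
    have hcont : ContinuousAt (fun τ : ℝ =>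
        Real.cosh (coords lam (w + τ • d) (k + 1)) ^ (-1 - lam) * d (k + 1) +
        Real.cosh (coords lam (w + τ • d) (k + 2)) ^ (-1 - lam) * d (k + 2)) 0 := by
      refine ContinuousAt.add (ContinuousAt.mul ?_ continuousAt_const)
        (ContinuousAt.mul ?_ continuousAt_const)
      · exact ContinuousAt.comp (g := fun x => Real.cosh x ^ (-1 - lam))
          (continuous_cosh_rpow _).continuousAt hr1.continuousAt
      · exact ContinuousAt.comp (g := fun x => Real.cosh x ^ (-1 - lam))
          (continuous_cosh_rpow _).continuousAt hr2.continuousAt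
    have hpos : 0 < Real.cosh ρ ^ (-1 - lam) * (d (k + 1) + d (k + 2)) :=
      mul_pos (cosh_rpow_pos _ _) hd
    refine ⟨Real.cosh ρ ^ (-1 - lam) * (d (k + 1) + d (k + 2)) / 2, by linarith, ?_⟩
    have ht := hcont.tendsto
    rw [z1, z2, Real.cosh_neg, ← mul_add] at ht
    exact (ht.mono_left nhdsWithin_le_nhds).eventually_const_lt (by linarith)
  have hM1 : ∀ᶠ τ in 𝓝[>] (0 : ℝ), |coords lam (w + τ • d) (k + 1)| ≤ |ρ| + 1 := by
    have := hr1.continuousAt.abs.tendsto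
    rw [z1] at this
    exact ((this.mono_left nhdsWithin_le_nhds).eventually_lt_const
      (show |ρ| < |ρ| + 1 by linarith)).mono fun _ h => h.le
  have hM2 : ∀ᶠ τ in 𝓝[>] (0 : ℝ), |coords lam (w + τ • d) (k + 2)| ≤ |ρ| + 1 := by
    have := hr2.continuousAt.abs.tendsto
    rw [z2, abs_neg] at this
    exact ((this.mono_left nhdsWithin_le_nhds).eventually_lt_const
      (show |ρ| < |ρ| + 1 by linarith)).mono fun _ h => h.le
  set q := Real.exp (-(4 * (|ρ| + 1) * |1 + lam / 2|)) with hq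
  have hqpos : 0 < q := Real.exp_pos _
  -- A weight bounded below, a numerator at least `m ^ 2` and an arc of size `O(τ)` bound the second
  -- derivative by `-const / τ`, which is not integrable at `0`.
  have hev : ∀ᶠ τ in 𝓝[>] (0 : ℝ), w + τ • d ∈ weightCone lam ∧
      secondVariation lam (coords lam (w + τ • d))
        (fun i => Real.cosh (coords lam (w + τ • d) i) ^ (-1 - lam) * d i) ≤
      -(q / C * m ^ 2 / τ) := by
    filter_upwards [hCS, hE, hM1, hM2, eventually_ray h, self_mem_nhdsWithin] with τ a1 a2 a3 a4 a5 a6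
    refine ⟨a5, (secondVariation_le lam (coords_mem a5) _ k).trans (neg_le_neg ?_)⟩
    have hτ : (0 : ℝ) < τ := a6
    have hS := arcSinh_pos (coords_mem a5) k
    have hW := le_hexWeight lam a3 a4
    have hW' := hexWeight_pos lam (coords lam (w + τ • d))
    calc q / C * m ^ 2 / τ = q / (C * τ) * m ^ 2 := by field_simp
      _ ≤ _ := by gcongr
  obtain ⟨δ, hδ, hδ'⟩ := mem_nhdsGT_iff_exists_Ioo_subset.1 hev
  exact tendsto_atTop_of_deriv_le_div (c := q / C * m ^ 2) (by positivity) hδ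
    (fun τ hτ => hasDerivAt_sum_hexSlope (hδ' hτ).1) fun τ hτ => (hδ' hτ).2

/-- A tail estimate: the derivative of `cosh^lam` is at least `lam * cosh^lam`, so integration over
`[x, ∞)` bounds `cosh x ^ lam` by `-lam` times the tail, and `W` is at least the full integral. -/
theorem cosh_rpow_le_of_notMem_range {lam W : ℝ} (hW : W ∉ Set.range (coshPrimitive lam))
    (hpos : 0 < W) (x : ℝ) : Real.cosh x ^ lam ≤ -lam * (W - coshPrimitive lam x) := by
  have hlam := lam_neg_of_notMem_range hW
  have hmono : Monotone fun x => -lam * coshPrimitive lam x + Real.cosh x ^ lam := by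
    refine monotone_of_hasDerivAt_nonneg (f' := fun x => -lam * Real.cosh x ^ lam +
      Real.sinh x * lam * Real.cosh x ^ (lam - 1)) (fun x => ?_) fun x => ?_
    · exact ((hasDerivAt_coshPrimitive lam x).const_mul _).add
        ((Real.hasDerivAt_cosh x).rpow_const (Or.inl (Real.cosh_pos x).ne'))
    · show (0 : ℝ) ≤ -lam * Real.cosh x ^ lam + Real.sinh x * lam * Real.cosh x ^ (lam - 1)
      have e : Real.cosh x ^ lam = Real.cosh x * Real.cosh x ^ (lam - 1) := by
        rw [Real.rpow_sub_one (Real.cosh_pos x).ne']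
        field_simp [(Real.cosh_pos x).ne']
      rw [e]
      have h1 := cosh_rpow_pos (lam - 1) x
      have h2 : 0 ≤ Real.cosh x - Real.sinh x := by
        rw [Real.cosh_sub_sinh]; exact (Real.exp_pos _).le
      have h3 := mul_nonneg (mul_nonneg (neg_pos.2 hlam).le h2) h1.le
      linarith
  have hbound : ∀ y, x ≤ y → Real.cosh x ^ lam - Real.cosh y ^ lam ≤
      -lam * (W - coshPrimitive lam x) := by
    intro y hxy
    have h1 := hmono hxy
    have h2 := abs_lt_abs_of_notMem_range ⟨y, rfl⟩ hW
    rw [abs_of_pos hpos] at h2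
    have h3 := mul_le_mul_of_nonneg_left ((le_abs_self _).trans h2.le) (neg_pos.2 hlam).le
    simp only at h1
    linarith
  have hlim : Tendsto (fun y : ℝ => Real.cosh x ^ lam - Real.cosh y ^ lam) atTop
      (𝓝 (Real.cosh x ^ lam - 0)) := by
    refine tendsto_const_nhds.sub ?_
    have hcosh : Tendsto Real.cosh atTop atTop := by
      refine tendsto_atTop_mono (fun y => ?_) (tendsto_id.atTop_div_const zero_lt_two)
      have h1 := Real.add_one_le_exp y
      have h2 := Real.exp_pos (-y)
      rw [Real.cosh_eq, id]
      linarith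
    have := (tendsto_rpow_neg_atTop (neg_pos.2 hlam)).comp hcosh
    simpa [Function.comp_def] using this
  rw [sub_zero] at hlim
  exact le_of_tendsto hlim ((eventually_ge_atTop x).mono hbound)

theorem cosh_le_exp {x : ℝ} (hx : 0 ≤ x) : Real.cosh x ≤ Real.exp x := by
  simpa [abs_of_nonneg hx] using cosh_le_exp_abs x

/-- Arcs of length at least `δ` have `sinh` comparable with `exp`, and the exponents in numerator
and denominator agree. Hence the red side has bounded length. -/
theorem le_one_sub_exp_logRatio {a b c δ : ℝ} (ha : 0 ≤ a) (hs : 0 ≤ a + b + c) (hδ : 0 < δ)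
    (h1 : δ ≤ c + a) (h2 : δ ≤ a + b) :
    ((1 - Real.exp (-2 * δ)) / 2) ^ 2 ≤ 1 - Real.exp (logRatio a b c) := by
  have key : ∀ x, δ ≤ x → (1 - Real.exp (-2 * δ)) / 2 * Real.exp x ≤ Real.sinh x := by
    intro x hx
    have e : Real.sinh x = (1 - Real.exp (-2 * x)) / 2 * Real.exp x := by
      rw [Real.sinh_eq, show -x = -2 * x + x by ring, Real.exp_add]; ring
    rw [e]
    have := Real.exp_le_exp.2 (show -2 * x ≤ -2 * δ by linarith)
    have := Real.exp_pos x
    gcongr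
  have hpos : 0 < (1 - Real.exp (-2 * δ)) / 2 := by
    have := Real.exp_lt_one_iff.2 (show -2 * δ < 0 by linarith)
    linarith
  rw [one_sub_exp_logRatio, le_div_iff₀ (mul_pos (Real.cosh_pos _) (Real.cosh_pos _))]
  calc _ ≤ ((1 - Real.exp (-2 * δ)) / 2) ^ 2 * (Real.exp (a + b + c) * Real.exp a) := by
        gcongr
        · exact cosh_le_exp hs
        · exact cosh_le_exp ha
    _ = ((1 - Real.exp (-2 * δ)) / 2 * Real.exp (c + a)) *
        ((1 - Real.exp (-2 * δ)) / 2 * Real.exp (a + b)) := by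
        rw [← Real.exp_add, mul_mul_mul_comm, ← Real.exp_add]; ring_nf
    _ ≤ _ := mul_le_mul (key _ h1) (key _ h2) (by positivity)
        (le_trans (by positivity) (key _ h1))

theorem one_sub_exp_logRatio_le {a b c : ℝ} (h1 : 0 < c + a) (h2 : 0 < a + b) :
    1 - Real.exp (logRatio a b c) ≤ Real.exp (2 * a) := by
  rw [one_sub_exp_logRatio, div_le_iff₀ (mul_pos (Real.cosh_pos _) (Real.cosh_pos _))]
  have s1 : ∀ x, 0 < x → Real.sinh x ≤ Real.exp x / 2 := fun x hx => by
    rw [Real.sinh_eq]; have := Real.exp_pos (-x); linarith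
  have c1 : Real.exp (a + b + c) / 2 ≤ Real.cosh (a + b + c) := by
    rw [Real.cosh_eq]; have := Real.exp_pos (-(a + b + c)); linarith
  have c2 : Real.exp (-a) / 2 ≤ Real.cosh a := by
    rw [Real.cosh_eq]; have := Real.exp_pos a; linarith
  calc _ ≤ Real.exp (c + a) / 2 * (Real.exp (a + b) / 2) :=
        mul_le_mul (s1 _ h1) (s1 _ h2) (Real.sinh_pos_iff.2 h2).le (by positivity)
    _ = Real.exp (2 * a) * (Real.exp (a + b + c) / 2 * (Real.exp (-a) / 2)) := by
        rw [show Real.exp (2 * a) * (Real.exp (a + b + c) / 2 * (Real.exp (-a) / 2)) =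
          (Real.exp (2 * a) * Real.exp (a + b + c) * Real.exp (-a)) / 4 by ring,
          show Real.exp (c + a) / 2 * (Real.exp (a + b) / 2) =
          (Real.exp (c + a) * Real.exp (a + b)) / 4 by ring, ← Real.exp_add, ← Real.exp_add,
          ← Real.exp_add]
        ring_nf
    _ ≤ _ := by gcongr

/-- At a point where a coordinate degenerates to `-∞`, the slope of the potential along a ray into
the cone is infinite. -/
theorem tendsto_sum_hexSlope_of_corner {lam : ℝ} {w d : Fin 3 → ℝ} {i : Fin 3}
    (h : ∀ τ ∈ Set.Ioc (0 : ℝ) 1, w + τ • d ∈ weightCone lam)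
    (hi : w i ∉ Set.range (coshPrimitive lam)) (hneg : w i < 0)
    (h1 : w (i + 1) = -w i) (h2 : w (i + 2) = -w i) :
    Tendsto (fun τ : ℝ => ∑ i, hexSlope lam (w + τ • d) i * d i) (𝓝[>] 0) atTop := by
  have e1 : i + 1 + 1 = i + 2 := by fin_cases i <;> rfl
  have e2 : i + 1 + 2 = i := by fin_cases i <;> rfl
  have e3 : i + 2 + 1 = i := by fin_cases i <;> rfl
  have e4 : i + 2 + 2 = i + 1 := by fin_cases i <;> rfl
  set W := -w i with hW
  have hWpos : 0 < W := neg_pos.2 hneg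
  have hWr : W ∉ Set.range (coshPrimitive lam) := fun hm => hi (by
    have := neg_mem_range hm
    rwa [hW, neg_neg] at this)
  have hlam := lam_neg_of_notMem_range hWr
  have hmem : ∀ j, ∀ᶠ τ in 𝓝[>] (0 : ℝ), (w + τ • d) j ∈ Set.range (coshPrimitive lam) :=
    fun j => (eventually_ray h).mono fun τ hτ => hτ.1 j
  have hone := h 1 ⟨zero_lt_one, le_rfl⟩
  rw [one_smul] at hone
  have hbd : ∀ j, |(w + d) j| < W := fun j => by
    have := abs_lt_abs_of_notMem_range (hone.1 j) hWr
    rwa [abs_of_pos hWpos] at this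
  have hdi : 0 < d i := by
    have := (abs_lt.1 (hbd i)).1
    simp only [Pi.add_apply] at this
    linarith
  have hd1 : d (i + 1) < 0 := by
    have := (abs_lt.1 (hbd (i + 1))).2
    simp only [Pi.add_apply] at this
    linarith
  have hd2 : d (i + 2) < 0 := by
    have := (abs_lt.1 (hbd (i + 2))).2
    simp only [Pi.add_apply] at this
    linarith
  -- the coordinates tend to infinity
  have hr1 : Tendsto (fun τ : ℝ => coords lam (w + τ • d) (i + 1)) (𝓝[>] 0) atTop :=
    tendsto_coshInv_atTop (h1 ▸ hWr) (h1 ▸ hWpos) (tendsto_ray w d _) (hmem _)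
  have hr2 : Tendsto (fun τ : ℝ => coords lam (w + τ • d) (i + 2)) (𝓝[>] 0) atTop :=
    tendsto_coshInv_atTop (h2 ▸ hWr) (h2 ▸ hWpos) (tendsto_ray w d _) (hmem _)
  have hri : Tendsto (fun τ : ℝ => -coords lam (w + τ • d) i) (𝓝[>] 0) atTop := by
    refine (tendsto_coshInv_atTop hWr hWpos (tendsto_ray w d i).neg
      ((hmem i).mono fun τ hτ => neg_mem_range hτ)).congr' ?_
    filter_upwards [hmem i] with τ hτ
    exact coshInv_neg hτ
  -- the two short arcs stay long
  have harc : ∀ j, w j = W → d j < 0 → 0 < d i + d j → ∀ᶠ τ in 𝓝[>] (0 : ℝ),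
      (d i + d j) / (-lam * d i) ≤ coords lam (w + τ • d) i + coords lam (w + τ • d) j := by
    intro j hj hdj hdij
    filter_upwards [hri.eventually_ge_atTop 0, hmem i, hmem j, self_mem_nhdsWithin] with τ a1 a2 a3 a4
    have hτ : (0 : ℝ) < τ := a4
    set ri := coords lam (w + τ • d) i with hri_def
    set rj := coords lam (w + τ • d) j with hrj_def
    have p1 : coshPrimitive lam ri = w i + τ * d i := by
      rw [hri_def, coords, coshPrimitive_coshInv a2]; simp
    have p2 : coshPrimitive lam rj = W + τ * d j := by
      rw [hrj_def, coords, coshPrimitive_coshInv a3]; simp [hj]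
    have p3 : coshPrimitive lam (-ri) = W - τ * d i := by
      rw [coshPrimitive_neg, p1]; ring
    have hlt : -ri < rj := by
      rw [← (strictMono_coshPrimitive lam).lt_iff_lt, p2, p3]
      nlinarith
    have hc := cosh_rpow_le_of_notMem_range hWr hWpos (-ri)
    rw [p3] at hc
    -- Mean value inequality on `[-ri, rj]`, where `cosh^lam` decreases. The left side is `τ * (d i
    -- + d j)` and the tail estimate bounds `cosh (-ri) ^ lam` by `-lam * τ * d i`, so `τ` cancels
    -- and a positive lower bound for the arc remains.
    have hmv : coshPrimitive lam rj - coshPrimitive lam (-ri) ≤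
        Real.cosh (-ri) ^ lam * (rj - -ri) := by
      refine Convex.image_sub_le_mul_sub_of_deriv_le (convex_Ici (-ri))
        (continuous_coshPrimitive lam).continuousOn
        (fun x _ => (hasDerivAt_coshPrimitive lam x).differentiableAt.differentiableWithinAt)
        (fun x hx => ?_) (-ri) Set.self_mem_Ici rj hlt.le hlt.le
      rw [interior_Ici] at hx
      rw [(hasDerivAt_coshPrimitive lam x).deriv]
      refine Real.rpow_le_rpow_of_nonpos (Real.cosh_pos _) ?_ hlam.le
      rw [Real.cosh_le_cosh, abs_of_nonneg a1, abs_of_nonneg (a1.trans (le_of_lt hx))]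
      exact le_of_lt hx
    have hpos : 0 < -lam * d i := mul_pos (neg_pos.2 hlam) hdi
    rw [div_le_iff₀ hpos]
    have h3 : Real.cosh (-ri) ^ lam * (rj - -ri) ≤ -lam * (τ * d i) * (rj - -ri) := by
      refine mul_le_mul_of_nonneg_right ?_ (by linarith)
      linarith
    rw [p2, p3] at hmv
    have h4 : τ * (d i + d j) ≤ τ * ((ri + rj) * (-lam * d i)) := by linarith
    exact le_of_mul_le_mul_left h4 hτ
  have hpair1 : 0 < d i + d (i + 1) := by
    have := hone.2 (i + 2)
    rw [e3, e4] at this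
    simp only [Pi.add_apply] at this
    linarith
  have hpair2 : 0 < d i + d (i + 2) := by
    have := hone.2 (i + 1)
    rw [e1, e2] at this
    simp only [Pi.add_apply] at this
    linarith
  have harc1 := harc (i + 1) h1 hd1 hpair1
  have harc2 := harc (i + 2) h2 hd2 hpair2
  have hpos : 0 < -lam * d i := mul_pos (neg_pos.2 hlam) hdi
  set δ := min ((d i + d (i + 1)) / (-lam * d i)) ((d i + d (i + 2)) / (-lam * d i)) with hδ
  have hδpos : 0 < δ := lt_min (div_pos hpair1 hpos) (div_pos hpair2 hpos)
  set κ := ((1 - Real.exp (-2 * δ)) / 2) ^ 2 with hκ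
  have hκpos : 0 < κ := by
    have := Real.exp_lt_one_iff.2 (show -2 * δ < 0 by linarith)
    have : 0 < (1 - Real.exp (-2 * δ)) / 2 := by linarith
    positivity
  have hκlt : κ < 1 := by
    have h1 := Real.exp_lt_one_iff.2 (show -2 * δ < 0 by linarith)
    have h2 := Real.exp_pos (-2 * δ)
    rw [hκ, sq_lt_one_iff₀ (by linarith)]
    linarith
  have hlogneg : Real.log (1 - κ) < 0 := Real.log_neg (by linarith) (by linarith)
  have hslope : ∀ j, ∀ᶠ τ in 𝓝[>] (0 : ℝ), κ ≤ 1 - Real.exp (sideLog (coords lam (w + τ • d)) j) →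
      hexSlope lam (w + τ • d) j ≤ slope lam (Real.log (1 - κ)) := by
    intro j
    filter_upwards [eventually_ray h] with τ hτ hle
    refine (slope_strictMonoOn lam).monotoneOn (sideLog_neg (coords_mem hτ) j) hlogneg ?_
    rw [Real.le_log_iff_exp_le (by linarith)]
    linarith
  have hs1 : ∀ᶠ τ in 𝓝[>] (0 : ℝ), hexSlope lam (w + τ • d) (i + 1) ≤
      slope lam (Real.log (1 - κ)) := by
    filter_upwards [hslope (i + 1), harc1, hr1.eventually_ge_atTop δ, hr2.eventually_ge_atTop δ]
      with τ a1 a2 a3 a4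
    refine a1 ?_
    have a5 := (min_le_left _ _ : δ ≤ _).trans a2
    rw [sideLog, e1, e2]
    exact le_one_sub_exp_logRatio (by linarith) (by linarith) hδpos a5 (by linarith)
  have hs2 : ∀ᶠ τ in 𝓝[>] (0 : ℝ), hexSlope lam (w + τ • d) (i + 2) ≤
      slope lam (Real.log (1 - κ)) := by
    filter_upwards [hslope (i + 2), harc2, hr1.eventually_ge_atTop δ, hr2.eventually_ge_atTop δ]
      with τ a1 a2 a3 a4
    refine a1 ?_
    have a5 := (min_le_right _ _ : δ ≤ _).trans a2
    rw [sideLog, e3, e4]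
    exact le_one_sub_exp_logRatio (by linarith) (by linarith) hδpos (by linarith) (by linarith)
  -- The side whose coordinate tends to `-∞` becomes infinitely long: `1 - exp (sideLog)` is at most
  -- `exp (2 * r i)`.
  have hs0 : Tendsto (fun τ : ℝ => hexSlope lam (w + τ • d) i) (𝓝[>] 0) atTop := by
    refine (tendsto_slope_zero lam).comp ?_
    refine tendsto_nhdsWithin_iff.2 ⟨?_, (eventually_ray h).mono fun τ hτ =>
      sideLog_neg (coords_mem hτ) i⟩
    have hexp : Tendsto (fun τ : ℝ => Real.exp (sideLog (coords lam (w + τ • d)) i)) (𝓝[>] 0)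
        (𝓝 1) := by
      have hlow : Tendsto (fun τ : ℝ => 1 - Real.exp (2 * coords lam (w + τ • d) i)) (𝓝[>] 0)
          (𝓝 (1 - 0)) := by
        refine tendsto_const_nhds.sub (Real.tendsto_exp_atBot.comp ?_)
        have := (tendsto_neg_atTop_atBot.comp hri).const_mul_atBot (zero_lt_two (α := ℝ))
        simpa [Function.comp_def] using this
      rw [sub_zero] at hlow
      refine tendsto_of_tendsto_of_tendsto_of_le_of_le' hlow tendsto_const_nhds ?_ ?_
      · filter_upwards [eventually_ray h] with τ hτ
        have b1 := coords_mem hτ (i + 1)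
        have b2 := coords_mem hτ (i + 2)
        rw [e1, e2] at b1
        rw [e3, e4] at b2
        have := one_sub_exp_logRatio_le b1 b2
        rw [sideLog]
        linarith
      · filter_upwards [eventually_ray h] with τ hτ
        exact (Real.exp_lt_one_iff.2 (sideLog_neg (coords_mem hτ) i)).le
    have := (Real.continuousAt_log one_ne_zero).tendsto.comp hexp
    simpa [Function.comp_def] using this
  have hsum : ∀ f : Fin 3 → ℝ, ∑ j, f j = f i + f (i + 1) + f (i + 2) := by
    intro f
    rw [Fin.sum_univ_three]
    fin_cases i
    · rfl
    · simp; ring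
    · simp; ring
  -- The other two slopes are bounded above and are multiplied by negative `d j`, so they cannot
  -- compensate the divergent term.
  have hbase := tendsto_atTop_add_const_right (𝓝[>] (0 : ℝ))
    (slope lam (Real.log (1 - κ)) * d (i + 1) + slope lam (Real.log (1 - κ)) * d (i + 2))
    (hs0.atTop_mul_const hdi)
  refine tendsto_atTop_mono' _ ?_ hbase
  filter_upwards [hs1, hs2] with τ a1 a2
  rw [hsum]
  have b1 := mul_le_mul_of_nonpos_right a1 hd1.le
  have b2 := mul_le_mul_of_nonpos_right a2 hd2.le
  linarith

/-- At a boundary point of the cone with an opposite pair of coordinates, the slope of the potential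
along a ray into the cone is infinite. -/
theorem tendsto_sum_hexSlope {lam : ℝ} {w d : Fin 3 → ℝ} {k : Fin 3}
    (h : ∀ τ ∈ Set.Ioc (0 : ℝ) 1, w + τ • d ∈ weightCone lam)
    (hcl : ∀ i, ENNReal.ofReal |w i| ≤ coshIntegral lam)
    (hnn : ∀ i, 0 ≤ w (i + 1) + w (i + 2)) (hk : w (k + 1) + w (k + 2) = 0) :
    Tendsto (fun τ : ℝ => ∑ i, hexSlope lam (w + τ • d) i * d i) (𝓝[>] 0) atTop := by
  by_cases h1 : w (k + 1) ∈ Set.range (coshPrimitive lam)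
  · exact tendsto_sum_hexSlope_of_opposite h hk h1
  have e1 : k + 1 + 1 = k + 2 := by fin_cases k <;> rfl
  have e2 : k + 1 + 2 = k := by fin_cases k <;> rfl
  have e3 : k + 2 + 1 = k := by fin_cases k <;> rfl
  have e4 : k + 2 + 2 = k + 1 := by fin_cases k <;> rfl
  have hle : ∀ j, |w j| ≤ |w (k + 1)| := fun j => by
    have h2 := h1
    rw [mem_range_coshPrimitive, not_lt] at h2
    exact (ENNReal.ofReal_le_ofReal_iff (abs_nonneg _)).1 ((hcl j).trans h2)
  have hne : w (k + 1) ≠ 0 := fun h0 => h1 ⟨0, by rw [h0, coshPrimitive_zero]⟩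
  have hk0 := hle k
  have n1 := hnn (k + 1)
  have n2 := hnn (k + 2)
  rw [e1, e2] at n1
  rw [e3, e4] at n2
  -- The vanishing pair consists of the two extreme values. Nonnegativity of the sum with the
  -- negative one, together with the bound on absolute values, forces the third coordinate to the
  -- positive extreme.
  rcases lt_or_gt_of_ne hne with hneg | hpos
  · rw [abs_of_neg hneg] at hk0
    have := (abs_le.1 hk0).2
    refine tendsto_sum_hexSlope_of_corner h h1 hneg (by rw [e1]; linarith) (by rw [e2]; linarith)
  · rw [abs_of_pos hpos] at hk0
    have := (abs_le.1 hk0).2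
    have hw2 : w (k + 2) = -w (k + 1) := by linarith
    refine tendsto_sum_hexSlope_of_corner (i := k + 2) h
      (fun hm => h1 (by have := neg_mem_range hm; rwa [hw2, neg_neg] at this)) (by linarith)
      (by rw [e3]; linarith) (by rw [e4]; linarith)

theorem exp_logRatio_le {a b c M : ℝ} (hM : 0 ≤ M) (hb : -M ≤ b) (hc : -M ≤ c) :
    Real.exp (logRatio a b c) ≤ 4 * Real.exp (4 * M - 2 * a) := by
  rw [exp_logRatio, div_le_iff₀ (mul_pos (Real.cosh_pos _) (Real.cosh_pos _))]
  have hch : ∀ x, -M ≤ x → Real.cosh x ≤ Real.exp (x + 2 * M) := fun x hx =>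
    (cosh_le_exp_abs x).trans (Real.exp_le_exp.2 (abs_le.2 ⟨by linarith, by linarith⟩))
  have hlow : ∀ x, Real.exp x / 2 ≤ Real.cosh x := fun x => by
    rw [Real.cosh_eq]; have := Real.exp_pos (-x); linarith
  calc _ ≤ Real.exp (b + 2 * M) * Real.exp (c + 2 * M) :=
        mul_le_mul (hch b hb) (hch c hc) (Real.cosh_pos _).le (Real.exp_pos _).le
    _ = 4 * Real.exp (4 * M - 2 * a) * (Real.exp (a + b + c) / 2 * (Real.exp a / 2)) := by
        rw [show 4 * Real.exp (4 * M - 2 * a) * (Real.exp (a + b + c) / 2 * (Real.exp a / 2)) =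
          Real.exp (4 * M - 2 * a) * Real.exp (a + b + c) * Real.exp a by ring, ← Real.exp_add,
          ← Real.exp_add, ← Real.exp_add]
        ring_nf
    _ ≤ _ := by
        gcongr
        · exact hlow _
        · exact hlow _

/-- The bound involves only `a`: a red side cannot become short while its own coordinate stays
bounded, whatever the other two do. -/
theorem le_logRatio (a b c : ℝ) : -(2 * |a| + Real.log 2) ≤ logRatio a b c := by
  rw [← Real.exp_le_exp, exp_logRatio, le_div_iff₀ (mul_pos (Real.cosh_pos _) (Real.cosh_pos _)),
    Real.exp_neg, inv_mul_le_iff₀ (Real.exp_pos _), Real.exp_add, Real.exp_log zero_lt_two]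
  have h1 : Real.cosh (b + c) ≤ 2 * (Real.cosh b * Real.cosh c) := by
    have h2 := Real.cosh_pos (b - c)
    have h3 := Real.cosh_add b c
    have h4 := Real.cosh_sub b c
    linarith
  have h2 : Real.cosh (a + b + c) ≤ Real.exp |a| * Real.cosh (b + c) := by
    have := cosh_add_le (b + c) a
    rwa [show b + c + a = a + b + c by ring] at this
  have h3 : Real.exp (2 * |a|) = Real.exp |a| * Real.exp |a| := by
    rw [← Real.exp_add]; ring_nf
  rw [h3]
  calc _ ≤ Real.exp |a| * (2 * (Real.cosh b * Real.cosh c)) * Real.exp |a| := by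
        refine mul_le_mul (h2.trans ?_) (cosh_le_exp_abs a) (Real.cosh_pos _).le ?_
        · gcongr
        · have := Real.cosh_pos b
          have := Real.cosh_pos c
          positivity
    _ = _ := by ring

/-- A red side whose coordinate degenerates to `∞` becomes short. -/
theorem tendsto_sideLog_atBot {lam : ℝ} {w d : Fin 3 → ℝ} {i : Fin 3}
    (h : ∀ τ ∈ Set.Ioc (0 : ℝ) 1, w + τ • d ∈ weightCone lam)
    (hi : w i ∉ Set.range (coshPrimitive lam)) (hpos : 0 < w i)
    (hcl : ENNReal.ofReal |w i| ≤ coshIntegral lam) (hlow : ∀ j, -w i < w j) :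
    Tendsto (fun τ : ℝ => sideLog (coords lam (w + τ • d)) i) (𝓝[>] 0) atBot := by
  have hmem : ∀ j, ∀ᶠ τ in 𝓝[>] (0 : ℝ), (w + τ • d) j ∈ Set.range (coshPrimitive lam) :=
    fun j => (eventually_ray h).mono fun τ hτ => hτ.1 j
  have hr : Tendsto (fun τ : ℝ => coords lam (w + τ • d) i) (𝓝[>] 0) atTop :=
    tendsto_coshInv_atTop hi hpos (tendsto_ray w d i) (hmem i)
  have hbelow : ∀ j, ∃ M : ℝ, 0 ≤ M ∧ ∀ᶠ τ in 𝓝[>] (0 : ℝ), -M ≤ coords lam (w + τ • d) j := by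
    intro j
    -- Such a `y` is a value of the primitive because `|y| < w i`; its preimage bounds the `j`-th
    -- coordinate from below near `τ = 0`.
    obtain ⟨y, hy1, hy2⟩ := exists_between (show -w i < min (w j) 0 from lt_min (hlow j) (by linarith))
    rw [lt_min_iff] at hy2
    have hy : y ∈ Set.range (coshPrimitive lam) := by
      rw [mem_range_coshPrimitive]
      refine lt_of_lt_of_le ?_ hcl
      rw [abs_of_neg hy2.2, abs_of_pos hpos]
      exact (ENNReal.ofReal_lt_ofReal_iff hpos).2 (by linarith)
    obtain ⟨m, rfl⟩ := hy
    refine ⟨|m|, abs_nonneg m, ?_⟩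
    filter_upwards [(tendsto_ray w d j).eventually_const_lt hy2.1, hmem j] with τ a1 a2
    have := (lt_coshInv_iff a2).2 a1
    exact (neg_abs_le m).trans this.le
  obtain ⟨M₁, hM₁, hb₁⟩ := hbelow (i + 1)
  obtain ⟨M₂, hM₂, hb₂⟩ := hbelow (i + 2)
  have hbig : Tendsto (fun τ : ℝ => Real.log 4 + (4 * max M₁ M₂ - 2 * coords lam (w + τ • d) i))
      (𝓝[>] 0) atBot := by
    refine tendsto_atBot_add_const_left _ _ ?_
    have := tendsto_atBot_add_const_left _ (4 * max M₁ M₂)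
      (tendsto_neg_atTop_atBot.comp (hr.const_mul_atTop (zero_lt_two (α := ℝ))))
    refine this.congr fun τ => ?_
    simp only [Function.comp]
    ring
  refine tendsto_atBot_mono' _ ?_ hbig
  filter_upwards [hb₁, hb₂] with τ a1 a2
  have := exp_logRatio_le (a := coords lam (w + τ • d) i) (le_max_of_le_left hM₁ : 0 ≤ max M₁ M₂)
    ((neg_le_neg (le_max_left _ _)).trans a1) ((neg_le_neg (le_max_right _ _)).trans a2)
  rw [← Real.exp_le_exp, Real.exp_add, Real.exp_log (by norm_num)]
  exact this

theorem eventually_le_sideLog {lam : ℝ} {w d : Fin 3 → ℝ} {i : Fin 3}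
    (hi : w i ∈ Set.range (coshPrimitive lam)) :
    ∃ c, ∀ᶠ τ in 𝓝[>] (0 : ℝ), c ≤ sideLog (coords lam (w + τ • d)) i := by
  refine ⟨-(2 * (|coshInv lam (w i)| + 1) + Real.log 2), ?_⟩
  have h1 := ((hasDerivAt_coshInv hi).continuousAt.tendsto.comp (tendsto_ray w d i)).abs
  filter_upwards [h1.eventually_lt_const (lt_add_one |coshInv lam (w i)|)] with τ hτ
  refine le_trans ?_ (le_logRatio _ _ _)
  simp only [Function.comp] at hτ
  rw [coords]
  linarith

/-- A concave function on a relatively open convex set `P` with compact closure attains its maximum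
if it increases along some ray starting at any boundary point. -/
theorem exists_max_of_increasing_at_boundary {E : Type*} [NormedAddCommGroup E] [NormedSpace ℝ E]
    {K P : Set E} {F : E → ℝ} (hK : IsCompact K) (hPK : P ⊆ K) (hne : P.Nonempty)
    (hF : ConcaveOn ℝ P F) (hcont : ContinuousOn F P)
    (hseg : ∀ x ∈ K, ∀ y ∈ P, ∀ τ ∈ Set.Ioc (0 : ℝ) 1, x + τ • (y - x) ∈ P)
    (hbd : ∀ x ∈ K, x ∉ P → ∃ y ∈ P, ∃ δ > 0,
      StrictMonoOn (fun τ : ℝ => F (x + τ • (y - x))) (Set.Ioo 0 δ)) :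
    ∃ x ∈ P, ∀ y ∈ P, F y ≤ F x := by
  -- A closed substitute for the superlevel set of `F p` that makes sense on all of `K`: the
  -- concavity inequality along segments into `P`, with `F p` in place of the possibly undefined
  -- value at `x`. These sets are nested, and a common point is a maximum if it lies in `P`.
  let A : P → Set E := fun p => {x | x ∈ K ∧ ∀ y ∈ P, ∀ τ ∈ Set.Ioc (0 : ℝ) 1,
    (1 - τ) * F p + τ * F y ≤ F (x + τ • (y - x))}
  have hAK : ∀ p, A p ⊆ K := fun p x hx => hx.1
  have hclosed : ∀ p, IsClosed (A p) := by
    intro p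
    have : A p = K ∩ ⋂ y ∈ P, ⋂ τ ∈ Set.Ioc (0 : ℝ) 1,
        (K ∩ (fun x => F (x + τ • (y - x))) ⁻¹' Set.Ici ((1 - τ) * F p + τ * F y)) := by
      ext x
      simp only [A, Set.mem_ofPred_eq, Set.mem_inter_iff, Set.mem_iInter, Set.mem_preimage,
        Set.mem_Ici]
      exact ⟨fun h => ⟨h.1, fun y hy τ hτ => ⟨h.1, h.2 y hy τ hτ⟩⟩,
        fun h => ⟨h.1, fun y hy τ hτ => (h.2 y hy τ hτ).2⟩⟩
    rw [this]
    refine hK.isClosed.inter (isClosed_biInter fun y hy => isClosed_biInter fun τ hτ => ?_)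
    refine ContinuousOn.preimage_isClosed_of_isClosed ?_ hK.isClosed isClosed_Ici
    refine hcont.comp (by fun_prop) fun x hx => hseg x hx y hy τ hτ
  have hmem : ∀ p : P, (p : E) ∈ A p := by
    intro p
    refine ⟨hPK p.2, fun y hy τ hτ => ?_⟩
    have := hF.2 p.2 hy (sub_nonneg.2 hτ.2) hτ.1.le (by ring)
    have e : (1 - τ) • (p : E) + τ • y = (p : E) + τ • (y - (p : E)) := by
      rw [sub_smul, smul_sub, one_smul]; abel
    rw [e] at this
    simpa using this
  have hmono : ∀ p q : P, F p ≤ F q → A q ⊆ A p := by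
    intro p q hpq x hx
    refine ⟨hx.1, fun y hy τ hτ => le_trans ?_ (hx.2 y hy τ hτ)⟩
    have := mul_le_mul_of_nonneg_left hpq (sub_nonneg.2 hτ.2)
    linarith
  have hdir : Directed (· ⊇ ·) A := by
    intro p q
    rcases le_total (F p) (F q) with h | h
    · exact ⟨q, hmono p q h, subset_rfl⟩
    · exact ⟨p, subset_rfl, hmono q p h⟩
  have : Nonempty P := hne.to_subtype
  obtain ⟨x, hx⟩ := IsCompact.nonempty_iInter_of_directed_nonempty_isCompact_isClosed A hdir
    (fun p => ⟨p, hmem p⟩) (fun p => hK.of_isClosed_subset (hclosed p) (hAK p)) hclosed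
  rw [Set.mem_iInter] at hx
  by_cases hxP : x ∈ P
  · refine ⟨x, hxP, fun y hy => ?_⟩
    have := (hx ⟨y, hy⟩).2 x hxP (1 / 2) ⟨by norm_num, by norm_num⟩
    simp only [sub_self, smul_zero, add_zero] at this
    linarith
  · exfalso
    have hxK := (hx (Classical.arbitrary P)).1
    obtain ⟨y, hy, δ, hδ, hmonoF⟩ := hbd x hxK hxP
    set ε := min (δ / 2) 1 with hε
    have hε0 : 0 < ε := lt_min (by linarith) one_pos
    have hεδ : ε < δ := (min_le_left _ _).trans_lt (by linarith)
    have hεP : x + ε • (y - x) ∈ P := hseg x hxK y hy ε ⟨hε0, min_le_right _ _⟩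
    have hlim : Tendsto (fun τ : ℝ => (1 - τ) * F (x + ε • (y - x)) + τ * F y) (𝓝[>] 0)
        (𝓝 ((1 - 0) * F (x + ε • (y - x)) + 0 * F y)) := by
      refine Tendsto.mono_left ?_ nhdsWithin_le_nhds
      exact (Continuous.tendsto (by fun_prop) 0)
    have hle : ∀ᶠ τ in 𝓝[>] (0 : ℝ), (1 - τ) * F (x + ε • (y - x)) + τ * F y ≤
        F (x + (ε / 2) • (y - x)) := by
      filter_upwards [Ioo_mem_nhdsGT (half_pos hε0)] with τ hτ
      have h1 := (hx ⟨_, hεP⟩).2 y hy τ ⟨hτ.1, by linarith [hτ.2, min_le_right (δ / 2) 1]⟩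
      have h2 := hmonoF ⟨hτ.1, by linarith [hτ.2]⟩ ⟨half_pos hε0, by linarith⟩ hτ.2
      exact h1.trans h2.le
    have h1 := le_of_tendsto hlim hle
    -- Membership in the set belonging to the point at parameter `ε` gave, in the limit `τ → 0`, a
    -- value at `ε / 2` at least as large as at `ε`.
    have h2 := hmonoF (a := ε / 2) (b := ε) ⟨half_pos hε0, by linarith⟩ ⟨hε0, hεδ⟩ (by linarith)
    simp only [sub_zero, one_mul, zero_mul, add_zero] at h1
    exact absurd h2 (not_lt.2 h1)

/-! ### Existence of a metric with prescribed invariants -/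

theorem isOpen_range_coshPrimitive (lam : ℝ) : IsOpen (Set.range (coshPrimitive lam)) := by
  have : Set.range (coshPrimitive lam) = {y | ENNReal.ofReal |y| < coshIntegral lam} :=
    Set.ext fun y => mem_range_coshPrimitive
  rw [this]
  exact isOpen_lt (ENNReal.continuous_ofReal.comp continuous_abs) continuous_const

theorem convex_range_coshPrimitive (lam : ℝ) : Convex ℝ (Set.range (coshPrimitive lam)) :=
  (isPreconnected_range (continuous_coshPrimitive lam)).ordConnected.convex

theorem isOpen_weightCone (lam : ℝ) : IsOpen (weightCone lam) := by
  have : weightCone lam = (⋂ i, (fun w : Fin 3 → ℝ => w i) ⁻¹' Set.range (coshPrimitive lam)) ∩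
      ⋂ i, {w : Fin 3 → ℝ | 0 < w (i + 1) + w (i + 2)} := by
    ext w; simp [weightCone]
  rw [this]
  exact (isOpen_iInter_of_finite fun i =>
    (isOpen_range_coshPrimitive lam).preimage (continuous_apply i)).inter
    (isOpen_iInter_of_finite fun i => isOpen_lt continuous_const (by fun_prop))

/-- A point of the open segment from `x`, in the closure of the range, to a point of the range. -/
theorem segment_mem_range {lam x y τ : ℝ} (hx : ENNReal.ofReal |x| ≤ coshIntegral lam)
    (hy : y ∈ Set.range (coshPrimitive lam)) (hτ : τ ∈ Set.Ioc (0 : ℝ) 1) :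
    x + τ * (y - x) ∈ Set.range (coshPrimitive lam) := by
  by_cases hxr : x ∈ Set.range (coshPrimitive lam)
  · exact (convex_range_coshPrimitive lam).add_smul_sub_mem hxr hy ⟨hτ.1.le, hτ.2⟩
  · have h := abs_lt_abs_of_notMem_range hy hxr
    rw [mem_range_coshPrimitive]
    refine lt_of_lt_of_le ((ENNReal.ofReal_lt_ofReal_iff ((abs_nonneg y).trans_lt h)).2 ?_) hx
    have e : x + τ * (y - x) = (1 - τ) * x + τ * y := by ring
    rw [e]
    calc |(1 - τ) * x + τ * y| ≤ |(1 - τ) * x| + |τ * y| := abs_add_le _ _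
      _ = (1 - τ) * |x| + τ * |y| := by
        rw [abs_mul, abs_mul, abs_of_pos hτ.1, abs_of_nonneg (sub_nonneg.2 hτ.2)]
      _ < |x| := by nlinarith [hτ.1]

variable {ι : Type*}

/-- The values of a function of the red sides on the red sides of one hexagon. -/
def row (w : ι × Fin 3 → ℝ) (h : ι) : Fin 3 → ℝ := fun i => w (h, i)

theorem continuous_row (h : ι) : Continuous fun w : ι × Fin 3 → ℝ => row w h :=
  continuous_pi fun _ => continuous_apply _

/-- The slope `hexSlope` of the red side `s`. -/
def sideSlope (lam : ℝ) (w : ι × Fin 3 → ℝ) (s : ι × Fin 3) : ℝ := hexSlope lam (row w s.1) s.2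

section Potential

variable [Fintype ι]

/-- The sum of the potentials of the hexagons. -/
def potential (lam : ℝ) (w : ι × Fin 3 → ℝ) : ℝ := ∑ h, hexPotential lam (row w h)

/-- The derivative of `potential` in the direction `d`. -/
def potentialSlope (lam : ℝ) (w d : ι × Fin 3 → ℝ) : ℝ := ∑ s, sideSlope lam w s * d s

theorem potentialSlope_eq (lam : ℝ) (w d : ι × Fin 3 → ℝ) : potentialSlope lam w d =
    ∑ h, ∑ i, hexSlope lam (row w h) i * row d h i := Fintype.sum_prod_type _

theorem hasDerivAt_potential {lam : ℝ} {w d : ι × Fin 3 → ℝ} {τ : ℝ}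
    (hw : ∀ h, row (w + τ • d) h ∈ weightCone lam) :
    HasDerivAt (fun t : ℝ => potential lam (w + t • d)) (potentialSlope lam (w + τ • d) d) τ := by
  rw [potentialSlope_eq]
  exact HasDerivAt.fun_sum fun h _ => hasDerivAt_hexPotential (hw h)

theorem antitoneOn_potentialSlope {lam : ℝ} {w d : ι × Fin 3 → ℝ} {s : Set ℝ} (hs : Convex ℝ s)
    (hw : ∀ τ ∈ s, ∀ h, row (w + τ • d) h ∈ weightCone lam) :
    AntitoneOn (fun t : ℝ => potentialSlope lam (w + t • d) d) s := by
  intro a ha b hb hab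
  simp only [potentialSlope_eq]
  exact Finset.sum_le_sum fun h _ =>
    antitoneOn_sum_hexSlope hs (fun τ hτ => hw τ hτ h) ha hb hab

theorem continuousOn_potential (lam : ℝ) :
    ContinuousOn (potential lam) {w : ι × Fin 3 → ℝ | ∀ h, row w h ∈ weightCone lam} :=
  continuousOn_finsetSum _ fun h _ => (continuousOn_hexPotential lam).comp
    (continuous_row h).continuousOn fun _ hw => hw h

theorem concaveOn_potential {lam : ℝ} {P : Set (ι × Fin 3 → ℝ)} (hP : Convex ℝ P)
    (hw : ∀ w ∈ P, ∀ h, row w h ∈ weightCone lam) : ConcaveOn ℝ P (potential lam) := by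
  refine ⟨hP, fun x hx y hy a b ha hb hab => ?_⟩
  have hmem : ∀ τ ∈ Set.Icc (0 : ℝ) 1, ∀ h, row (x + τ • (y - x)) h ∈ weightCone lam :=
    fun τ hτ => hw _ (hP.add_smul_sub_mem hx hy hτ)
  have hder : ∀ τ ∈ Set.Icc (0 : ℝ) 1, HasDerivAt (fun t : ℝ => potential lam (x + t • (y - x)))
      (potentialSlope lam (x + τ • (y - x)) (y - x)) τ :=
    fun τ hτ => hasDerivAt_potential (hmem τ hτ)
  have hc : ConcaveOn ℝ (Set.Icc (0 : ℝ) 1) fun t : ℝ => potential lam (x + t • (y - x)) := by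
    refine AntitoneOn.concaveOn_of_deriv (convex_Icc 0 1)
      (fun τ hτ => (hder τ hτ).continuousAt.continuousWithinAt)
      (fun τ hτ => (hder τ (interior_subset hτ)).differentiableAt.differentiableWithinAt) ?_
    intro s hs t ht hst
    rw [(hder s (interior_subset hs)).deriv, (hder t (interior_subset ht)).deriv]
    exact antitoneOn_potentialSlope (convex_Icc 0 1) hmem (interior_subset hs)
      (interior_subset ht) hst
  have h := hc.2 (Set.left_mem_Icc.2 zero_le_one) (Set.right_mem_Icc.2 zero_le_one) ha hb hab
  have e : a • x + b • y = x + b • (y - x) := by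
    rw [← eq_sub_iff_add_eq] at hab
    rw [hab]; module
  simpa [e] using h

theorem exists_strictMonoOn_potential {lam : ℝ} {x d : ι × Fin 3 → ℝ}
    (hw : ∀ τ ∈ Set.Ioc (0 : ℝ) 1, ∀ h, row (x + τ • d) h ∈ weightCone lam)
    (hpos : ∀ᶠ τ in 𝓝[>] (0 : ℝ), 0 < potentialSlope lam (x + τ • d) d) :
    ∃ δ > 0, StrictMonoOn (fun τ : ℝ => potential lam (x + τ • d)) (Set.Ioo 0 δ) := by
  obtain ⟨δ, hδ, hsub⟩ := mem_nhdsGT_iff_exists_Ioo_subset.1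
    (hpos.and (eventually_ray (P := fun τ => ∀ h, row (x + τ • d) h ∈ weightCone lam) hw))
  refine ⟨δ, hδ, strictMonoOn_of_deriv_pos (convex_Ioo 0 δ)
    (fun τ hτ => (hasDerivAt_potential (hsub hτ).2).continuousAt.continuousWithinAt) ?_⟩
  intro τ hτ
  have hτ' := interior_subset hτ
  rw [(hasDerivAt_potential (hsub hτ').2).deriv]
  exact (hsub hτ').1

theorem potentialSlope_single_sub [DecidableEq ι] (lam : ℝ) (w : ι × Fin 3 → ℝ)
    (s t : ι × Fin 3) :
    potentialSlope lam w (Pi.single s 1 - Pi.single t 1) =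
      sideSlope lam w s - sideSlope lam w t := by
  simp [potentialSlope, mul_sub, Finset.sum_sub_distrib, Pi.single_apply]

end Potential

namespace IdealTriangulation

variable (T : IdealTriangulation ι)

/-- Distributions of the edge invariants `z` over the red sides such that every hexagon can be
realized. -/
def weights (lam : ℝ) (z : T.Edge → ℝ) : Set (ι × Fin 3 → ℝ) :=
  {w | (∀ h, row w h ∈ weightCone lam) ∧ ∀ s, w s + w (T.glue s) = z (T.edge s)}

/-- The closure of `weights`. -/
def closedWeights (lam : ℝ) (z : T.Edge → ℝ) : Set (ι × Fin 3 → ℝ) :=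
  {w | (∀ s, ENNReal.ofReal |w s| ≤ coshIntegral lam) ∧
    (∀ h i, 0 ≤ w (h, i + 1) + w (h, i + 2)) ∧ ∀ s, w s + w (T.glue s) = z (T.edge s)}

variable {T} {lam : ℝ} {z : T.Edge → ℝ}

theorem weights_subset : T.weights lam z ⊆ T.closedWeights lam z := fun _ hw =>
  ⟨fun s => (mem_range_coshPrimitive.1 ((hw.1 s.1).1 s.2)).le,
    fun h i => ((hw.1 h).2 i).le, hw.2⟩

theorem segment_mem_weights {x y : ι × Fin 3 → ℝ} (hx : x ∈ T.closedWeights lam z)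
    (hy : y ∈ T.weights lam z) {τ : ℝ} (hτ : τ ∈ Set.Ioc (0 : ℝ) 1) :
    x + τ • (y - x) ∈ T.weights lam z := by
  refine ⟨fun h => ⟨fun i => segment_mem_range (hx.1 (h, i)) ((hy.1 h).1 i) hτ, fun i => ?_⟩,
    fun s => ?_⟩
  · have h1 := hx.2.1 h i
    have h2 : 0 < y (h, i + 1) + y (h, i + 2) := (hy.1 h).2 i
    simp only [row, Pi.add_apply, Pi.smul_apply, Pi.sub_apply, smul_eq_mul]
    have := mul_pos hτ.1 h2
    have := mul_nonneg (sub_nonneg.2 hτ.2) h1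
    linarith
  · simp only [Pi.add_apply, Pi.smul_apply, Pi.sub_apply, smul_eq_mul]
    linear_combination (1 - τ) * hx.2.2 s + τ * hy.2 s

theorem convex_weights : Convex ℝ (T.weights lam z) := by
  rw [convex_iff_add_mem]
  intro x hx y hy a b ha hb hab
  rcases hb.eq_or_lt with rfl | hb
  · simpa [show a = 1 by linarith] using hx
  · have := segment_mem_weights (weights_subset hx) hy (τ := b) ⟨hb, by linarith⟩
    have e : a • x + b • y = x + b • (y - x) := by
      rw [← eq_sub_iff_add_eq] at hab
      rw [hab]; module
    rwa [e]

theorem isClosed_closedWeights : IsClosed (T.closedWeights lam z) := by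
  have : T.closedWeights lam z =
      (⋂ s, {w | ENNReal.ofReal |w s| ≤ coshIntegral lam}) ∩
      ((⋂ h, ⋂ i, {w | 0 ≤ w (h, i + 1) + w (h, i + 2)}) ∩
        ⋂ s, {w | w s + w (T.glue s) = z (T.edge s)}) := by
    ext w; simp [closedWeights]
  rw [this]
  refine (isClosed_iInter fun s => ?_).inter ((isClosed_iInter fun h => isClosed_iInter fun i => ?_).inter
    (isClosed_iInter fun s => ?_))
  · exact isClosed_le (ENNReal.continuous_ofReal.comp (by fun_prop)) continuous_const
  · exact isClosed_le continuous_const (by fun_prop)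
  · exact isClosed_eq (by fun_prop) continuous_const

/-- The gluing as a permutation of the red sides. -/
def glueEquiv (T : IdealTriangulation ι) : Equiv.Perm (ι × Fin 3) :=
  ⟨T.glue, T.glue, T.glue_glue, T.glue_glue⟩

theorem sum_glue [Fintype ι] {M : Type*} [AddCommMonoid M] (T : IdealTriangulation ι)
    (f : ι × Fin 3 → M) : ∑ s, f (T.glue s) = ∑ s, f s := Equiv.sum_comp T.glueEquiv f

theorem two_mul_sum_eq [Fintype ι] {w : ι × Fin 3 → ℝ}
    (hw : ∀ s, w s + w (T.glue s) = z (T.edge s)) : 2 * ∑ s, w s = ∑ s, z (T.edge s) := by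
  simp only [← hw, Finset.sum_add_distrib, T.sum_glue w, two_mul]

/-- Boundedness does not use the integral, which may be infinite. The total weight `Z` is fixed by
`z` and each hexagon has nonnegative total, so each total is at most `Z`; a weight is at most the
total of its hexagon, and at least minus another weight of that hexagon. -/
theorem isCompact_closedWeights [Finite ι] : IsCompact (T.closedWeights lam z) := by
  have := Fintype.ofFinite ι
  set Z := (∑ s, z (T.edge s)) / 2 with hZ
  refine (Metric.isCompact_of_isClosed_isBounded isClosed_closedWeights
    ((Metric.isBounded_Icc (fun _ => -Z) (fun _ => Z)).subset fun w hw => ?_))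
  have htot : ∑ h, ∑ i, w (h, i) = Z := by
    rw [← Fintype.sum_prod_type, hZ, ← two_mul_sum_eq hw.2.2]; ring
  have hle : ∀ h, ∑ i, w (h, i) ≤ Z := by
    intro h
    rw [← htot]
    refine Finset.single_le_sum (f := fun h => ∑ i, w (h, i)) (fun k _ => ?_) (Finset.mem_univ h)
    have h0 := hw.2.1 k 0
    have h1 := hw.2.1 k 1
    have h2 := hw.2.1 k 2
    simp only [Fin.sum_univ_three]
    simp only [Fin.reduceAdd, zero_add, show (2 : Fin 3) + 2 = 1 from rfl,
      show (1 : Fin 3) + 2 = 0 from rfl, show (2 : Fin 3) + 1 = 0 from rfl] at h0 h1 h2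
    linarith
  have hub : ∀ h i, w (h, i) ≤ Z := by
    intro h i
    have h1 := hle h
    have h2 := hw.2.1 h i
    have e : ∑ i, w (h, i) = w (h, i) + w (h, i + 1) + w (h, i + 2) := by
      rw [Fin.sum_univ_three]
      fin_cases i <;> simp <;> ring_nf
    linarith
  refine ⟨fun s => ?_, fun s => hub s.1 s.2⟩
  have h1 := hw.2.1 s.1 (s.2 + 2)
  have e : s.2 + 2 + 1 = s.2 := by rw [add_assoc]; exact add_zero _
  rw [e] at h1
  have := hub s.1 (s.2 + 2 + 2)
  simp only at this ⊢
  linarith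

end IdealTriangulation

end LuoCoord

end

noncomputable section

namespace LuoCoord

open MeasureTheory Filter Topology

/-! ### The critical point of the potential -/

/-- The three indices of a hexagon seen from one of them. -/
theorem fin_three_cases (i j : Fin 3) : j = i ∨ j = i + 1 ∨ j = i + 2 := by
  revert i j; decide

theorem fin_three_add (i : Fin 3) :
    i + 1 + 1 = i + 2 ∧ i + 1 + 2 = i ∧ i + 2 + 1 = i ∧ i + 2 + 2 = i + 1 := by
  revert i; decide

namespace IdealTriangulation

variable {ι : Type*} {T : IdealTriangulation ι} {lam : ℝ} {z : T.Edge → ℝ}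

theorem pair_pos {x : ι × Fin 3 → ℝ} {h : ι} (hpair : ∀ i, 0 < x (h, i + 1) + x (h, i + 2))
    {i j : Fin 3} (hij : i ≠ j) : 0 < x (h, i) + x (h, j) := by
  obtain ⟨h1, h2, h3, h4⟩ := fin_three_add i
  rcases fin_three_cases i j with rfl | rfl | rfl
  · exact absurd rfl hij
  · have := hpair (i + 2); rwa [h3, h4] at this
  · have := hpair (i + 1); rw [h1, h2] at this; linarith

theorem potentialSlope_eventually_pos_of_pair_eq_zero [Fintype ι] {x d : ι × Fin 3 → ℝ}
    (hx : x ∈ T.closedWeights lam z)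
    (hw : ∀ τ ∈ Set.Ioc (0 : ℝ) 1, ∀ h, row (x + τ • d) h ∈ weightCone lam)
    {h : ι} {k : Fin 3} (hk : x (h, k + 1) + x (h, k + 2) = 0) :
    ∀ᶠ τ in 𝓝[>] (0 : ℝ), 0 < potentialSlope lam (x + τ • d) d := by
  classical
  have h1 := tendsto_sum_hexSlope (w := row x h) (d := row d h) (k := k)
    (fun τ hτ => hw τ hτ h) (fun i => hx.1 (h, i)) (hx.2.1 h) hk
  -- By concavity the slopes of the other hexagons are bounded below by their values at `τ = 1`, so
  -- the divergence in hexagon `h` decides the sign.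
  set C := ∑ g ∈ Finset.univ.erase h, ∑ i, hexSlope lam (row x g + (1 : ℝ) • row d g) i * row d g i
  filter_upwards [h1.eventually_gt_atTop (-C),
    eventually_ray (P := fun τ => τ ∈ Set.Ioc (0 : ℝ) 1) fun τ hτ => hτ] with τ h2 h3
  rw [potentialSlope_eq, ← Finset.add_sum_erase _ _ (Finset.mem_univ h)]
  have : C ≤ ∑ g ∈ Finset.univ.erase h, ∑ i, hexSlope lam (row (x + τ • d) g) i * row d g i :=
    Finset.sum_le_sum fun g _ => antitoneOn_sum_hexSlope (convex_Ioc 0 1) (fun τ hτ => hw τ hτ g)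
      h3 (Set.right_mem_Ioc.2 one_pos) h3.2
  have h2' : -C < ∑ i, hexSlope lam (row (x + τ • d) h) i * row d h i := h2
  linarith

/-- A weight of maximal absolute value that is not positive could not have a positive sum with its
neighbor. -/
theorem pos_of_notMem_range {x : ι × Fin 3 → ℝ} (hx : x ∈ T.closedWeights lam z)
    (hpair : ∀ h i, 0 < x (h, i + 1) + x (h, i + 2)) {s : ι × Fin 3}
    (hs : x s ∉ Set.range (coshPrimitive lam)) : 0 < x s := by
  by_contra hneg
  have h1 : 0 < x (s.1, s.2) + x (s.1, s.2 + 1) := pair_pos (hpair s.1) (by simp)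
  have h2 := hx.1 (s.1, s.2 + 1)
  rw [mem_range_coshPrimitive, not_lt] at hs
  have h3 := (ENNReal.ofReal_le_ofReal_iff (abs_nonneg _)).1 (h2.trans hs)
  have h4 := le_abs_self (x (s.1, s.2 + 1))
  rw [abs_of_nonpos (not_lt.1 hneg)] at h3
  change 0 < x s + _ at h1
  linarith

open Classical in
/-- The direction in which all extremal weights decrease. -/
def inward (T : IdealTriangulation ι) (lam : ℝ) (x : ι × Fin 3 → ℝ) : ι × Fin 3 → ℝ := fun s =>
  (if x (T.glue s) ∈ Set.range (coshPrimitive lam) then 0 else 1) -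
    (if x s ∈ Set.range (coshPrimitive lam) then 0 else 1)

theorem potentialSlope_inward [Fintype ι] (x w : ι × Fin 3 → ℝ) : potentialSlope lam w (T.inward lam x) =
    ∑ s, open Classical in if x s ∈ Set.range (coshPrimitive lam) then 0 else
      sideSlope lam w (T.glue s) - sideSlope lam w s := by
  classical
  have h1 : ∑ s, sideSlope lam w s *
      (if x (T.glue s) ∈ Set.range (coshPrimitive lam) then (0 : ℝ) else 1) =
      ∑ s, sideSlope lam w (T.glue s) *
        (if x s ∈ Set.range (coshPrimitive lam) then 0 else 1) := by
    rw [← T.sum_glue]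
    simp only [T.glue_glue]
  simp only [potentialSlope, inward, mul_sub, Finset.sum_sub_distrib]
  rw [h1, ← Finset.sum_sub_distrib]
  refine Finset.sum_congr rfl fun s _ => ?_
  split_ifs <;> ring

theorem potentialSlope_smul [Fintype ι] (w d : ι × Fin 3 → ℝ) (c : ℝ) :
    potentialSlope lam w (c • d) = c * potentialSlope lam w d := by
  simp only [potentialSlope, Pi.smul_apply, smul_eq_mul, Finset.mul_sum]
  exact Finset.sum_congr rfl fun s _ => by ring

/-- If both sides of an edge were extremal, then `z` there would be twice the integral, which
exceeds what the interior point `y` attains on that edge. -/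
theorem glue_mem_range {x y : ι × Fin 3 → ℝ} (hx : x ∈ T.closedWeights lam z)
    (hy : y ∈ T.weights lam z) (hpair : ∀ h i, 0 < x (h, i + 1) + x (h, i + 2)) {s : ι × Fin 3}
    (hs : x s ∉ Set.range (coshPrimitive lam)) :
    x (T.glue s) ∈ Set.range (coshPrimitive lam) := by
  by_contra hg
  have h1 := abs_lt_abs_of_notMem_range ((hy.1 s.1).1 s.2) hs
  have h2 := abs_lt_abs_of_notMem_range ((hy.1 (T.glue s).1).1 (T.glue s).2) hg
  rw [abs_of_pos (pos_of_notMem_range hx hpair hs)] at h1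
  rw [abs_of_pos (pos_of_notMem_range hx hpair hg)] at h2
  have h3 := (le_abs_self _).trans_lt h1
  have h4 := (le_abs_self _).trans_lt h2
  have h5 := hx.2.2 s
  have h6 := hy.2 s
  simp only [row] at h3 h4
  linarith

theorem exists_inward_mem [Finite ι] {x y : ι × Fin 3 → ℝ} (hx : x ∈ T.closedWeights lam z)
    (hy : y ∈ T.weights lam z) (hpair : ∀ h i, 0 < x (h, i + 1) + x (h, i + 2)) :
    ∃ ε : ℝ, 0 < ε ∧ x + ε • T.inward lam x ∈ T.weights lam z := by
  have hev : ∀ᶠ ε in 𝓝[>] (0 : ℝ), ∀ h, row (x + ε • T.inward lam x) h ∈ weightCone lam := by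
    have hcont : ∀ s, Tendsto (fun ε : ℝ => (x + ε • T.inward lam x) s) (𝓝[>] 0) (𝓝 (x s)) := by
      intro s
      have : Tendsto (fun ε : ℝ => (x + ε • T.inward lam x) s) (𝓝 0) (𝓝 (x s + 0 * _)) :=
        (by fun_prop : Continuous fun ε : ℝ => x s + ε * T.inward lam x s).tendsto 0
      rw [zero_mul, add_zero] at this
      exact this.mono_left nhdsWithin_le_nhds
    refine eventually_all.2 fun h => (eventually_all.2 fun i => ?_).and (eventually_all.2 fun i => ?_)
    · by_cases hs : x (h, i) ∈ Set.range (coshPrimitive lam)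
      · exact (hcont (h, i)).eventually ((isOpen_range_coshPrimitive lam).mem_nhds hs)
      -- The partner of an extremal side is not extremal, so the two indicator terms in `inward` do
      -- not cancel.
      · have hd : T.inward lam x (h, i) = -1 := by
          simp [inward, hs, glue_mem_range hx hy hpair hs]
        have hpos := pos_of_notMem_range hx hpair hs
        filter_upwards [self_mem_nhdsWithin,
          nhdsWithin_le_nhds (Iio_mem_nhds hpos)] with ε h1 h2
        rw [Set.mem_Ioi] at h1
        rw [Set.mem_Iio] at h2
        rw [mem_range_coshPrimitive]
        refine lt_of_lt_of_le ?_ (hx.1 (h, i))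
        rw [ENNReal.ofReal_lt_ofReal_iff (abs_pos.2 hpos.ne')]
        simp only [row, Pi.add_apply, Pi.smul_apply, smul_eq_mul, hd]
        rw [abs_of_pos hpos, abs_of_pos (by linarith)]
        linarith
    · exact ((hcont (h, i + 1)).add (hcont (h, i + 2))).eventually (lt_mem_nhds (hpair h i))
  obtain ⟨ε, h1, h2⟩ := (hev.and self_mem_nhdsWithin).exists
  refine ⟨ε, h2, h1, fun s => ?_⟩
  have e : T.inward lam x (T.glue s) = -T.inward lam x s := by
    have := T.glue_glue s
    unfold inward
    rw [neg_sub]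
    congr! 3
    rw [this]
  simp only [Pi.add_apply, Pi.smul_apply, smul_eq_mul, e]
  rw [← hx.2.2 s]
  ring

/-- Along the ray, `sideLog` tends to `-∞` at `s` and is bounded below at `t`. Only monotonicity of
`slope` is used, since `slope` may have a finite limit at `-∞`. -/
theorem sideSlope_lt_eventually {x d : ι × Fin 3 → ℝ} (hx : x ∈ T.closedWeights lam z)
    (hw : ∀ τ ∈ Set.Ioc (0 : ℝ) 1, ∀ h, row (x + τ • d) h ∈ weightCone lam)
    (hpair : ∀ h i, 0 < x (h, i + 1) + x (h, i + 2)) {s t : ι × Fin 3}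
    (hs : x s ∉ Set.range (coshPrimitive lam)) (ht : x t ∈ Set.range (coshPrimitive lam)) :
    ∀ᶠ τ in 𝓝[>] (0 : ℝ), sideSlope lam (x + τ • d) s < sideSlope lam (x + τ • d) t := by
  have hpos := pos_of_notMem_range hx hpair hs
  have h1 := tendsto_sideLog_atBot (w := row x s.1) (d := row d s.1) (i := s.2)
    (fun τ hτ => hw τ hτ s.1) hs hpos (hx.1 s) (by
      intro j
      change -x s < x (s.1, j)
      rcases eq_or_ne s.2 j with rfl | hj
      · change -x s < x s
        linarith
      · have : 0 < x s + x (s.1, j) := pair_pos (hpair s.1) hj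
        linarith)
  obtain ⟨c, h2⟩ := eventually_le_sideLog (w := row x t.1) (d := row d t.1) (i := t.2) ht

  filter_upwards [h1.eventually_lt_atBot c, h2,
    eventually_ray (P := fun τ => τ ∈ Set.Ioc (0 : ℝ) 1) fun τ hτ => hτ] with τ h3 h4 h5
  exact slope_strictMonoOn lam (sideLog_neg (coords_mem (hw τ h5 s.1)) _)
    (sideLog_neg (coords_mem (hw τ h5 t.1)) _) (h3.trans_le h4)

theorem potentialSlope_inward_pos [Fintype ι] {x y d : ι × Fin 3 → ℝ} (hx : x ∈ T.closedWeights lam z)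
    (hy : y ∈ T.weights lam z)
    (hw : ∀ τ ∈ Set.Ioc (0 : ℝ) 1, ∀ h, row (x + τ • d) h ∈ weightCone lam)
    (hpair : ∀ h i, 0 < x (h, i + 1) + x (h, i + 2)) {s : ι × Fin 3}
    (hs : x s ∉ Set.range (coshPrimitive lam)) :
    ∀ᶠ τ in 𝓝[>] (0 : ℝ), 0 < potentialSlope lam (x + τ • d) (T.inward lam x) := by
  have h1 : ∀ᶠ τ in 𝓝[>] (0 : ℝ), ∀ t, x t ∉ Set.range (coshPrimitive lam) →
      sideSlope lam (x + τ • d) t < sideSlope lam (x + τ • d) (T.glue t) := by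
    refine eventually_all.2 fun t => ?_
    by_cases ht : x t ∈ Set.range (coshPrimitive lam)
    · exact Eventually.of_forall fun _ h => absurd ht h
    · filter_upwards [sideSlope_lt_eventually hx hw hpair ht (glue_mem_range hx hy hpair ht)]
        with τ h _ using h
  filter_upwards [h1] with τ h
  rw [potentialSlope_inward]
  refine Finset.sum_pos' (fun t _ => ?_) ⟨s, Finset.mem_univ s, ?_⟩
  · split_ifs with ht
    · exact le_rfl
    · exact (sub_pos.2 (h t ht)).le
  · rw [if_neg hs]
    exact sub_pos.2 (h s hs)

/-- The ray depends on the boundary point. If some pairwise sum vanishes, any interior target works;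
if all pairwise sums are positive, the failure is an extremal weight, and the target is a small step
along `inward`. -/
theorem exists_isMaxOn_potential [Fintype ι] (hne : (T.weights lam z).Nonempty) :
    ∃ x ∈ T.weights lam z, ∀ y ∈ T.weights lam z, potential lam y ≤ potential lam x := by
  obtain ⟨y, hy⟩ := hne
  refine exists_max_of_increasing_at_boundary isCompact_closedWeights weights_subset ⟨y, hy⟩
    (concaveOn_potential convex_weights fun w hw => hw.1)
    ((continuousOn_potential lam).mono fun w hw => hw.1)
    (fun x hx y hy τ hτ => segment_mem_weights hx hy hτ) fun x hx hxP => ?_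
  by_cases hpair : ∀ h i, 0 < x (h, i + 1) + x (h, i + 2)
  · have : ∃ s, x s ∉ Set.range (coshPrimitive lam) := by
      by_contra! hall
      exact hxP ⟨fun h => ⟨fun i => hall (h, i), hpair h⟩, hx.2.2⟩
    obtain ⟨s, hs⟩ := this
    obtain ⟨ε, hε, hmem⟩ := exists_inward_mem hx hy hpair
    have hw : ∀ τ ∈ Set.Ioc (0 : ℝ) 1, ∀ h,
        row (x + τ • (x + ε • T.inward lam x - x)) h ∈ weightCone lam :=
      fun τ hτ => (segment_mem_weights hx hmem hτ).1
    refine ⟨_, hmem, exists_strictMonoOn_potential hw ?_⟩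
    filter_upwards [potentialSlope_inward_pos hx hy hw hpair hs] with τ h
    rw [add_sub_cancel_left, potentialSlope_smul]
    rw [add_sub_cancel_left] at h
    exact mul_pos hε h
  · push Not at hpair
    obtain ⟨h, k, hk⟩ := hpair
    have hw : ∀ τ ∈ Set.Ioc (0 : ℝ) 1, ∀ h, row (x + τ • (y - x)) h ∈ weightCone lam :=
      fun τ hτ => (segment_mem_weights hx hy hτ).1
    exact ⟨y, hy, exists_strictMonoOn_potential hw
      (potentialSlope_eventually_pos_of_pair_eq_zero hx hw (le_antisymm hk (hx.2.1 h k)))⟩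

theorem exists_sideLog_glue_eq [Finite ι] (hne : (T.weights lam z).Nonempty) :
    ∃ w ∈ T.weights lam z, ∀ s, sideLog (coords lam (row w (T.glue s).1)) (T.glue s).2 =
      sideLog (coords lam (row w s.1)) s.2 := by
  classical
  have := Fintype.ofFinite ι
  obtain ⟨w, hw, hmax⟩ := exists_isMaxOn_potential hne
  refine ⟨w, hw, fun s => ?_⟩
  -- Shifting weight across one edge preserves the edge equations, so the derivative in this
  -- direction vanishes at the maximum; it is the difference of the two slopes.
  set d : ι × Fin 3 → ℝ := Pi.single (T.glue s) 1 - Pi.single s 1 with hd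
  have hev : ∀ᶠ t in 𝓝 (0 : ℝ), ∀ h, row (w + t • d) h ∈ weightCone lam := by
    refine eventually_all.2 fun h => ?_
    have hc : Continuous fun t : ℝ => row (w + t • d) h :=
      (continuous_row h).comp (by fun_prop)
    refine hc.continuousAt.eventually ((isOpen_weightCone lam).mem_nhds ?_)
    simpa using hw.1 h
  have hglue : ∀ u, d u + d (T.glue u) = 0 := by
    intro u
    have e1 : T.glue u = T.glue s ↔ u = s := T.glueEquiv.injective.eq_iff
    have e2 : T.glue u = s ↔ u = T.glue s :=
      ⟨fun h => by rw [← h, T.glue_glue], fun h => by rw [h, T.glue_glue]⟩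
    simp only [hd, Pi.sub_apply, Pi.single_apply, e1, e2]
    ring
  have hloc : IsLocalMax (fun t : ℝ => potential lam (w + t • d)) 0 := by
    filter_upwards [hev] with t ht
    rw [zero_smul, add_zero]
    refine hmax _ ⟨ht, fun u => ?_⟩
    simp only [Pi.add_apply, Pi.smul_apply, smul_eq_mul]
    linear_combination hw.2 u + t * hglue u
  have hder := hasDerivAt_potential (d := d) hev.self_of_nhds
  have h0 := hloc.hasDerivAt_eq_zero hder
  rw [zero_smul, add_zero, potentialSlope_single_sub, sub_eq_zero] at h0
  exact (slope_strictMonoOn lam).injOn (sideLog_neg (coords_mem (hw.1 _)) _)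
    (sideLog_neg (coords_mem (hw.1 _)) _) h0

theorem mem_range_Psi_of_weights_nonempty [Finite ι] (hne : (T.weights lam z).Nonempty) :
    z ∈ Set.range (T.Psi lam) := by
  obtain ⟨w, hw, hlog⟩ := exists_sideLog_glue_eq hne
  choose H hH hred using fun h => exists_hexagon (coords lam (row w h)) (coords_mem (hw.1 h))
  -- The relation `sinh² = tanh² / (1 - tanh²)` shows that equal values of `sideLog` give equal red
  -- lengths.
  have hsinh : ∀ s : ι × Fin 3, Real.sinh ((H s.1).redLength s.2 / 2) ^ 2 =
      Real.exp (sideLog (coords lam (row w s.1)) s.2) /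
        (1 - Real.exp (sideLog (coords lam (row w s.1)) s.2)) := by
    intro s
    rw [(hred s.1 s.2).2, sideLog, one_sub_exp_logRatio, exp_logRatio,
      div_div_div_cancel_right₀]
    exact (mul_pos (Real.cosh_pos _) (Real.cosh_pos _)).ne'
  have hglue : ∀ s : ι × Fin 3,
      (H (T.glue s).1).redLength (T.glue s).2 = (H s.1).redLength s.2 := by
    intro s
    have h1 : Real.sinh ((H (T.glue s).1).redLength (T.glue s).2 / 2) ^ 2 =
        Real.sinh ((H s.1).redLength s.2 / 2) ^ 2 := by
      rw [hsinh, hsinh, hlog]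
    have hp : ∀ s : ι × Fin 3, 0 ≤ Real.sinh ((H s.1).redLength s.2 / 2) := fun s =>
      Real.sinh_nonneg_iff.2 (half_pos (hred s.1 s.2).1).le
    have h2 := Real.sinh_injective ((pow_left_inj₀ (hp _) (hp _) two_ne_zero).1 h1)
    linarith
  refine ⟨Quotient.mk _ ⟨H, hglue⟩, funext fun e => ?_⟩
  refine Quotient.inductionOn e fun s => ?_
  have hside : ∀ s, T.sideInvariant lam ⟨H, hglue⟩ s = w s := by
    intro s
    change coshPrimitive lam ((H s.1).rCoord s.2) = w s
    rw [hH, coords, coshPrimitive_coshInv ((hw.1 s.1).1 s.2)]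
    rfl
  change T.sideInvariant lam ⟨H, hglue⟩ s + T.sideInvariant lam ⟨H, hglue⟩ (T.glue s) = _
  rw [hside, hside, hw.2]
  rfl

end IdealTriangulation

/-! ### The image of `Ψ` -/

/-- If the endpoints coincided, the angle there would be the argument of `0`, which is `0` and not
`π / 2`. -/
theorem RightAngledHexagon.arcLength_pos (H : RightAngledHexagon) (i : Fin 3) :
    0 < H.arcLength i := by
  rw [arcLength, dist_pos]
  intro h
  have h1 := H.angle_q (i + 1)
  rw [(fin_three_add i).1, ← h] at h1
  simp only [orientedAngle, direction, sub_self, zero_div, div_zero, Complex.arg_zero] at h1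
  linarith [Real.pi_pos]

theorem RightAngledHexagon.rCoord_add_rCoord (H : RightAngledHexagon) (i : Fin 3) :
    H.rCoord (i + 1) + H.rCoord (i + 2) = H.arcLength i := by
  obtain ⟨h1, h2, h3, h4⟩ := fin_three_add i
  simp only [rCoord, h1, h2, h3, h4]
  ring

/-- Comparison with a possibly infinite bound becomes a real inequality guarded by finiteness, a
form suited to linear arithmetic. -/
theorem coe_lt_two_mul_iff (W : ℝ≥0∞) (y : ℝ) :
    (y : EReal) < ((2 * W : ℝ≥0∞) : EReal) ↔ (W ≠ ⊤ → y < 2 * W.toReal) := by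
  rcases eq_or_ne W ⊤ with rfl | hW
  · simp
  · have e : ((2 * W : ℝ≥0∞) : EReal) = ((2 * W.toReal : ℝ) : EReal) := by
      rw [← EReal.coe_ennreal_toReal (ENNReal.mul_ne_top ENNReal.ofNat_ne_top hW), ENNReal.toReal_mul]
      simp
    rw [e, EReal.coe_lt_coe_iff]
    simp [hW]

theorem neg_two_mul_lt_coe_iff (W : ℝ≥0∞) (y : ℝ) :
    -((2 * W : ℝ≥0∞) : EReal) < (y : EReal) ↔ (W ≠ ⊤ → -(2 * W.toReal) < y) := by
  rw [EReal.neg_lt_comm, ← EReal.coe_neg, coe_lt_two_mul_iff, neg_lt]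

theorem mem_range_coshPrimitive_iff {lam y : ℝ} : y ∈ Set.range (coshPrimitive lam) ↔
    (coshIntegral lam ≠ ⊤ → |y| < (coshIntegral lam).toReal) := by
  rw [mem_range_coshPrimitive]
  rcases eq_or_ne (coshIntegral lam) ⊤ with h | h
  · simp [h]
  · rw [ENNReal.ofReal_lt_iff_lt_toReal (abs_nonneg y) h]
    simp [h]

namespace IdealTriangulation

variable {ι : Type*} {T : IdealTriangulation ι} {lam : ℝ} {z : T.Edge → ℝ}

theorem sideInvariant_mem_weights (lam : ℝ) (d : T.HyperbolicMetric) :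
    T.sideInvariant lam d ∈ T.weights lam (T.edgeInvariant lam d) := by
  refine ⟨fun h => ⟨fun i => ⟨_, rfl⟩, fun i => ?_⟩, fun s => rfl⟩
  change 0 < coshPrimitive lam ((d.hexagon h).rCoord (i + 1)) +
    coshPrimitive lam ((d.hexagon h).rCoord (i + 2))
  have h1 := (d.hexagon h).arcLength_pos i
  rw [← RightAngledHexagon.rCoord_add_rCoord] at h1
  rw [← neg_lt_iff_pos_add, ← coshPrimitive_neg, (strictMono_coshPrimitive lam).lt_iff_lt]
  linarith

theorem mem_range_Psi_iff [Finite ι] :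
    z ∈ Set.range (T.Psi lam) ↔ (T.weights lam z).Nonempty := by
  refine ⟨?_, mem_range_Psi_of_weights_nonempty⟩
  rintro ⟨d, rfl⟩
  exact Quotient.inductionOn d fun d => ⟨_, sideInvariant_mem_weights lam d⟩

theorem add_pos_of_mem_weights {w : ι × Fin 3 → ℝ} (hw : w ∈ T.weights lam z) {s t : ι × Fin 3}
    (hst : t.1 = s.1) (hne : t ≠ s) : 0 < w s + w t := by
  obtain ⟨h, i⟩ := s
  obtain ⟨k, j⟩ := t
  obtain rfl : k = h := hst
  exact pair_pos (hw.1 k).2 fun h => hne (by rw [h])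

/-- Each `z` splits into the weights of the two sides of the edge. Regrouping by hexagons leaves the
first and last weight and, for each hexagon in between, a positive sum of entrance and exit. -/
theorem le_pathSum {w : ι × Fin 3 → ℝ} (hw : w ∈ T.weights lam z) (s : ι × Fin 3)
    (l : List (ι × Fin 3)) (hl : (s :: l).IsChain T.Follows) :
    w s + w (T.glue ((s :: l).getLast (List.cons_ne_nil s l))) ≤ T.pathSum z (s :: l) := by
  induction l generalizing s with
  | nil => simp [pathSum, hw.2]
  | cons t l ih =>
    rw [List.isChain_cons_cons] at hl
    have h1 := ih t hl.2
    have h2 := add_pos_of_mem_weights hw hl.1.1 hl.1.2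
    have h3 := hw.2 s
    rw [List.getLast_cons (List.cons_ne_nil t l)]
    have e : T.pathSum z (s :: t :: l) = z (T.edge s) + T.pathSum z (t :: l) := by
      simp [pathSum]
    rw [e]
    linarith

theorem abs_lt_of_mem_weights {w : ι × Fin 3 → ℝ} (hw : w ∈ T.weights lam z)
    (hW : coshIntegral lam ≠ ⊤) (s : ι × Fin 3) : |w s| < (coshIntegral lam).toReal :=
  mem_range_coshPrimitive_iff.1 ((hw.1 s.1).1 s.2) hW

theorem edge_lt_of_mem_weights {w : ι × Fin 3 → ℝ} (hw : w ∈ T.weights lam z)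
    (hW : coshIntegral lam ≠ ⊤) (e : T.Edge) : z e < 2 * (coshIntegral lam).toReal := by
  refine Quotient.inductionOn e fun s => ?_
  have h1 := hw.2 s
  have h2 := (abs_lt.1 (abs_lt_of_mem_weights hw hW s)).2
  have h3 := (abs_lt.1 (abs_lt_of_mem_weights hw hW (T.glue s))).2
  change z (T.edge s) < _
  linarith

theorem lt_pathSum_of_mem_weights {w : ι × Fin 3 → ℝ} (hw : w ∈ T.weights lam z)
    (hW : coshIntegral lam ≠ ⊤) {c : List (ι × Fin 3)} (hc : T.IsEdgePath c) :
    -(2 * (coshIntegral lam).toReal) < T.pathSum z c := by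
  obtain ⟨s, l, rfl⟩ := List.exists_cons_of_ne_nil hc.1
  have h1 := le_pathSum hw s l hc.2
  have h2 := (abs_lt.1 (abs_lt_of_mem_weights hw hW s)).1
  have h3 := (abs_lt.1 (abs_lt_of_mem_weights hw hW
    (T.glue ((s :: l).getLast (List.cons_ne_nil s l))))).1
  linarith

theorem pathSum_pos_of_mem_weights {w : ι × Fin 3 → ℝ} (hw : w ∈ T.weights lam z)
    {c : List (ι × Fin 3)} (hc : T.IsEdgeCycle c) : 0 < T.pathSum z c := by
  obtain ⟨s, l, rfl⟩ := List.exists_cons_of_ne_nil hc.1.1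
  obtain ⟨_, h⟩ := hc.2
  have h1 := le_pathSum hw s l hc.1.2
  have h2 := add_pos_of_mem_weights hw h.1 h.2
  rw [List.head_cons] at h2
  linarith

/-- An edge is the image of only two red sides, namely `s` and `glue s`. -/
theorem isFundamental_of_nodup {c : List (ι × Fin 3)} (hc : c.Nodup) : T.IsFundamental c := by
  classical
  intro e
  refine Quotient.inductionOn e fun s => ?_
  change List.count (T.edge s) _ ≤ 2
  rw [List.count, List.countP_map, List.countP_eq_length_filter,
    ← List.toFinset_card_of_nodup (hc.filter _)]
  refine (Finset.card_le_card (t := {s, T.glue s}) fun t ht => ?_).trans Finset.card_le_two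
  simp only [List.mem_toFinset, List.mem_filter, Function.comp_apply, beq_iff_eq] at ht
  have h : s = t ∨ s = T.glue t := Quotient.exact ht.2
  rcases h with rfl | rfl
  · simp
  · simp [T.glue_glue]

theorem finite_edge [Finite ι] : Finite T.Edge := Quotient.finite _

theorem weights_nonempty [Finite ι]
    (h1 : ∀ e, coshIntegral lam ≠ ⊤ → z e < 2 * (coshIntegral lam).toReal)
    (h2 : ∀ c, c.Nodup → T.IsEdgePath c → coshIntegral lam ≠ ⊤ →
      -(2 * (coshIntegral lam).toReal) < T.pathSum z c)
    (h3 : ∀ c, c.Nodup → T.IsEdgeCycle c → 0 < T.pathSum z c) : (T.weights lam z).Nonempty := by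
  have key : ∃ B : ℝ, 0 < B ∧ (coshIntegral lam ≠ ⊤ → B ≤ (coshIntegral lam).toReal) ∧
      (∀ e, z e < 2 * B) ∧
      ∀ c, c.Nodup → T.IsEdgePath c → -(2 * B) < T.pathSum z c := by
    by_cases hW : coshIntegral lam = ⊤
    · have := T.finite_edge
      obtain ⟨B₁, hB₁⟩ := (Set.finite_range z).bddAbove
      obtain ⟨B₂, hB₂⟩ := ((finite_nodup_lists (ι × Fin 3)).image (T.pathSum z)).bddBelow
      -- When the integral is infinite, any finite bound large compared with the finitely many
      -- values of `z` and of the simple path sums is admissible.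
      refine ⟨|B₁| + |B₂| + 1, by positivity, fun h => absurd hW h, fun e => ?_, fun c hc _ => ?_⟩
      · have := hB₁ ⟨e, rfl⟩
        linarith [le_abs_self B₁, abs_nonneg B₂, abs_nonneg B₁]
      · have := hB₂ ⟨c, hc, rfl⟩
        linarith [neg_abs_le B₂, abs_nonneg B₂, abs_nonneg B₁]
    · exact ⟨_, ENNReal.toReal_pos (coshIntegral_pos lam).ne' hW, fun _ => le_rfl,
        fun e => h1 e hW, fun c hc hp => h2 c hc hp hW⟩
  obtain ⟨B, hB, hBW, hz, hp⟩ := key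
  obtain ⟨w, hw1, hw2, hw3⟩ := T.exists_feasible z hB hz hp h3
  refine ⟨w, fun h => ⟨fun i => mem_range_coshPrimitive_iff.2 fun hW =>
    (hw2 (h, i)).trans_le (hBW hW), fun i => hw3 _ _ rfl ?_⟩, hw1⟩
  simp

/-- The inequalities for edge paths and edge cycles without repeated crossings suffice. -/
theorem mem_range_Psi_iff_nodup [Finite ι] : z ∈ Set.range (T.Psi lam) ↔
    (∀ e, coshIntegral lam ≠ ⊤ → z e < 2 * (coshIntegral lam).toReal) ∧
    (∀ c, c.Nodup → T.IsEdgePath c → coshIntegral lam ≠ ⊤ →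
      -(2 * (coshIntegral lam).toReal) < T.pathSum z c) ∧
    ∀ c, c.Nodup → T.IsEdgeCycle c → 0 < T.pathSum z c := by
  rw [mem_range_Psi_iff]
  refine ⟨fun ⟨w, hw⟩ => ⟨fun e hW => edge_lt_of_mem_weights hw hW e,
    fun c _ hc hW => lt_pathSum_of_mem_weights hw hW hc,
    fun c _ hc => pathSum_pos_of_mem_weights hw hc⟩, fun ⟨h1, h2, h3⟩ => weights_nonempty h1 h2 h3⟩

theorem range_Psi_eq [Finite ι] (T : IdealTriangulation ι) (lam : ℝ) : Set.range (T.Psi lam) =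
      {z : T.Edge → ℝ |
        (∀ e : T.Edge, (z e : EReal) < ((2 * coshIntegral lam : ENNReal) : EReal)) ∧
        (∀ c : List (ι × Fin 3), T.IsEdgePath c → T.IsFundamental c →
          -((2 * coshIntegral lam : ENNReal) : EReal) < (T.pathSum z c : EReal)) ∧
        (∀ c : List (ι × Fin 3), T.IsEdgeCycle c → T.IsFundamental c → 0 < T.pathSum z c)} := by
  ext z
  simp only [Set.mem_ofPred_eq, coe_lt_two_mul_iff, neg_two_mul_lt_coe_iff]
  constructor
  · rw [mem_range_Psi_iff]
    rintro ⟨w, hw⟩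
    exact ⟨fun e hW => edge_lt_of_mem_weights hw hW e,
      fun c hc _ hW => lt_pathSum_of_mem_weights hw hW hc,
      fun c hc _ => pathSum_pos_of_mem_weights hw hc⟩
  · rintro ⟨h1, h2, h3⟩
    exact mem_range_Psi_iff_nodup.2 ⟨h1, fun c hn hc => h2 c hc (isFundamental_of_nodup hn),
      fun c hn hc => h3 c hc (isFundamental_of_nodup hn)⟩

/-- `pathSum` as a linear functional. -/
def pathSumLinear (T : IdealTriangulation ι) (c : List (ι × Fin 3)) : (T.Edge → ℝ) →ₗ[ℝ] ℝ where
  toFun z := T.pathSum z c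
  map_add' x y := by simp [pathSum, List.sum_map_add]
  map_smul' a x := by simp [pathSum, List.sum_map_mul_left]

end IdealTriangulation

/-! ### The polytope and the comparison of different parameters -/

theorem isOpenConvexPolytope_of_finite {E : Type*} [Finite E]
    {A : Set (((E → ℝ) →ₗ[ℝ] ℝ) × ℝ)} (hA : A.Finite) :
    IsOpenConvexPolytope {z | ∀ a ∈ A, a.1 z < a.2} := by
  have e : {z : E → ℝ | ∀ a ∈ A, a.1 z < a.2} = ⋂ a ∈ A, {z | a.1 z < a.2} := by
    ext z; simp
  refine ⟨?_, ?_, A, hA, rfl⟩ <;> rw [e]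
  · exact hA.isOpen_biInter fun a _ =>
      isOpen_lt a.1.continuous_of_finiteDimensional continuous_const
  · exact convex_iInter₂ fun a _ => convex_halfSpace_lt a.1.isLinear a.2

namespace IdealTriangulation

variable {ι : Type*} {T : IdealTriangulation ι} {lam : ℝ} {z : T.Edge → ℝ}

theorem isOpenConvexPolytope_range_Psi [Finite ι] (T : IdealTriangulation ι) (lam : ℝ) :
    IsOpenConvexPolytope (Set.range (T.Psi lam)) := by
  have := T.finite_edge
  set W := coshIntegral lam
  -- The condition `W ≠ ⊤` makes the index sets of `A₁` and `A₂` empty when the integral is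
  -- infinite, so that the corresponding inequalities disappear.
  let A₁ : Set (((T.Edge → ℝ) →ₗ[ℝ] ℝ) × ℝ) :=
    (fun e => (LinearMap.proj e, 2 * W.toReal)) '' {_e : T.Edge | W ≠ ⊤}
  let A₂ : Set (((T.Edge → ℝ) →ₗ[ℝ] ℝ) × ℝ) :=
    (fun c => (-T.pathSumLinear c, 2 * W.toReal)) '' {c | c.Nodup ∧ T.IsEdgePath c ∧ W ≠ ⊤}
  let A₃ : Set (((T.Edge → ℝ) →ₗ[ℝ] ℝ) × ℝ) :=
    (fun c => (-T.pathSumLinear c, 0)) '' {c | c.Nodup ∧ T.IsEdgeCycle c}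
  have hlists := finite_nodup_lists (ι × Fin 3)
  have hA : (A₁ ∪ A₂ ∪ A₃).Finite :=
    (((Set.toFinite _).image _).union ((hlists.subset fun c hc => hc.1).image _)).union
      ((hlists.subset fun c hc => hc.1).image _)
  convert isOpenConvexPolytope_of_finite hA using 1
  ext z
  rw [mem_range_Psi_iff_nodup]
  simp only [Set.mem_ofPred_eq, A₁, A₂, A₃, Set.mem_union, or_imp, forall_and,
    Set.forall_mem_image, and_imp, LinearMap.neg_apply, LinearMap.proj_apply, neg_lt, neg_zero,
    and_assoc]
  rfl

theorem weights_mono {lam₁ lam₂ : ℝ} (h : coshIntegral lam₁ ≤ coshIntegral lam₂) :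
    T.weights lam₁ z ⊆ T.weights lam₂ z := fun _ hw =>
  ⟨fun k => ⟨fun i => mem_range_coshPrimitive.2
    ((mem_range_coshPrimitive.1 ((hw.1 k).1 i)).trans_le h), (hw.1 k).2⟩, hw.2⟩

theorem range_Psi_subset [Finite ι] {lam₁ lam₂ : ℝ} (h : coshIntegral lam₁ ≤ coshIntegral lam₂) :
    Set.range (T.Psi lam₁) ⊆ Set.range (T.Psi lam₂) := fun _ hz =>
  mem_range_Psi_iff.2 ((mem_range_Psi_iff.1 hz).mono (weights_mono h))

theorem range_Psi_ssubset [Finite ι] [Nonempty ι] {lam₁ lam₂ : ℝ}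
    (h : coshIntegral lam₁ < coshIntegral lam₂) :
    Set.range (T.Psi lam₁) ⊂ Set.range (T.Psi lam₂) := by
  refine ⟨range_Psi_subset h.le, fun hsub => ?_⟩
  set a := (coshIntegral lam₁).toReal with ha
  have hpos : 0 < a := ENNReal.toReal_pos (coshIntegral_pos lam₁).ne' h.ne_top
  -- The constant invariant `2 * a` lies on the boundary for `lam₁`, where the edge bound is strict,
  -- while equal weights `a` realize it for `lam₂`.
  have hmem : (fun _ => 2 * a) ∈ Set.range (T.Psi lam₂) := by
    refine mem_range_Psi_iff.2 ⟨fun _ => a, fun k => ⟨fun i => mem_range_coshPrimitive.2 ?_,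
      fun i => add_pos hpos hpos⟩, fun s => (two_mul a).symm⟩
    rw [row, abs_of_pos hpos, ha, ENNReal.ofReal_toReal h.ne_top]
    exact h
  have hlt := (mem_range_Psi_iff_nodup.1 (hsub hmem)).1 (T.edge (Classical.arbitrary ι, 0)) h.ne_top
  exact lt_irrefl _ hlt

/-- The weights of each hexagon have positive total, so `z` is positive on some edge; the edge bound
fails there once the integral is small enough. -/
theorem iInter_range_Psi_eq_empty [Finite ι] [Nonempty ι] (T : IdealTriangulation ι) :
    (⋂ lam ∈ Set.Iio (0 : ℝ), Set.range (T.Psi lam)) = ∅ := by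
  refine Set.eq_empty_iff_forall_notMem.2 fun z hz => ?_
  rw [Set.mem_iInter₂] at hz
  have := Fintype.ofFinite ι
  obtain ⟨w, hw⟩ := mem_range_Psi_iff.1 (hz (-1) (by simp))
  have hsum : 0 < ∑ s, z (T.edge s) := by
    rw [← two_mul_sum_eq hw.2, Fintype.sum_prod_type]
    refine mul_pos two_pos (Finset.sum_pos (fun h _ => ?_) Finset.univ_nonempty)
    have h0 : 0 < w (h, 0) + w (h, 1) := pair_pos (hw.1 h).2 (by decide)
    have h1 : 0 < w (h, 1) + w (h, 2) := pair_pos (hw.1 h).2 (by decide)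
    have h2 : 0 < w (h, 2) + w (h, 0) := pair_pos (hw.1 h).2 (by decide)
    rw [Fin.sum_univ_three]
    linarith
  obtain ⟨s, -, hs⟩ := Finset.exists_lt_of_sum_lt (f := fun _ => (0 : ℝ)) (by simpa using hsum)
  obtain ⟨lam, hlam, hlt⟩ := exists_coshIntegral_lt
    (ENNReal.ofReal_pos.2 (half_pos hs))
  have h1 := (mem_range_Psi_iff_nodup.1 (hz lam hlam)).1 (T.edge s) hlt.ne_top
  have h2 := (ENNReal.lt_ofReal_iff_toReal_lt hlt.ne_top).1 hlt
  linarith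

end IdealTriangulation

end LuoCoord

end

theorem theorem1p3 {ι : Type*} [Finite ι] [Nonempty ι] (T : LuoCoord.IdealTriangulation ι) :
    (∀ lam : ℝ, Set.range (T.Psi lam) =
      {z : T.Edge → ℝ |
        (∀ e : T.Edge, (z e : EReal) < ((2 * LuoCoord.coshIntegral lam : ENNReal) : EReal)) ∧
        (∀ c : List (ι × Fin 3), T.IsEdgePath c → T.IsFundamental c →
          -((2 * LuoCoord.coshIntegral lam : ENNReal) : EReal) < (T.pathSum z c : EReal)) ∧
        (∀ c : List (ι × Fin 3), T.IsEdgeCycle c → T.IsFundamental c → 0 < T.pathSum z c)}) ∧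
    (∀ lam : ℝ, LuoCoord.IsOpenConvexPolytope (Set.range (T.Psi lam))) ∧
    (∀ lam₁ lam₂ lam₃ : ℝ, lam₁ < lam₂ → lam₂ < 0 → 0 < lam₃ →
      Set.range (T.Psi lam₁) ⊂ Set.range (T.Psi lam₂) ∧
      Set.range (T.Psi lam₂) ⊂ Set.range (T.Psi 0) ∧
      Set.range (T.Psi 0) = Set.range (T.Psi lam₃)) ∧
    (⋂ lam ∈ Set.Iio (0 : ℝ), Set.range (T.Psi lam)) = ∅ := by
  refine ⟨T.range_Psi_eq, T.isOpenConvexPolytope_range_Psi, fun lam₁ lam₂ lam₃ h12 h2 h3 => ?_,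
    T.iInter_range_Psi_eq_empty⟩
  have e0 : LuoCoord.coshIntegral 0 = ⊤ := LuoCoord.coshIntegral_of_nonneg le_rfl
  have e3 : LuoCoord.coshIntegral lam₃ = ⊤ := LuoCoord.coshIntegral_of_nonneg h3.le
  exact ⟨LuoCoord.IdealTriangulation.range_Psi_ssubset (LuoCoord.coshIntegral_strictMonoOn h12 h2),
    LuoCoord.IdealTriangulation.range_Psi_ssubset (e0 ▸ LuoCoord.coshIntegral_lt_top h2),
    (LuoCoord.IdealTriangulation.range_Psi_subset (e0.trans e3.symm).le).antisymm
      (LuoCoord.IdealTriangulation.range_Psi_subset (e3.trans e0.symm).le)⟩
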